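/- Let $G$ be a compact Lie group and $H\subset G$ a compact subgroup, with Lie algebras $\mathfrak h\subset\mathfrak g$ (neither group need be connected). Fix an $\mathrm{Ad}_G$-invariant inner product $Q$ on $\mathfrak g$; orthogonal complements are taken with respect to $Q$, and $\mathfrak m=\mathfrak h^\perp$ is identified with the tangent space of $G/H$ at the base point. An \emph{intermediate subgroup} is a (not necessarily closed) Lie subgroup $K$ of $G$ with Lie algebra $\mathfrak k$ such that $H\subset K\subset G$ and $\mathfrak h\subsetneq\mathfrak k\subsetneq\mathfrak g$; we say that $H$ is \emph{not maximal} in $G$ if an intermediate subgroup exists. Homogeneous metrics on $G/H$, $K/H$ and $G/K$ are identified with the $\mathrm{Ad}_H$-invariant inner products on $\mathfrak m$, the $\mathrm{Ad}_H$-invariant inner products on $\mathfrak k\cap\mathfrak m$, and the $\mathrm{Ad}_K$-invariant inner products on $\mathfrak k^\perp$, respectively (if $K$ is not closed, $G/K$ is understood locally); denote these sets by $\mathcal M(G/H)$, $\mathcal M(K/H)$, $\mathcal M(G/K)$. Let $\operatorname{Ric}(g)$ and $S(g)$ be the Ricci and scalar curvatures (at the base point) of the Levi-Civita connection of a homogeneous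 metric $g$, and let $\operatorname{tr}_g$ denote the trace of a bilinear form with respect to $g$. Let $T$ be a positive-definite $G$-invariant symmetric $(0,2)$-tensor field on $G/H$, i.e. a positive-definite $\mathrm{Ad}_H$-invariant symmetric bilinear form on $\mathfrak m$. Put $$\mathcal M_T=\{g\in\mathcal M(G/H)\mid \operatorname{tr}_gT=1\},$$ $$\alpha_{\mathfrak k}=\sup\{S(h)\mid h\in\mathcal M(K/H),\ \operatorname{tr}_h(T|_{\mathfrak k\cap\mathfrak m})=1\},\qquad \beta_{\mathfrak k}=\sup\{S(h)\mid h\in\mathcal M(G/K),\ \operatorname{tr}_h(T|_{\mathfrak k^\perp})=1\},$$ and $\alpha_{G/H}=\sup_{\mathfrak k}\alpha_{\mathfrak k}$, the supremum over the Lie algebras $\mathfrak k$ of all intermediate subgroups. \textbf{Theorem.} Suppose $H$ is not maximal in $G$. Then there exists an intermediate subgroup $K$ with $\alpha_{\mathfrak k}=\alpha_{G/H}$. Moreover, if $K$ is an intermediate subgroup of the lowest possible dimension among all those with $\alpha_{\mathfrak k}=\alpha_{G/H}$, and if $\beta_{\mathfrak k}-\alpha_{\mathfrak k}>0$, then there is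 a metric $g\in\mathcal M_T$ at which $S|_{\mathcal M_T}$ attains its global maximum, and $\operatorname{Ric}(g)=cT$ for some $c>0$. -/

import Mathlib

open scoped Manifold ContDiff

noncomputable section

/-! ### Linear algebra of inner products -/

/-- A positive-definite symmetric bilinear form (an inner product) on a real vector space. -/
structure InnerForm (V : Type*) [AddCommGroup V] [Module ℝ V] where
  form : LinearMap.BilinForm ℝ V
  symm : ∀ x y, form x y = form y x
  pos : ∀ x, x ≠ 0 → 0 < form x x

namespace InnerForm

variable {V : Type*} [AddCommGroup V] [Module ℝ V]

theorem nondegenerate (g : InnerForm V) : g.form.Nondegenerate := by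
  constructor
  · intro x hx
    by_contra h
    exact (g.pos x h).ne' (hx x)
  · intro x hx
    by_contra h
    exact (g.pos x h).ne' (hx x)

/-- The restriction of an inner product to a subspace. -/
def restrict (g : InnerForm V) (W : Submodule ℝ V) : InnerForm W where
  form := g.form.restrict W
  symm x y := g.symm x y
  pos x hx := g.pos x (fun h => hx (Subtype.ext h))

variable [FiniteDimensional ℝ V]

/-- The vector representing a linear functional `f`, i.e. `g (g.sharp f) v = f v`. -/
def sharp (g : InnerForm V) : Module.Dual ℝ V →ₗ[ℝ] V :=
  (g.form.toDual g.nondegenerate).symm.toLinearMap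

/-- The trace `tr_g b` of a bilinear form `b` with respect to the inner product `g`: the trace of
the endomorphism `A` with `g (A v) w = b v w`. -/
def traceForm (g : InnerForm V) (b : LinearMap.BilinForm ℝ V) : ℝ :=
  LinearMap.trace ℝ V (g.sharp ∘ₗ b)

/-- The orthogonal projection onto a subspace. -/
def proj (Q : InnerForm V) (W : Submodule ℝ V) : V →ₗ[ℝ] W :=
  (Q.restrict W).sharp ∘ₗ (Submodule.dualRestrict W) ∘ₗ Q.form

end InnerForm

/-- Restriction of a bilinear form on the subspace `W` to a smaller subspace `W'`. -/
def restrictForm {V : Type*} [AddCommGroup V] [Module ℝ V] {W W' : Submodule ℝ V}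
    (b : LinearMap.BilinForm ℝ W) (h : W' ≤ W) : LinearMap.BilinForm ℝ W' :=
  b.compl₁₂ (Submodule.inclusion h) (Submodule.inclusion h)

/-! ### Curvature of a homogeneous metric

Let `L` be a Lie group with Lie algebra `𝔩`, let `P` be a Lie subgroup with Lie algebra `𝔭`, and
let `𝔩 = 𝔭 ⊕ W` be the `Q`-orthogonal splitting, where `Q` is a bi-invariant inner product (on a Lie
algebra `𝔤` containing `𝔩`).  The space `W` is the tangent space of `L/P` at the base point, and the
`L`-invariant metrics on `L/P` are the `Ad_P`-invariant inner products `g` on `W`.  The Levi-Civita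
connection of the metric is the `L`-invariant affine connection given by a bilinear map
`Λ : W × W → W`, the unique one which is metric, `g (Λ X Y) Z + g Y (Λ X Z) = 0`, and torsion-free,
`Λ X Y - Λ Y X = [X, Y]_W`.  For `X`, `Y` in `W`, the component of `[X, Y]` in `𝔭` is
`[X, Y] - [X, Y]_W`, so everything is expressed through `W`.  All tensors are evaluated at the base
point, which determines them by invariance. -/

section Curvature

variable {𝔤 : Type*} [LieRing 𝔤] [LieAlgebra ℝ 𝔤] [FiniteDimensional ℝ 𝔤]

/-- The component `[X, Y]_W` in `W` of the bracket of two elements of `W`. -/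
def bracketProj (Q : InnerForm 𝔤) (W : Submodule ℝ 𝔤) : W →ₗ[ℝ] W →ₗ[ℝ] W :=
  LinearMap.mk₂ ℝ (fun X Y => Q.proj W ⁅(X : 𝔤), (Y : 𝔤)⁆)
    (by intros; simp) (by intros; simp) (by intros; simp) (by intros; simp)

/-- The right-hand side of the Koszul formula,
`Z ↦ (g [X,Y]_W Z + g [Z,X]_W Y + g [Z,Y]_W X) / 2`. -/
def koszulForm (Q : InnerForm 𝔤) (W : Submodule ℝ 𝔤) (g : InnerForm W) (X Y : W) :
    Module.Dual ℝ W where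
  toFun Z := (g.form (bracketProj Q W X Y) Z + g.form (bracketProj Q W Z X) Y
    + g.form (bracketProj Q W Z Y) X) / 2
  map_add' Z Z' := by simp only [map_add, LinearMap.add_apply]; ring
  map_smul' c Z := by
    simp only [map_smul, LinearMap.smul_apply, smul_eq_mul, RingHom.id_apply]; ring

/-- The Levi-Civita connection `Λ X Y` at the base point, given by the Koszul formula
`2 g (Λ X Y) Z = g [X,Y]_W Z + g [Z,X]_W Y + g [Z,Y]_W X`. -/
def leviCivita (Q : InnerForm 𝔤) (W : Submodule ℝ 𝔤) (g : InnerForm W) : W →ₗ[ℝ] W →ₗ[ℝ] W :=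
  LinearMap.mk₂ ℝ (fun X Y => g.sharp (koszulForm Q W g X Y))
    (by
      intro X X' Y
      rw [← map_add]; congr 1; ext Z
      simp only [koszulForm, LinearMap.coe_mk, AddHom.coe_mk, map_add, LinearMap.add_apply]; ring)
    (by
      intro c X Y
      rw [← map_smul]; congr 1; ext Z
      simp only [koszulForm, LinearMap.coe_mk, AddHom.coe_mk, map_smul, LinearMap.smul_apply,
        smul_eq_mul]; ring)
    (by
      intro X Y Y'
      rw [← map_add]; congr 1; ext Z
      simp only [koszulForm, LinearMap.coe_mk, AddHom.coe_mk, map_add, LinearMap.add_apply]; ring)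
    (by
      intro c X Y
      rw [← map_smul]; congr 1; ext Z
      simp only [koszulForm, LinearMap.coe_mk, AddHom.coe_mk, map_smul, LinearMap.smul_apply,
        smul_eq_mul]; ring)

theorem form_leviCivita (Q : InnerForm 𝔤) (W : Submodule ℝ 𝔤) (g : InnerForm W) (X Y Z : W) :
    g.form (leviCivita Q W g X Y) Z = koszulForm Q W g X Y Z :=
  LinearMap.BilinForm.apply_toDual_symm_apply (hB := g.nondegenerate) _ _

theorem bracketProj_swap (Q : InnerForm 𝔤) (W : Submodule ℝ 𝔤) (X Y : W) :
    bracketProj Q W X Y = -bracketProj Q W Y X := by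
  simp only [bracketProj, LinearMap.mk₂_apply, ← map_neg, lie_skew]

/-- The Levi-Civita connection is metric. -/
theorem leviCivita_metric (Q : InnerForm 𝔤) (W : Submodule ℝ 𝔤) (g : InnerForm W) (X Y Z : W) :
    g.form (leviCivita Q W g X Y) Z + g.form Y (leviCivita Q W g X Z) = 0 := by
  rw [g.symm Y, form_leviCivita, form_leviCivita]
  simp only [koszulForm, LinearMap.coe_mk, AddHom.coe_mk]
  rw [bracketProj_swap Q W Z X, bracketProj_swap Q W Z Y, bracketProj_swap Q W Y X]
  simp only [map_neg, LinearMap.neg_apply]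
  ring

/-- The Levi-Civita connection is torsion-free. -/
theorem leviCivita_torsion (Q : InnerForm 𝔤) (W : Submodule ℝ 𝔤) (g : InnerForm W) (X Y : W) :
    leviCivita Q W g X Y - leviCivita Q W g Y X = bracketProj Q W X Y := by
  apply (g.form.toDual g.nondegenerate).injective
  ext Z
  rw [LinearMap.BilinForm.toDual_def, LinearMap.BilinForm.toDual_def]
  simp only [map_sub, LinearMap.sub_apply, form_leviCivita]
  simp only [koszulForm, LinearMap.coe_mk, AddHom.coe_mk]
  rw [bracketProj_swap Q W Y X]
  simp only [map_neg, LinearMap.neg_apply]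
  ring

/-- The Riemann curvature tensor at the base point,
`R(X,Y)Z = Λ X (Λ Y Z) - Λ Y (Λ X Z) - Λ [X,Y]_W Z - [[X,Y]_𝔭, Z]`. -/
def riemann (Q : InnerForm 𝔤) (W : Submodule ℝ 𝔤) (g : InnerForm W) (X Y Z : W) : W :=
  leviCivita Q W g X (leviCivita Q W g Y Z) - leviCivita Q W g Y (leviCivita Q W g X Z)
    - leviCivita Q W g (bracketProj Q W X Y) Z
    - Q.proj W ⁅⁅(X : 𝔤), (Y : 𝔤)⁆ - (bracketProj Q W X Y : 𝔤), (Z : 𝔤)⁆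

/-- The endomorphism `X ↦ R(X,Y)Z`. -/
def riemannEnd (Q : InnerForm 𝔤) (W : Submodule ℝ 𝔤) (g : InnerForm W) (Y Z : W) : W →ₗ[ℝ] W where
  toFun X := riemann Q W g X Y Z
  map_add' X X' := by
    simp only [riemann, map_add, LinearMap.add_apply, Submodule.coe_add, add_lie, sub_lie,
      map_sub]
    abel
  map_smul' c X := by
    simp only [riemann, map_smul, LinearMap.smul_apply, Submodule.coe_smul, smul_lie, sub_lie,
      map_sub, smul_sub, RingHom.id_apply]

/-- The Ricci tensor at the base point, `Ric(Y,Z) = tr (X ↦ R(X,Y)Z)`. -/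
def ricci (Q : InnerForm 𝔤) (W : Submodule ℝ 𝔤) (g : InnerForm W) : LinearMap.BilinForm ℝ W :=
  LinearMap.mk₂ ℝ (fun Y Z => LinearMap.trace ℝ W (riemannEnd Q W g Y Z))
    (by
      intro Y Y' Z
      rw [← map_add]; congr 1; ext1 X
      simp only [riemannEnd, riemann, LinearMap.coe_mk, AddHom.coe_mk, map_add,
        LinearMap.add_apply, Submodule.coe_add, lie_add, add_lie, sub_lie, map_sub]
      abel)
    (by
      intro c Y Z
      rw [← map_smul]; congr 1; ext1 X
      simp only [riemannEnd, riemann, LinearMap.coe_mk, AddHom.coe_mk, map_smul,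
        LinearMap.smul_apply, Submodule.coe_smul, lie_smul, smul_lie, sub_lie, map_sub, smul_sub])
    (by
      intro Y Z Z'
      rw [← map_add]; congr 1; ext1 X
      simp only [riemannEnd, riemann, LinearMap.coe_mk, AddHom.coe_mk, map_add,
        LinearMap.add_apply, Submodule.coe_add, lie_add]
      abel)
    (by
      intro c Y Z
      rw [← map_smul]; congr 1; ext1 X
      simp only [riemannEnd, riemann, LinearMap.coe_mk, AddHom.coe_mk, map_smul,
        LinearMap.smul_apply, Submodule.coe_smul, lie_smul, smul_sub])

/-- The scalar curvature, `S(g) = tr_g Ric(g)`. -/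
def scalarCurvature (Q : InnerForm 𝔤) (W : Submodule ℝ 𝔤) (g : InnerForm W) : ℝ :=
  g.traceForm (ricci Q W g)

end Curvature

/-! ### Lie groups and Lie subgroups -/

section LieGroups

variable (n : ℕ) (G : Type*) [TopologicalSpace G] [ChartedSpace (EuclideanSpace ℝ (Fin n)) G]
  [Group G]

instance instLieGroupMinSmoothness [LieGroup (𝓡 n) ∞ G] :
    LieGroup (𝓡 n) (minSmoothness ℝ 3) G :=
  LieGroup.of_le (n := ∞)
    (by simp only [minSmoothness_of_isRCLikeNormedField]; exact ENat.LEInfty.out)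

instance instFiniteDimensionalGroupLieAlgebra :
    FiniteDimensional ℝ (GroupLieAlgebra (𝓡 n) G) :=
  inferInstanceAs (FiniteDimensional ℝ (EuclideanSpace ℝ (Fin n)))

variable {n G}

/-- The adjoint representation: `Ad a` is the differential at `1` of `x ↦ a x a⁻¹`. -/
def Ad (a : G) : GroupLieAlgebra (𝓡 n) G →ₗ[ℝ] GroupLieAlgebra (𝓡 n) G where
  toFun X := mfderiv (𝓡 n) (𝓡 n) (fun x : G => a * x * a⁻¹) 1 X
  map_add' X Y := map_add _ X Y
  map_smul' c X := map_smul (mfderiv (𝓡 n) (𝓡 n) (fun x : G => a * x * a⁻¹) 1) c X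

/-- `IsExp X a` says that `a = exp X`: the integral curve through `1` of the left-invariant vector
field defined by `X` is at `a` at time `1`. -/
def IsExp (X : GroupLieAlgebra (𝓡 n) G) (a : G) : Prop :=
  ∃ γ : ℝ → G, γ 0 = 1 ∧ IsMIntegralCurve (I := 𝓡 n) γ (mulInvariantVectorField X) ∧ γ 1 = a

variable [LieGroup (𝓡 n) ∞ G]

/-- The subgroup generated by `exp 𝔨`, i.e. the connected Lie subgroup with Lie algebra `𝔨`. -/
def expSubgroup (𝔨 : LieSubalgebra ℝ (GroupLieAlgebra (𝓡 n) G)) : Subgroup G :=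
  Subgroup.closure {a | ∃ X ∈ 𝔨, IsExp X a}

variable (n G) in
/-- A (not necessarily closed or connected) Lie subgroup of `G` together with its Lie algebra:
a subgroup `K` and a subalgebra `𝔨` such that the connected Lie subgroup with Lie algebra `𝔨`
has countable index in `K` and `K` normalizes `𝔨`.  These are exactly the subgroups that carry the
structure of a second countable Lie group for which the inclusion into `G` is an immersion with
tangent space `𝔨` at the identity; `expSubgroup 𝔨` is then the identity component. -/
structure LieSubgroup where
  toSubgroup : Subgroup G
  lieAlg : LieSubalgebra ℝ (GroupLieAlgebra (𝓡 n) G)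
  expSubgroup_le : expSubgroup lieAlg ≤ toSubgroup
  countable_components : Countable (toSubgroup ⧸ (expSubgroup lieAlg).subgroupOf toSubgroup)
  Ad_mem : ∀ a ∈ toSubgroup, ∀ X ∈ lieAlg, Ad a X ∈ lieAlg

variable (n G) in
/-- A bi-invariant metric on `G`: an `Ad_G`-invariant inner product on the Lie algebra. -/
structure BiinvariantMetric extends InnerForm (GroupLieAlgebra (𝓡 n) G) where
  inv : ∀ (a : G) (X Y), form (Ad a X) (Ad a Y) = form X Y

/-- An `Ad_L`-invariant positive-definite symmetric bilinear form on the subspace `W` of the Lie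
algebra.  When `W` is the orthogonal complement of the Lie algebra of `L` in a larger subalgebra,
these are the invariant Riemannian metrics on the corresponding homogeneous space with isotropy
group `L`, and likewise the invariant positive-definite symmetric (0,2)-tensor fields. -/
structure InvariantMetric (L : Subgroup G) (W : Submodule ℝ (GroupLieAlgebra (𝓡 n) G))
    extends InnerForm W where
  inv : ∀ a ∈ L, ∀ (x y : W) (hx : Ad a (x : GroupLieAlgebra (𝓡 n) G) ∈ W)
    (hy : Ad a (y : GroupLieAlgebra (𝓡 n) G) ∈ W),
    form ⟨Ad a (x : GroupLieAlgebra (𝓡 n) G), hx⟩ ⟨Ad a (y : GroupLieAlgebra (𝓡 n) G), hy⟩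
      = form x y

namespace LieSubgroup

variable (Q : BiinvariantMetric n G) (H K : LieSubgroup n G)

/-- The `Q`-orthogonal complement `𝔥^⊥` in `𝔤`, the tangent space of `G/H` at the base point. -/
def perp : Submodule ℝ (GroupLieAlgebra (𝓡 n) G) :=
  Q.form.orthogonal H.lieAlg.toSubmodule

/-- The space `𝔨 ∩ 𝔥^⊥`, the tangent space of `K/H` at the base point. -/
def fiber : Submodule ℝ (GroupLieAlgebra (𝓡 n) G) :=
  K.lieAlg.toSubmodule ⊓ H.perp Q

theorem fiber_le_perp : H.fiber Q K ≤ H.perp Q := inf_le_right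

variable {H K} in
theorem perp_le_perp (h : H.lieAlg ≤ K.lieAlg) : K.perp Q ≤ H.perp Q :=
  LinearMap.BilinForm.orthogonal_le h

/-- `K` is an intermediate subgroup, `H ⊂ K ⊂ G`, where `𝔥 ⊂ 𝔨 ⊂ 𝔤` are proper inclusions. -/
def IsIntermediate : Prop :=
  H.toSubgroup ≤ K.toSubgroup ∧ H.lieAlg < K.lieAlg ∧ K.lieAlg < ⊤

/-- The set `𝓜_T` of `G`-invariant metrics `g` on `G/H` with `tr_g T = 1`. -/
def metricsT (T : InvariantMetric H.toSubgroup (H.perp Q)) :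
    Set (InvariantMetric H.toSubgroup (H.perp Q)) :=
  {g | g.traceForm T.form = 1}

/-- The invariant `α_𝔨`: the supremum of the scalar curvatures of the homogeneous metrics `h` on
`K/H` such that the restriction of `T` to `𝔨 ∩ 𝔥^⊥` has `h`-trace `1`. -/
def alpha (T : InvariantMetric H.toSubgroup (H.perp Q)) : EReal :=
  ⨆ h ∈ {h : InvariantMetric H.toSubgroup (H.fiber Q K) |
      h.traceForm (restrictForm T.form (H.fiber_le_perp Q K)) = 1},
    ((scalarCurvature Q.toInnerForm (H.fiber Q K) h.toInnerForm : ℝ) : EReal)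

variable {H K} in
/-- The invariant `β_𝔨`: the supremum of the scalar curvatures of the homogeneous metrics `h` on
`G/K` such that the restriction of `T` to `𝔨^⊥` has `h`-trace `1`. -/
def beta (T : InvariantMetric H.toSubgroup (H.perp Q)) (hK : H.IsIntermediate K) : EReal :=
  ⨆ h ∈ {h : InvariantMetric K.toSubgroup (K.perp Q) |
      h.traceForm (restrictForm T.form (perp_le_perp Q hK.2.1.le)) = 1},
    ((scalarCurvature Q.toInnerForm (K.perp Q) h.toInnerForm : ℝ) : EReal)

/-- The invariant `α_{G/H}`: the supremum of `α_𝔨` over all intermediate subgroups. -/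
def alphaTotal (T : InvariantMetric H.toSubgroup (H.perp Q)) : EReal :=
  ⨆ K ∈ {K : LieSubgroup n G | H.IsIntermediate K}, H.alpha Q K T

end LieSubgroup

end LieGroups

end

/-! A metric `g` with `tr_g T = 1` is recorded by a `Q`-orthonormal frame `b` diagonalizing it, with
eigenvalues `1 / y i`. The scalar curvature is then an explicit function `scal` of the weights `y`
and the structure constants of `b` (`scalarCurvature_eq_scal`), and the trace condition becomes `∑ y
i * T (b i) (b i) = 1`. Since `T ≥ τ Q` on `𝔥^⊥`, all weights are at most `1 / τ`, so frames have
convergent subsequences; compactness fails only because some `y i` may tend to `0`.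

`IsAdmissibleFrame.limit` controls this degeneration. A term `q i j k * y i * y j / y k` stays
bounded when `S` does, so brackets of surviving directions (those with positive limiting weight)
have no component along lost ones: the surviving directions span a `W` for which `𝔥 + W` is a
subalgebra. Moreover the limit of `S` is at most the scalar curvature of the limiting metric on `W`.
By `LieSubgroup.Admissible.exists_isIntermediate`, a proper `W` is the tangent space of `K/H` for an
intermediate `K`. Hence suprema of `S` are dominated by genuine metrics, possibly on a smaller space
(`exists_admissible_forall_le`).

This principle is used three times. Over all intermediate `K`, with a dimension bound that excludes
`𝔥^⊥` itself, it produces a `K` with `α_𝔨 = α_{G/H}`. For a single such `K` of lowest dimension, a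
degeneration would give a smaller intermediate subgroup with the same `α`, so `α_𝔨` is attained on
`K/H`. On `G/H`, a degeneration forces `S ≤ α_{G/H}`, so a maximum exists as soon as some metric has
`S > α_{G/H}`.

Such a metric comes from the fibration `K/H → G/H → G/K`: weights `(1 - t) y` on the fiber and `t
y'` on the base keep the trace equal to one, and `S = (1 - t) S(fiber) + t S(base) - C t² / (1 - t)`
(`exists_scal_sumElim_eq`). If the fiber attains `α_𝔨` and the base exceeds it, the linear gain wins
for small `t`.

At the maximum, varying `g` along `Ric - S T` gives `Ric = S T` (`ricci_eq_of_scalarCurvature_le`),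
and `S > α_𝔨 ≥ 0` because a multiple of `Q` has non-negative scalar curvature. The Lie group input
is `d/dt Ad (exp tX) = ad X` (`hasDerivAt_Ad_zero`), which passes between `Ad`-invariance and
bracket conditions. -/

open Filter Topology

set_option linter.unusedSectionVars false
set_option linter.unusedSimpArgs false

/-! ### Second-order calculus of a local group law -/

section Calculus

variable {E : Type*} [NormedAddCommGroup E] [NormedSpace ℝ E]

/-- The partial derivative in the second variable, as an application of the total derivative. -/
theorem fderiv_snd_eventuallyEq {F : E × E → E} {e : E} (hF : ContDiffAt ℝ 2 F (e, e)) (Y : E) :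
    (fun x => fderiv ℝ (fun z => F (x, z)) e Y) =ᶠ[𝓝 e] fun x => fderiv ℝ F (x, e) (0, Y) := by
  have h1 : ∀ᶠ p in 𝓝 (e, e), DifferentiableAt ℝ F p :=
    (hF.eventually (by simp)).mono fun p hp => hp.differentiableAt (by norm_num)
  have h2 : Tendsto (fun x : E => (x, e)) (𝓝 e) (𝓝 (e, e)) :=
    (Continuous.prodMk_left e).tendsto e
  filter_upwards [h2.eventually h1] with x hx
  have h3 : HasFDerivAt (fun z : E => (x, z)) (ContinuousLinearMap.inr ℝ E E) e :=
    hasFDerivAt_prodMk_right x e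
  have := (HasFDerivAt.comp e (hx.hasFDerivAt) h3).fderiv
  rw [show (fun z => F (x, z)) = F ∘ (fun z : E => (x, z)) from rfl, this]
  simp

/-- The infinitesimal version of the relation `x z = (x z x⁻¹) x` in local coordinates of a
group. -/
theorem hasFDerivAt_conj {F C : E × E → E} {e : E} (hF : ContDiffAt ℝ 2 F (e, e))
    (hC : ContDiffAt ℝ 2 C (e, e)) (hF1 : ∀ᶠ x in 𝓝 e, F (x, e) = x)
    (hC1 : ∀ᶠ x in 𝓝 e, C (x, e) = e) (hC2 : ∀ᶠ z in 𝓝 e, C (e, z) = z)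
    (h : ∀ᶠ p in 𝓝 (e, e), F p = F (C p, p.1)) (Y : E) :
    DifferentiableAt ℝ (fun x => fderiv ℝ (fun z => C (x, z)) e Y) e ∧
    ∀ X, fderiv ℝ (fun x => fderiv ℝ (fun z => C (x, z)) e Y) e X =
      fderiv ℝ (fun x => fderiv ℝ (fun z => F (x, z)) e Y) e X -
      fderiv ℝ (fun x => fderiv ℝ (fun z => F (x, z)) e X) e Y := by
  have hl : HasFDerivAt (fun x : E => (x, e)) (ContinuousLinearMap.inl ℝ E E) e :=
    hasFDerivAt_prodMk_left e e
  have hr : HasFDerivAt (fun x : E => (e, x)) (ContinuousLinearMap.inr ℝ E E) e :=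
    hasFDerivAt_prodMk_right e e
  have hCe : C (e, e) = e := hC1.self_of_nhds
  have dF : DifferentiableAt ℝ (fderiv ℝ F) (e, e) :=
    (hF.fderiv_right (m := 1) (by norm_num)).differentiableAt (by norm_num)
  have dC : DifferentiableAt ℝ (fderiv ℝ C) (e, e) :=
    (hC.fderiv_right (m := 1) (by norm_num)).differentiableAt (by norm_num)
  have dF0 : DifferentiableAt ℝ F (e, e) := hF.differentiableAt (by norm_num)
  have dC0 : DifferentiableAt ℝ C (e, e) := hC.differentiableAt (by norm_num)
  -- derivative of the partial derivatives
  have key : ∀ {K : E × E → E}, ContDiffAt ℝ 2 K (e, e) → ∀ Z : E,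
      HasFDerivAt (fun x => fderiv ℝ (fun z => K (x, z)) e Z)
        ((ContinuousLinearMap.apply ℝ E ((0, Z) : E × E)).comp
          ((fderiv ℝ (fderiv ℝ K) (e, e)).comp (ContinuousLinearMap.inl ℝ E E))) e := by
    intro K hK Z
    have dK : DifferentiableAt ℝ (fderiv ℝ K) (e, e) :=
      (hK.fderiv_right (m := 1) (by norm_num)).differentiableAt (by norm_num)
    refine HasFDerivAt.congr_of_eventuallyEq ?_ (fderiv_snd_eventuallyEq hK Z)
    exact (ContinuousLinearMap.apply ℝ E ((0, Z) : E × E)).hasFDerivAt.comp e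
      (HasFDerivAt.comp e (f := fun x : E => (x, e)) dK.hasFDerivAt hl)
  refine ⟨(key hC Y).differentiableAt, fun X => ?_⟩
  -- the first derivatives at the base point
  have F1 : ∀ u, fderiv ℝ F (e, e) (u, 0) = u := by
    intro u
    have h1 : HasFDerivAt (fun x : E => F (x, e))
        ((fderiv ℝ F (e, e)).comp (ContinuousLinearMap.inl ℝ E E)) e :=
      HasFDerivAt.comp e (f := fun x : E => (x, e)) dF0.hasFDerivAt hl
    have h2 : HasFDerivAt (fun x : E => F (x, e)) (ContinuousLinearMap.id ℝ E) e :=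
      (hasFDerivAt_id e).congr_of_eventuallyEq hF1
    simpa using congrArg (fun L => L u) (h1.unique h2)
  have C2 : ∀ u, fderiv ℝ C (e, e) (0, u) = u := by
    intro u
    have h1 : HasFDerivAt (fun x : E => C (e, x))
        ((fderiv ℝ C (e, e)).comp (ContinuousLinearMap.inr ℝ E E)) e :=
      HasFDerivAt.comp e (f := fun x : E => (e, x)) dC0.hasFDerivAt hr
    have h2 : HasFDerivAt (fun x : E => C (e, x)) (ContinuousLinearMap.id ℝ E) e :=
      (hasFDerivAt_id e).congr_of_eventuallyEq hC2
    simpa using congrArg (fun L => L u) (h1.unique h2)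
  -- differentiate the relation in the second variable
  have rel : (fun x => fderiv ℝ F (x, e) (0, Y)) =ᶠ[𝓝 e]
      fun x => fderiv ℝ F (e, x) (fderiv ℝ C (x, e) (0, Y), 0) := by
    have hF' : ∀ᶠ p in 𝓝 (e, e), DifferentiableAt ℝ F p :=
      (hF.eventually (by simp)).mono fun p hp => hp.differentiableAt (by norm_num)
    have hC' : ∀ᶠ p in 𝓝 (e, e), DifferentiableAt ℝ C p :=
      (hC.eventually (by simp)).mono fun p hp => hp.differentiableAt (by norm_num)
    have hle : Tendsto (fun x : E => (x, e)) (𝓝 e) (𝓝 (e, e)) :=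
      (Continuous.prodMk_left e).tendsto e
    have hri : Tendsto (fun x : E => (e, x)) (𝓝 e) (𝓝 (e, e)) :=
      (Continuous.prodMk_right e).tendsto e
    filter_upwards [hle.eventually hF', hri.eventually hF', hle.eventually hC', hC1,
      hle.eventually h.eventually_nhds] with x h1 h2 h3 h4 h5
    have a1 : HasFDerivAt (fun p : E × E => (C p, p.1))
        ((fderiv ℝ C (x, e)).prod (ContinuousLinearMap.fst ℝ E E)) (x, e) :=
      h3.hasFDerivAt.prodMk hasFDerivAt_fst
    have a2 : HasFDerivAt F (fderiv ℝ F (e, x)) (C (x, e), (x, e).1) := by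
      rw [h4]; exact h2.hasFDerivAt
    have a3 := HasFDerivAt.comp (x, e) (f := fun p : E × E => (C p, p.1)) a2 a1
    have a4 : HasFDerivAt F _ (x, e) := a3.congr_of_eventuallyEq h5
    rw [a4.fderiv]
    simp
  have L : HasFDerivAt (fun x => fderiv ℝ F (x, e) (0, Y))
      ((ContinuousLinearMap.apply ℝ E ((0, Y) : E × E)).comp
          ((fderiv ℝ (fderiv ℝ F) (e, e)).comp (ContinuousLinearMap.inl ℝ E E))) e :=
    (ContinuousLinearMap.apply ℝ E ((0, Y) : E × E)).hasFDerivAt.comp e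
      (HasFDerivAt.comp e (f := fun x : E => (x, e)) dF.hasFDerivAt hl)
  have LC : HasFDerivAt (fun x => fderiv ℝ C (x, e) (0, Y))
      ((ContinuousLinearMap.apply ℝ E ((0, Y) : E × E)).comp
          ((fderiv ℝ (fderiv ℝ C) (e, e)).comp (ContinuousLinearMap.inl ℝ E E))) e :=
    (ContinuousLinearMap.apply ℝ E ((0, Y) : E × E)).hasFDerivAt.comp e
      (HasFDerivAt.comp e (f := fun x : E => (x, e)) dC.hasFDerivAt hl)
  have R1 : HasFDerivAt (fun x => fderiv ℝ F (e, x))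
      ((fderiv ℝ (fderiv ℝ F) (e, e)).comp (ContinuousLinearMap.inr ℝ E E)) e :=
    HasFDerivAt.comp e (f := fun x : E => (e, x)) dF.hasFDerivAt hr
  have R2 : HasFDerivAt (fun x => ((fderiv ℝ C (x, e) (0, Y), 0) : E × E)) _ e :=
    LC.prodMk (hasFDerivAt_const (0 : E) e)
  -- The product rule applied to the differentiated relation expresses `D²F((X,0),(0,Y))` as
  -- `D²F((0,X),(Y,0))` plus the derivative of the conjugation; symmetry of `D²F` then turns the
  -- difference into the commutator.
  have R := (L.congr_of_eventuallyEq rel.symm).unique (R1.clm_apply R2)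
  have symmF : IsSymmSndFDerivAt ℝ F (e, e) :=
    hF.isSymmSndFDerivAt (by simp)
  have Rx := congrArg (fun T => T X) R
  simp [F1, C2] at Rx
  rw [(key hC Y).fderiv, (key hF Y).fderiv, (key hF X).fderiv]
  simp only [ContinuousLinearMap.comp_apply, ContinuousLinearMap.apply_apply,
    ContinuousLinearMap.inl_apply]
  rw [Rx, symmF.eq (Y, 0) (0, X)]
  simp

end Calculus

/-! ### The adjoint representation and left-invariant fields -/

section LieGroupBasics

variable {n : ℕ} {G : Type*} [TopologicalSpace G] [ChartedSpace (EuclideanSpace ℝ (Fin n)) G]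
  [Group G] [LieGroup (𝓡 n) ∞ G]

theorem mdifferentiableAt_leftMul (a b : G) :
    MDifferentiableAt (𝓡 n) (𝓡 n) (fun x : G => a * x) b :=
  (contMDiff_mul_left (I := 𝓡 n) (n := ∞) (a := a)).mdifferentiableAt (by simp)

theorem contMDiff_conj (a : G) : ContMDiff (𝓡 n) (𝓡 n) ∞ (fun x : G => a * x * a⁻¹) :=
  (contMDiff_mul_right (I := 𝓡 n) (n := ∞) (a := a⁻¹)).comp contMDiff_mul_left

theorem mdifferentiableAt_conj (a b : G) :
    MDifferentiableAt (𝓡 n) (𝓡 n) (fun x : G => a * x * a⁻¹) b :=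
  (contMDiff_conj a).mdifferentiableAt (by simp)

/-- Every tangent space is definitionally the model space, so derivatives at base points that are
only propositionally equal can be compared there. -/
theorem mfderiv_base_congr {f : G → G} {b c : G} (h : b = c) (v : EuclideanSpace ℝ (Fin n)) :
    (show EuclideanSpace ℝ (Fin n) from mfderiv (𝓡 n) (𝓡 n) f b v) =
      (show EuclideanSpace ℝ (Fin n) from mfderiv (𝓡 n) (𝓡 n) f c v) := by
  subst h; rfl

/-- Left-invariant vector fields are invariant under left translations. -/
theorem mfderiv_mul_left_mulInvariantVectorField (a b : G) (X : GroupLieAlgebra (𝓡 n) G) :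
    mfderiv (𝓡 n) (𝓡 n) (fun x : G => a * x) b (mulInvariantVectorField X b) =
      mulInvariantVectorField X (a * b) := by
  have h : (fun x : G => a * b * x) = (fun x => a * x) ∘ (fun x => b * x) := by
    ext x; simp [mul_assoc]
  have h2 := mfderiv_comp_apply (I := 𝓡 n) (I' := 𝓡 n) (I'' := 𝓡 n) (1 : G)
    (mdifferentiableAt_leftMul a (b * 1)) (mdifferentiableAt_leftMul b 1) X
  rw [← h] at h2
  exact (mfderiv_base_congr (mul_one b).symm _).trans h2.symm

theorem mfderiv_conj_mulInvariantVectorField (a b : G) (X : GroupLieAlgebra (𝓡 n) G) :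
    mfderiv (𝓡 n) (𝓡 n) (fun x : G => a * x * a⁻¹) b (mulInvariantVectorField X b) =
      mulInvariantVectorField (Ad a X) (a * b * a⁻¹) := by
  have h : (fun x : G => a * x * a⁻¹) ∘ (fun x => b * x) =
      (fun x => (a * b * a⁻¹) * x) ∘ (fun x : G => a * x * a⁻¹) := by
    ext x; simp [mul_assoc]
  have h1 := mfderiv_comp_apply (I := 𝓡 n) (I' := 𝓡 n) (I'' := 𝓡 n) (1 : G)
    (mdifferentiableAt_conj a (b * 1)) (mdifferentiableAt_leftMul b 1) X
  have h2 := mfderiv_comp_apply (I := 𝓡 n) (I' := 𝓡 n) (I'' := 𝓡 n) (1 : G)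
    (mdifferentiableAt_leftMul (a * b * a⁻¹) (a * 1 * a⁻¹)) (mdifferentiableAt_conj a 1) X
  rw [h] at h1
  have h3 := h1.symm.trans h2
  refine (mfderiv_base_congr (mul_one b).symm _).trans (h3.trans ?_)
  exact mfderiv_base_congr (by simp) _

theorem Ad_mul_apply (a b : G) (X : GroupLieAlgebra (𝓡 n) G) : Ad (a * b) X = Ad a (Ad b X) := by
  have h : (fun x : G => a * b * x * (a * b)⁻¹) =
      (fun x => a * x * a⁻¹) ∘ (fun x : G => b * x * b⁻¹) := by
    ext x; simp [mul_assoc]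
  have h2 := mfderiv_comp_apply (I := 𝓡 n) (I' := 𝓡 n) (I'' := 𝓡 n) (1 : G)
    (mdifferentiableAt_conj a (b * 1 * b⁻¹)) (mdifferentiableAt_conj b 1) X
  rw [← h] at h2
  exact h2.trans (mfderiv_base_congr (by simp) _)

theorem Ad_one_apply (X : GroupLieAlgebra (𝓡 n) G) : Ad (1 : G) X = X := by
  have h : (fun x : G => 1 * x * (1 : G)⁻¹) = id := by ext x; simp
  have : mfderiv (𝓡 n) (𝓡 n) (fun x : G => 1 * x * (1 : G)⁻¹) 1 X = X := by
    rw [h, mfderiv_id]; rfl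
  exact this

theorem Ad_inv_apply_Ad (a : G) (X : GroupLieAlgebra (𝓡 n) G) : Ad a⁻¹ (Ad a X) = X := by
  rw [← Ad_mul_apply, inv_mul_cancel, Ad_one_apply]

theorem Ad_apply_Ad_inv (a : G) (X : GroupLieAlgebra (𝓡 n) G) : Ad a (Ad a⁻¹ X) = X := by
  rw [← Ad_mul_apply, mul_inv_cancel, Ad_one_apply]

theorem contMDiff_one_mulInvariantVectorField (X : GroupLieAlgebra (𝓡 n) G) :
    ContMDiff (𝓡 n) (𝓡 n).tangent 1
      (fun g : G => (⟨g, mulInvariantVectorField X g⟩ : TangentBundle (𝓡 n) G)) :=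
  (contMDiff_mulInvariantVectorField X).of_le
    (by rw [minSmoothness_of_isRCLikeNormedField]; norm_num)

theorem ContinuousLinearMap.isInvertible_of_injective {E : Type*} [NormedAddCommGroup E]
    [NormedSpace ℝ E] [FiniteDimensional ℝ E] {f : E →L[ℝ] E} (hf : Function.Injective f) :
    f.IsInvertible :=
  ⟨(LinearEquiv.ofInjectiveEndo f.toLinearMap hf).toContinuousLinearEquiv, by ext; rfl⟩

/-- The adjoint representation acts by automorphisms of the Lie algebra. -/
theorem Ad_lie (a : G) (X Y : GroupLieAlgebra (𝓡 n) G) : Ad a ⁅X, Y⁆ = ⁅Ad a X, Ad a Y⁆ := by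
  have inv : ∀ b : G, (mfderiv (𝓡 n) (𝓡 n) (fun x : G => a * x * a⁻¹) b).IsInvertible := by
    intro b
    have h : (fun x : G => a⁻¹ * x * a⁻¹⁻¹) ∘ (fun x : G => a * x * a⁻¹) = id := by
      ext x; simp [mul_assoc]
    have key : ∀ v, mfderiv (𝓡 n) (𝓡 n) (fun x : G => a⁻¹ * x * a⁻¹⁻¹) (a * b * a⁻¹)
        (mfderiv (𝓡 n) (𝓡 n) (fun x : G => a * x * a⁻¹) b v) = v := by
      intro v
      have h2 := mfderiv_comp_apply (I := 𝓡 n) (I' := 𝓡 n) (I'' := 𝓡 n) b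
        (mdifferentiableAt_conj a⁻¹ (a * b * a⁻¹)) (mdifferentiableAt_conj a b) v
      rw [h, mfderiv_id] at h2
      exact h2.symm
    exact ContinuousLinearMap.isInvertible_of_injective (E := EuclideanSpace ℝ (Fin n))
      (Function.LeftInverse.injective key)
  -- Conjugation by `a` pulls the left-invariant field of `Ad a Z` back to that of `Z`; naturality
  -- of the bracket under pullback then gives the claim.
  have pull : ∀ Z : GroupLieAlgebra (𝓡 n) G, VectorField.mpullback (𝓡 n) (𝓡 n)
      (fun x : G => a * x * a⁻¹) (mulInvariantVectorField (Ad a Z)) = mulInvariantVectorField Z := by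
    intro Z
    ext1 b
    rw [VectorField.mpullback_apply, ← mfderiv_conj_mulInvariantVectorField]
    simp [(inv b)]
  have h := VectorField.mpullback_mlieBracket (I := 𝓡 n) (I' := 𝓡 n) (n := ∞) (x₀ := (1 : G))
    (f := fun x : G => a * x * a⁻¹)
    (mdifferentiableAt_mulInvariantVectorField (Ad a X))
    (mdifferentiableAt_mulInvariantVectorField (Ad a Y)) (contMDiff_conj a).contMDiffAt
    (by rw [minSmoothness_of_isRCLikeNormedField]; exact ENat.LEInfty.out)
  rw [pull, pull, ← GroupLieAlgebra.bracket_def, VectorField.mpullback_apply] at h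
  have h2 := (inv 1).self_apply_inverse (VectorField.mlieBracket (𝓡 n)
    (mulInvariantVectorField (Ad a X)) (mulInvariantVectorField (Ad a Y)) (a * 1 * a⁻¹))
  rw [h] at h2
  refine h2.trans ?_
  rw [GroupLieAlgebra.bracket_def]
  have : ∀ c : G, c = 1 → (show EuclideanSpace ℝ (Fin n) from VectorField.mlieBracket (𝓡 n)
    (mulInvariantVectorField (Ad a X)) (mulInvariantVectorField (Ad a Y)) c) =
    VectorField.mlieBracket (𝓡 n)
    (mulInvariantVectorField (Ad a X)) (mulInvariantVectorField (Ad a Y)) 1 := by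
    rintro c rfl; rfl
  exact this _ (by simp)

/-! ### One-parameter subgroups -/

section Curves

theorem IsMIntegralCurveOn.mul_left {X : GroupLieAlgebra (𝓡 n) G} {γ : ℝ → G} {s : Set ℝ}
    (h : IsMIntegralCurveOn (I := 𝓡 n) γ (mulInvariantVectorField X) s) (a : G) :
    IsMIntegralCurveOn (I := 𝓡 n) (fun t => a * γ t) (mulInvariantVectorField X) s := by
  intro t ht
  have h1 := (mdifferentiableAt_leftMul a (γ t)).hasMFDerivAt.comp_hasMFDerivWithinAt t (h t ht)
  refine h1.congr_mfderiv (ContinuousLinearMap.ext fun (r : ℝ) => ?_)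
  refine (map_smul (mfderiv (𝓡 n) (𝓡 n) (fun x : G => a * x) (γ t)) r _).trans ?_
  exact congrArg (fun v : EuclideanSpace ℝ (Fin n) => r • v) (mfderiv_mul_left_mulInvariantVectorField a (γ t) X)

theorem IsMIntegralCurve.conj {X : GroupLieAlgebra (𝓡 n) G} {γ : ℝ → G}
    (h : IsMIntegralCurve (I := 𝓡 n) γ (mulInvariantVectorField X)) (a : G) :
    IsMIntegralCurve (I := 𝓡 n) (fun t => a * γ t * a⁻¹) (mulInvariantVectorField (Ad a X)) := by
  intro t
  have h1 := (mdifferentiableAt_conj a (γ t)).hasMFDerivAt.comp t (h t)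
  refine h1.congr_mfderiv (ContinuousLinearMap.ext fun (r : ℝ) => ?_)
  refine (map_smul (mfderiv (𝓡 n) (𝓡 n) (fun x : G => a * x * a⁻¹) (γ t)) r _).trans ?_
  exact congrArg (fun v : EuclideanSpace ℝ (Fin n) => r • v) (mfderiv_conj_mulInvariantVectorField a (γ t) X)

theorem IsExp.conj {X : GroupLieAlgebra (𝓡 n) G} {b : G} (h : IsExp X b) (a : G) :
    IsExp (Ad a X) (a * b * a⁻¹) := by
  obtain ⟨γ, h0, hγ, h1⟩ := h
  exact ⟨_, by simp [h0], hγ.conj a, by simp [h1]⟩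

theorem IsExp.of_integralCurve {X : GroupLieAlgebra (𝓡 n) G} {γ : ℝ → G} (h0 : γ 0 = 1)
    (h : IsMIntegralCurve (I := 𝓡 n) γ (mulInvariantVectorField X)) (t : ℝ) :
    IsExp (t • X) (γ t) := by
  refine ⟨γ ∘ (· * t), by simp [h0], ?_, by simp⟩
  have := h.comp_mul t
  rwa [← mulInvariantVectorField_smul] at this

variable [T2Space G]

instance : BoundarylessManifold (𝓡 n) G := inferInstance

/-- Left-invariant vector fields are complete. -/
theorem exists_isMIntegralCurve_mulInvariantVectorField (X : GroupLieAlgebra (𝓡 n) G) :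
    ∃ γ : ℝ → G, γ 0 = 1 ∧ IsMIntegralCurve (I := 𝓡 n) γ (mulInvariantVectorField X) := by
  have : IsManifold (𝓡 n) 1 G := IsManifold.of_le (n := ∞) (by simp)
  have hv := contMDiff_one_mulInvariantVectorField (G := G) X
  obtain ⟨γ, h0, hγ⟩ := exists_isMIntegralCurveAt_of_contMDiffAt_boundaryless 0
    (hv.contMDiffAt (x := 1))
  rw [isMIntegralCurveAt_iff'] at hγ
  obtain ⟨ε, hε, hγ⟩ := hγ
  -- Left translates of one local curve start at every point and all live for the same time `ε`; a
  -- uniform existence time implies completeness.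
  refine exists_isMIntegralCurve_of_isMIntegralCurveOn hv hε (fun x => ⟨fun t => x * γ t, by simp [h0], ?_⟩) 1
  rw [Real.ball_eq_Ioo] at hγ
  simpa using hγ.mul_left x

/-- As functions of `t`, both sides are integral curves of the same field and agree at `t = 0`, so
uniqueness applies. -/
theorem IsMIntegralCurve.map_add {X : GroupLieAlgebra (𝓡 n) G} {γ : ℝ → G} (h0 : γ 0 = 1)
    (h : IsMIntegralCurve (I := 𝓡 n) γ (mulInvariantVectorField X)) (s t : ℝ) :
    γ (s + t) = γ s * γ t := by
  have : IsManifold (𝓡 n) 1 G := IsManifold.of_le (n := ∞) (by simp)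
  have h1 : IsMIntegralCurve (I := 𝓡 n) (fun t => γ s * γ t) (mulInvariantVectorField X) := by
    rw [isMIntegralCurve_iff_isMIntegralCurveOn] at h ⊢
    exact h.mul_left _
  have h2 := h.comp_add s
  have := isMIntegralCurve_Ioo_eq_of_contMDiff_boundaryless (t₀ := 0)
    (contMDiff_one_mulInvariantVectorField (G := G) X) h2 h1 (by simp [h0])
  simpa [add_comm] using congrFun this t

end Curves
end LieGroupBasics

/-! ### The derivative of `Ad` is the Lie bracket -/

section AdDeriv

variable {n : ℕ} {G : Type*} [TopologicalSpace G] [ChartedSpace (EuclideanSpace ℝ (Fin n)) G]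
  [Group G] [LieGroup (𝓡 n) ∞ G]

variable (n G) in
/-- The multiplication of a Lie group in the coordinates at the identity. -/
noncomputable def localMul (p : EuclideanSpace ℝ (Fin n) × EuclideanSpace ℝ (Fin n)) :
    EuclideanSpace ℝ (Fin n) :=
  extChartAt (𝓡 n) (1 : G)
    ((extChartAt (𝓡 n) (1 : G)).symm p.1 * (extChartAt (𝓡 n) (1 : G)).symm p.2)

variable (n G) in
/-- The conjugation of a Lie group in the coordinates at the identity. -/
noncomputable def localConj (p : EuclideanSpace ℝ (Fin n) × EuclideanSpace ℝ (Fin n)) :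
    EuclideanSpace ℝ (Fin n) :=
  extChartAt (𝓡 n) (1 : G)
    ((extChartAt (𝓡 n) (1 : G)).symm p.1 * (extChartAt (𝓡 n) (1 : G)).symm p.2 *
      ((extChartAt (𝓡 n) (1 : G)).symm p.1)⁻¹)

variable (n G) in
/-- The coordinates of the identity. -/
noncomputable def localOne : EuclideanSpace ℝ (Fin n) := extChartAt (𝓡 n) (1 : G) 1

theorem extChartAt_symm_localOne : (extChartAt (𝓡 n) (1 : G)).symm (localOne n G) = 1 := by
  simp [localOne]

theorem contMDiffAt_extChartAt_symm_localOne :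
    ContMDiffAt 𝓘(ℝ, EuclideanSpace ℝ (Fin n)) (𝓡 n) ∞ (extChartAt (𝓡 n) (1 : G)).symm
      (localOne n G) :=
  have : IsManifold (𝓡 n) ∞ G := inferInstance
  (contMDiffOn_extChartAt_symm (n := ∞) (1 : G)).contMDiffAt (extChartAt_target_mem_nhds 1)

theorem contDiffAt_localMul : ContDiffAt ℝ ∞ (localMul n G) (localOne n G, localOne n G) := by
  have : IsManifold (𝓡 n) ∞ G := inferInstance
  rw [← contMDiffAt_iff_contDiffAt]
  have h1 : ContMDiffAt 𝓘(ℝ, EuclideanSpace ℝ (Fin n) × EuclideanSpace ℝ (Fin n)) (𝓡 n) ∞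
      (fun p : EuclideanSpace ℝ (Fin n) × EuclideanSpace ℝ (Fin n) =>
        (extChartAt (𝓡 n) (1 : G)).symm p.1) (localOne n G, localOne n G) :=
    contMDiffAt_extChartAt_symm_localOne.comp (localOne n G, localOne n G)
      contDiff_fst.contMDiff.contMDiffAt
  have h2 : ContMDiffAt 𝓘(ℝ, EuclideanSpace ℝ (Fin n) × EuclideanSpace ℝ (Fin n)) (𝓡 n) ∞
      (fun p : EuclideanSpace ℝ (Fin n) × EuclideanSpace ℝ (Fin n) =>
        (extChartAt (𝓡 n) (1 : G)).symm p.2) (localOne n G, localOne n G) :=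
    contMDiffAt_extChartAt_symm_localOne.comp (localOne n G, localOne n G)
      contDiff_snd.contMDiff.contMDiffAt
  refine ContMDiffAt.comp (localOne n G, localOne n G) (I' := 𝓡 n)
    (g := extChartAt (𝓡 n) (1 : G)) ?_ (h1.mul h2)
  simp only [extChartAt_symm_localOne, mul_one]
  exact contMDiffAt_extChartAt

theorem contDiffAt_localConj : ContDiffAt ℝ ∞ (localConj n G) (localOne n G, localOne n G) := by
  have : IsManifold (𝓡 n) ∞ G := inferInstance
  rw [← contMDiffAt_iff_contDiffAt]
  have h1 : ContMDiffAt 𝓘(ℝ, EuclideanSpace ℝ (Fin n) × EuclideanSpace ℝ (Fin n)) (𝓡 n) ∞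
      (fun p : EuclideanSpace ℝ (Fin n) × EuclideanSpace ℝ (Fin n) =>
        (extChartAt (𝓡 n) (1 : G)).symm p.1) (localOne n G, localOne n G) :=
    contMDiffAt_extChartAt_symm_localOne.comp (localOne n G, localOne n G)
      contDiff_fst.contMDiff.contMDiffAt
  have h2 : ContMDiffAt 𝓘(ℝ, EuclideanSpace ℝ (Fin n) × EuclideanSpace ℝ (Fin n)) (𝓡 n) ∞
      (fun p : EuclideanSpace ℝ (Fin n) × EuclideanSpace ℝ (Fin n) =>
        (extChartAt (𝓡 n) (1 : G)).symm p.2) (localOne n G, localOne n G) :=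
    contMDiffAt_extChartAt_symm_localOne.comp (localOne n G, localOne n G)
      contDiff_snd.contMDiff.contMDiffAt
  refine ContMDiffAt.comp (localOne n G, localOne n G) (I' := 𝓡 n)
    (g := extChartAt (𝓡 n) (1 : G)) ?_ ((h1.mul h2).mul h1.inv)
  simp only [extChartAt_symm_localOne, mul_one, inv_one]
  exact contMDiffAt_extChartAt

theorem tendsto_extChartAt_symm_localOne :
    Tendsto (extChartAt (𝓡 n) (1 : G)).symm (𝓝 (localOne n G)) (𝓝 1) := by
  have := (contMDiffAt_extChartAt_symm_localOne (n := n) (G := G)).continuousAt.tendsto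
  rwa [extChartAt_symm_localOne] at this

theorem eventually_extChartAt_right_inv : ∀ᶠ x in 𝓝 (localOne n G),
    extChartAt (𝓡 n) (1 : G) ((extChartAt (𝓡 n) (1 : G)).symm x) = x := by
  filter_upwards [extChartAt_target_mem_nhds (I := 𝓡 n) (1 : G)] with x hx
  exact (extChartAt (𝓡 n) (1 : G)).right_inv hx

theorem localMul_eq_localMul_localConj : ∀ᶠ p in 𝓝 (localOne n G, localOne n G),
    localMul n G p = localMul n G (localConj n G p, p.1) := by
  have : IsTopologicalGroup G := topologicalGroup_of_lieGroup (𝓡 n) ∞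
  have h1 : Tendsto (fun p : EuclideanSpace ℝ (Fin n) × EuclideanSpace ℝ (Fin n) =>
      ((extChartAt (𝓡 n) (1 : G)).symm p.1 * (extChartAt (𝓡 n) (1 : G)).symm p.2 *
      ((extChartAt (𝓡 n) (1 : G)).symm p.1)⁻¹)) (𝓝 (localOne n G, localOne n G)) (𝓝 1) := by
    have a := tendsto_extChartAt_symm_localOne.comp
      (continuous_fst.tendsto (localOne n G, localOne n G))
    have b := tendsto_extChartAt_symm_localOne.comp
      (continuous_snd.tendsto (localOne n G, localOne n G))
    simpa using (a.mul b).mul a.inv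
  filter_upwards [h1.eventually (extChartAt_source_mem_nhds (I := 𝓡 n) (1 : G))] with p hp
  simp only [localMul, localConj]
  rw [(extChartAt (𝓡 n) (1 : G)).left_inv hp]
  simp

theorem mfderiv_one_eq_fderiv {f : G → EuclideanSpace ℝ (Fin n)}
    (hf : MDifferentiableAt (𝓡 n) 𝓘(ℝ, EuclideanSpace ℝ (Fin n)) f 1)
    (Y : EuclideanSpace ℝ (Fin n)) :
    (show EuclideanSpace ℝ (Fin n) from
      mfderiv (𝓡 n) 𝓘(ℝ, EuclideanSpace ℝ (Fin n)) f 1 Y) =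
      fderiv ℝ (fun z => f ((extChartAt (𝓡 n) (1 : G)).symm z)) (localOne n G) Y := by
  rw [hf.mfderiv]
  simp [writtenInExtChartAt, localOne]
  rfl

theorem mfderiv_extChartAt_of_eq_one {g : G} (hg : g = 1) (v : EuclideanSpace ℝ (Fin n)) :
    (show EuclideanSpace ℝ (Fin n) from
      mfderiv (𝓡 n) 𝓘(ℝ, EuclideanSpace ℝ (Fin n)) (extChartAt (𝓡 n) (1 : G)) g v) = v := by
  have : IsManifold (𝓡 n) 1 G := IsManifold.of_le (n := ∞) (by simp)
  subst hg
  rw [mfderiv_extChartAt_self]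
  rfl

theorem Ad_eq_fderiv (a : G) (Y : GroupLieAlgebra (𝓡 n) G) :
    Ad a Y = fderiv ℝ (fun z => extChartAt (𝓡 n) (1 : G)
      (a * (extChartAt (𝓡 n) (1 : G)).symm z * a⁻¹)) (localOne n G) Y := by
  have : IsManifold (𝓡 n) 1 G := IsManifold.of_le (n := ∞) (by simp)
  have h1 : MDifferentiableAt (𝓡 n) 𝓘(ℝ, EuclideanSpace ℝ (Fin n)) (extChartAt (𝓡 n) (1 : G))
      (a * 1 * a⁻¹) := mdifferentiableAt_extChartAt (by simp)
  have h2 := mfderiv_comp_apply (I := 𝓡 n) (I' := 𝓡 n) (1 : G) h1 (mdifferentiableAt_conj a 1) Y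
  have h3 := mfderiv_one_eq_fderiv (h1.comp (1 : G) (mdifferentiableAt_conj a 1)) Y
  exact (mfderiv_extChartAt_of_eq_one (by simp) _).symm.trans (h2.symm.trans h3)

/-- In the chart at the identity a left-invariant field is a partial derivative of the
multiplication. This makes the Lie bracket a difference of second derivatives, comparable with
`hasFDerivAt_conj`. -/
theorem mpullbackWithin_mulInvariantVectorField (Y : GroupLieAlgebra (𝓡 n) G) :
    ∀ᶠ x in 𝓝 (localOne n G),
    VectorField.mpullbackWithin 𝓘(ℝ, EuclideanSpace ℝ (Fin n)) (𝓡 n)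
      (extChartAt (𝓡 n) (1 : G)).symm (mulInvariantVectorField Y) (Set.range (𝓡 n)) x =
      fderiv ℝ (fun z => localMul n G (x, z)) (localOne n G) Y := by
  have : IsManifold (𝓡 n) 1 G := IsManifold.of_le (n := ∞) (by simp)
  filter_upwards [extChartAt_target_mem_nhds (I := 𝓡 n) (1 : G)] with x hx
  rw [VectorField.mpullbackWithin_apply]
  set a := (extChartAt (𝓡 n) (1 : G)).symm x with ha
  have hL := isInvertible_mfderivWithin_extChartAt_symm (I := 𝓡 n) hx
  have hcomp := mfderiv_extChartAt_comp_mfderivWithin_extChartAt_symm (I := 𝓡 n) hx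
  have has : a ∈ (chartAt (EuclideanSpace ℝ (Fin n)) (1 : G)).source := by
    rw [← extChartAt_source (𝓡 n)]
    exact (extChartAt (𝓡 n) (1 : G)).map_target hx
  have has' : a * 1 ∈ (chartAt (EuclideanSpace ℝ (Fin n)) (1 : G)).source := by rwa [mul_one]
  have h1 : MDifferentiableAt (𝓡 n) 𝓘(ℝ, EuclideanSpace ℝ (Fin n)) (extChartAt (𝓡 n) (1 : G))
      (a * 1) := mdifferentiableAt_extChartAt has'
  have h2 := mfderiv_comp_apply (I := 𝓡 n) (I' := 𝓡 n) (1 : G) h1 (mdifferentiableAt_leftMul a 1) Y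
  have h3 := mfderiv_one_eq_fderiv (h1.comp (1 : G) (mdifferentiableAt_leftMul a 1)) Y
  have h4 := hL.self_apply_inverse (mulInvariantVectorField Y a)
  have h5 := congrArg (fun L => L ((mfderivWithin 𝓘(ℝ, EuclideanSpace ℝ (Fin n)) (𝓡 n)
    (extChartAt (𝓡 n) (1 : G)).symm (Set.range (𝓡 n)) x).inverse (mulInvariantVectorField Y a)))
    hcomp
  refine h5.symm.trans ?_
  have h6 : ∀ v w : EuclideanSpace ℝ (Fin n), v = w → ∀ b : G, a = b →
      (show EuclideanSpace ℝ (Fin n) from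
        mfderiv (𝓡 n) 𝓘(ℝ, EuclideanSpace ℝ (Fin n)) (extChartAt (𝓡 n) (1 : G)) a v) =
      (show EuclideanSpace ℝ (Fin n) from
        mfderiv (𝓡 n) 𝓘(ℝ, EuclideanSpace ℝ (Fin n)) (extChartAt (𝓡 n) (1 : G)) b w) := by
    rintro v w rfl b rfl; rfl
  exact (h6 _ _ h4 _ (mul_one a).symm).trans (h2.symm.trans h3)

theorem fderiv_localMul_right (X : EuclideanSpace ℝ (Fin n)) :
    fderiv ℝ (fun z => localMul n G (localOne n G, z)) (localOne n G) X = X := by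
  have : (fun z => localMul n G (localOne n G, z)) =ᶠ[𝓝 (localOne n G)] id := by
    filter_upwards [eventually_extChartAt_right_inv] with x hx
    simp only [localMul, extChartAt_symm_localOne, one_mul, mul_one, hx, id]
  rw [this.fderiv_eq, fderiv_id]
  rfl

theorem lie_eq_fderiv (X Y : GroupLieAlgebra (𝓡 n) G) :
    ⁅X, Y⁆ = fderiv ℝ (fun x => fderiv ℝ (fun z => localMul n G (x, z)) (localOne n G) Y)
        (localOne n G) X -
      fderiv ℝ (fun x => fderiv ℝ (fun z => localMul n G (x, z)) (localOne n G) X)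
        (localOne n G) Y := by
  have : IsManifold (𝓡 n) 1 G := IsManifold.of_le (n := ∞) (by simp)
  rw [GroupLieAlgebra.bracket_def, ← VectorField.mlieBracketWithin_univ,
    VectorField.mlieBracketWithin_apply]
  have hinv : ∀ v : EuclideanSpace ℝ (Fin n), (show EuclideanSpace ℝ (Fin n) from
      (mfderiv (𝓡 n) 𝓘(ℝ, EuclideanSpace ℝ (Fin n)) (extChartAt (𝓡 n) (1 : G)) 1).inverse v) =
      v := by
    intro v
    rw [mfderiv_extChartAt_self]
    exact congrArg (fun L => L v) (ContinuousLinearMap.inverse_id (R := ℝ)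
      (M := EuclideanSpace ℝ (Fin n)))
  refine (hinv _).trans ?_
  have hs : ((extChartAt (𝓡 n) (1 : G)).symm ⁻¹' Set.univ ∩ Set.range (𝓡 n)) = Set.univ := by
    simp
  rw [hs]
  have key := Filter.EventuallyEq.lieBracket_vectorField_eq (𝕜 := ℝ)
    (mpullbackWithin_mulInvariantVectorField (n := n) (G := G) X)
    (mpullbackWithin_mulInvariantVectorField (n := n) (G := G) Y)
  refine (congrFun VectorField.lieBracketWithin_univ _).trans (key.trans ?_)
  rw [VectorField.lieBracket_eq]
  exact congrArg₂ (fun v w : EuclideanSpace ℝ (Fin n) => v - w)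
    (congrArg (fderiv ℝ (fun x => fderiv ℝ (fun z => localMul n G (x, z)) (localOne n G)
      (show EuclideanSpace ℝ (Fin n) from Y)) (localOne n G)) (fderiv_localMul_right X))
    (congrArg (fderiv ℝ (fun x => fderiv ℝ (fun z => localMul n G (x, z)) (localOne n G)
      (show EuclideanSpace ℝ (Fin n) from X)) (localOne n G)) (fderiv_localMul_right Y))

theorem mulInvariantVectorField_one (X : GroupLieAlgebra (𝓡 n) G) :
    mulInvariantVectorField X (1 : G) = X := by
  have h : (fun x : G => 1 * x) = id := by ext x; simp
  have : mfderiv (𝓡 n) (𝓡 n) (fun x : G => 1 * x) 1 X = X := by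
    rw [h, mfderiv_id]; rfl
  exact this

theorem hasDerivAt_extChartAt_integralCurve {X : GroupLieAlgebra (𝓡 n) G} {γ : ℝ → G}
    (h0 : γ 0 = 1) (h : IsMIntegralCurve (I := 𝓡 n) γ (mulInvariantVectorField X)) :
    HasDerivAt (fun t => extChartAt (𝓡 n) (1 : G) (γ t)) X 0 := by
  have : IsManifold (𝓡 n) 1 G := IsManifold.of_le (n := ∞) (by simp)
  have hsrc : γ 0 ∈ (chartAt (EuclideanSpace ℝ (Fin n)) (1 : G)).source := by simp [h0]
  have h1 := HasMFDerivAt.comp (0 : ℝ) (mdifferentiableAt_extChartAt hsrc).hasMFDerivAt (h 0)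
  rw [hasMFDerivAt_iff_hasFDerivAt] at h1
  have h2 : HasDerivAt (fun t => extChartAt (𝓡 n) (1 : G) (γ t)) _ 0 :=
    (show HasFDerivAt (𝕜 := ℝ) (E := ℝ) (F := EuclideanSpace ℝ (Fin n)) _ _ 0 from h1).hasDerivAt
  have h3 : ∀ g : G, g = 1 → (show EuclideanSpace ℝ (Fin n) from
      mulInvariantVectorField X g) = X := by
    rintro g rfl; exact mulInvariantVectorField_one X
  refine h2.congr_deriv ?_
  refine (mfderiv_extChartAt_of_eq_one h0 _).trans ?_
  refine (one_smul ℝ (show EuclideanSpace ℝ (Fin n) from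
      mulInvariantVectorField X (γ 0))).trans (h3 _ h0)

/-- In coordinates `Ad` is the second partial derivative of the conjugation. Its derivative along
`X` is computed by `hasFDerivAt_conj`, and `lie_eq_fderiv` recognizes the result as the bracket. -/
theorem hasDerivAt_Ad_zero {X : GroupLieAlgebra (𝓡 n) G} {γ : ℝ → G} (h0 : γ 0 = 1)
    (h : IsMIntegralCurve (I := 𝓡 n) γ (mulInvariantVectorField X))
    (Y : GroupLieAlgebra (𝓡 n) G) : HasDerivAt (fun t => Ad (γ t) Y) ⁅X, Y⁆ 0 := by
  obtain ⟨hd, hX⟩ := hasFDerivAt_conj (F := localMul n G) (C := localConj n G) (e := localOne n G)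
    (contDiffAt_localMul.of_le ENat.LEInfty.out) (contDiffAt_localConj.of_le ENat.LEInfty.out)
    (by filter_upwards [eventually_extChartAt_right_inv] with x hx
        simp only [localMul, extChartAt_symm_localOne, one_mul, mul_one, hx, id])
    (Eventually.of_forall fun x => by
      simp only [localConj, extChartAt_symm_localOne, mul_one, mul_inv_cancel]; rfl)
    (by filter_upwards [eventually_extChartAt_right_inv] with x hx
        simp only [localConj, extChartAt_symm_localOne, one_mul, inv_one, mul_one, hx])
    localMul_eq_localMul_localConj Y
  have hγ := hasDerivAt_extChartAt_integralCurve h0 h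
  have hc : extChartAt (𝓡 n) (1 : G) (γ 0) = localOne n G := by rw [h0]; rfl
  have h1 := hd.hasFDerivAt
  rw [← hc] at h1
  have h2 := h1.comp_hasDerivAt (0 : ℝ) hγ
  rw [hc] at h2
  refine (h2.congr_deriv ((hX X).trans (lie_eq_fderiv X Y).symm)).congr_of_eventuallyEq ?_
  have hs : ∀ᶠ t in 𝓝 (0 : ℝ), γ t ∈ (extChartAt (𝓡 n) (1 : G)).source := by
    have := h.continuous.tendsto 0
    rw [h0] at this
    exact this.eventually (extChartAt_source_mem_nhds (I := 𝓡 n) (1 : G))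
  filter_upwards [hs] with t ht
  rw [Ad_eq_fderiv]
  simp only [Function.comp, localConj, (extChartAt (𝓡 n) (1 : G)).left_inv ht]

end AdDeriv

/-! ### Ad-invariance versus ad-invariance; construction of Lie subgroups -/

section AdInvariance

variable {n : ℕ} {G : Type*} [TopologicalSpace G] [ChartedSpace (EuclideanSpace ℝ (Fin n)) G]
  [Group G] [LieGroup (𝓡 n) ∞ G] [T2Space G]

/-- The case `t = 0`, applied to the functional `f ∘ Ad (γ t)`, gives every `t` by the one-parameter
group law. Testing against functionals keeps the derivative scalar-valued. -/
theorem hasDerivAt_dual_Ad {X : GroupLieAlgebra (𝓡 n) G} {γ : ℝ → G} (h0 : γ 0 = 1)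
    (h : IsMIntegralCurve (I := 𝓡 n) γ (mulInvariantVectorField X))
    (f : Module.Dual ℝ (GroupLieAlgebra (𝓡 n) G)) (Y : GroupLieAlgebra (𝓡 n) G) (t : ℝ) :
    HasDerivAt (fun s => f (Ad (γ s) Y)) (f (Ad (γ t) ⁅X, Y⁆)) t := by
  have key : ∀ f : Module.Dual ℝ (GroupLieAlgebra (𝓡 n) G),
      HasDerivAt (fun s => f (Ad (γ s) Y)) (f ⁅X, Y⁆) 0 := by
    intro f
    have h1 := hasDerivAt_Ad_zero h0 h Y
    have h2 := (LinearMap.toContinuousLinearMap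
      (show EuclideanSpace ℝ (Fin n) →ₗ[ℝ] ℝ from f)).hasFDerivAt.comp_hasDerivAt
      (0 : ℝ) h1
    exact h2
  have h1 := key (f ∘ₗ Ad (γ t))
  have h2 : HasDerivAt (fun s => s - t) 1 t := (hasDerivAt_id t).sub_const t
  have h3 := HasDerivAt.comp_of_eq (h := fun s => s - t) t h1 h2 (sub_self t).symm
  rw [mul_one] at h3
  refine h3.congr_of_eventuallyEq (Eventually.of_forall fun s => ?_)
  simp only [Function.comp, LinearMap.comp_apply]
  rw [← Ad_mul_apply, ← h.map_add h0, add_sub_cancel]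

theorem lie_mem_of_forall_Ad_mem {X : GroupLieAlgebra (𝓡 n) G} {γ : ℝ → G} (h0 : γ 0 = 1)
    (h : IsMIntegralCurve (I := 𝓡 n) γ (mulInvariantVectorField X))
    {V : Submodule ℝ (GroupLieAlgebra (𝓡 n) G)} (hV : ∀ t, ∀ Y ∈ V, Ad (γ t) Y ∈ V)
    {Y : GroupLieAlgebra (𝓡 n) G} (hY : Y ∈ V) : ⁅X, Y⁆ ∈ V := by
  by_contra hn
  obtain ⟨f, hf, hfV⟩ := Submodule.exists_le_ker_of_notMem hn
  have h1 := hasDerivAt_dual_Ad h0 h f Y 0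
  have h2 : HasDerivAt (fun s => f (Ad (γ s) Y)) 0 0 := by
    refine (hasDerivAt_const (0 : ℝ) (0 : ℝ)).congr_of_eventuallyEq (Eventually.of_forall fun s => ?_)
    exact hfV (hV s Y hY)
  rw [h0, Ad_one_apply] at h1
  exact hf (h1.unique h2)

theorem form_lie_add_form_lie {X : GroupLieAlgebra (𝓡 n) G} {γ : ℝ → G} (h0 : γ 0 = 1)
    (h : IsMIntegralCurve (I := 𝓡 n) γ (mulInvariantVectorField X))
    (b : LinearMap.BilinForm ℝ (GroupLieAlgebra (𝓡 n) G)) {x y : GroupLieAlgebra (𝓡 n) G}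
    (hb : ∀ t, b (Ad (γ t) x) y = b x (Ad (γ (-t)) y)) : b ⁅X, x⁆ y + b x ⁅X, y⁆ = 0 := by
  have h1 := hasDerivAt_dual_Ad h0 h (b.flip y) x 0
  have h2 := hasDerivAt_dual_Ad h0 h (b x) y 0
  rw [← neg_zero] at h2
  have h3 := h2.comp (0 : ℝ) (hasDerivAt_neg (0 : ℝ))
  have h4 := h1.unique (h3.congr_of_eventuallyEq (Eventually.of_forall hb))
  rw [neg_zero, h0, Ad_one_apply, Ad_one_apply] at h4
  have h5 : b ⁅X, x⁆ y = b x ⁅X, y⁆ * -1 := h4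
  linarith

/-- Let `f` vanish on `V`. Evaluated on a basis of `V`, the functions `t ↦ f (Ad (γ t) v)` solve a
linear ODE with zero initial value, hence vanish; so no functional separates `Ad (γ t) Y` from `V`.
-/
theorem Ad_mem_of_forall_lie_mem {X : GroupLieAlgebra (𝓡 n) G} {γ : ℝ → G} (h0 : γ 0 = 1)
    (h : IsMIntegralCurve (I := 𝓡 n) γ (mulInvariantVectorField X))
    {V : Submodule ℝ (GroupLieAlgebra (𝓡 n) G)} (hV : ∀ Y ∈ V, ⁅X, Y⁆ ∈ V)
    {Y : GroupLieAlgebra (𝓡 n) G} (hY : Y ∈ V) (t : ℝ) : Ad (γ t) Y ∈ V := by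
  by_contra hn
  obtain ⟨f, hf, hfV⟩ := Submodule.exists_le_ker_of_notMem hn
  let b := Module.finBasis ℝ V
  let a : V →ₗ[ℝ] V := LinearMap.restrict (LieAlgebra.ad ℝ _ X : _ →ₗ[ℝ] _) hV
  -- The transpose appears because `u` collects values of a functional on the basis vectors, not
  -- coordinates of a vector.
  let L : (Fin (Module.finrank ℝ V) → ℝ) →ₗ[ℝ] (Fin (Module.finrank ℝ V) → ℝ) :=
    Matrix.toLin' (LinearMap.toMatrix b b a).transpose
  let L' := LinearMap.toContinuousLinearMap L
  let u : ℝ → Fin (Module.finrank ℝ V) → ℝ := fun t i => f (Ad (γ t) (b i))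
  have hu : ∀ t, HasDerivAt u (L' (u t)) t := by
    intro t
    rw [hasDerivAt_pi]
    intro i
    refine (hasDerivAt_dual_Ad h0 h f (b i) t).congr_deriv ?_
    have h1 : ⁅X, (b i : GroupLieAlgebra (𝓡 n) G)⁆ = ((a (b i) : V) : GroupLieAlgebra (𝓡 n) G) :=
      rfl
    rw [h1, ← b.sum_repr (a (b i))]
    simp only [AddSubmonoidClass.coe_finsetSum, map_sum, SetLike.val_smul, map_smul, smul_eq_mul]
    simp only [L', L, u, LinearMap.coe_toContinuousLinearMap', Matrix.toLin'_apply, Matrix.mulVec,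
      dotProduct, Matrix.transpose_apply, LinearMap.toMatrix_apply]
  have h2 := ODE_solution_unique_univ (v := fun _ => L') (s := fun _ => Set.univ) (t₀ := 0)
    (K := ‖L'‖₊) (f := u) (g := fun _ => 0) (fun t => L'.lipschitz.lipschitzOnWith)
    (fun t => ⟨hu t, trivial⟩) (fun t => ⟨by simpa using hasDerivAt_const t _, trivial⟩) (by
      ext i
      simp only [u, h0, Ad_one_apply, Pi.zero_apply]
      exact hfV (b i).2)
  have h3 : ∀ i, f (Ad (γ t) (b i)) = 0 := fun i => congrFun (congrFun h2 t) i
  apply hf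
  have h4 : f ∘ₗ Ad (γ t) ∘ₗ V.subtype = 0 := b.ext h3
  exact LinearMap.congr_fun h4 ⟨Y, hY⟩

theorem Ad_inv_mem {a : G} {V : Submodule ℝ (GroupLieAlgebra (𝓡 n) G)}
    (hV : ∀ Y ∈ V, Ad a Y ∈ V) {Y : GroupLieAlgebra (𝓡 n) G} (hY : Y ∈ V) : Ad a⁻¹ Y ∈ V := by
  have hinj : Function.Injective (LinearMap.restrict (Ad a) hV) := by
    intro x y hxy
    have : Ad a (x : GroupLieAlgebra (𝓡 n) G) = Ad a y := congrArg Subtype.val hxy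
    rw [Subtype.ext_iff, ← Ad_inv_apply_Ad a x.1, this, Ad_inv_apply_Ad]
  obtain ⟨x, hx⟩ := LinearMap.injective_iff_surjective.1 hinj ⟨Y, hY⟩
  have : Ad a (x : GroupLieAlgebra (𝓡 n) G) = Y := congrArg Subtype.val hx
  rw [← this, Ad_inv_apply_Ad]
  exact x.2

theorem Ad_mem_of_mem_expSubgroup (𝔨 : LieSubalgebra ℝ (GroupLieAlgebra (𝓡 n) G)) {a : G}
    (ha : a ∈ expSubgroup 𝔨) : ∀ Y ∈ 𝔨, Ad a Y ∈ 𝔨 := by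
  induction ha using Subgroup.closure_induction with
  | mem x hx =>
    obtain ⟨X, hX, γ, h0, h, rfl⟩ := hx
    exact fun Y hY => Ad_mem_of_forall_lie_mem (V := 𝔨.toSubmodule) h0 h
      (fun Z hZ => 𝔨.lie_mem hX hZ) hY 1
  | one => intro Y hY; rwa [Ad_one_apply]
  | mul x y _ _ hx hy => intro Y hY; rw [Ad_mul_apply]; exact hx _ (hy _ hY)
  | inv x _ hx => exact fun Y hY => Ad_inv_mem (V := 𝔨.toSubmodule) hx hY

theorem expSubgroup_mono {𝔥 𝔨 : LieSubalgebra ℝ (GroupLieAlgebra (𝓡 n) G)} (h : 𝔥 ≤ 𝔨) :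
    expSubgroup 𝔥 ≤ expSubgroup 𝔨 :=
  Subgroup.closure_mono fun _ ⟨X, hX, ha⟩ => ⟨X, h hX, ha⟩

theorem conj_mem_expSubgroup {𝔨 : LieSubalgebra ℝ (GroupLieAlgebra (𝓡 n) G)} {a x : G}
    (ha : ∀ Y ∈ 𝔨, Ad a Y ∈ 𝔨) (hx : x ∈ expSubgroup 𝔨) : a * x * a⁻¹ ∈ expSubgroup 𝔨 := by
  induction hx using Subgroup.closure_induction with
  | mem x hx =>
    obtain ⟨X, hX, h⟩ := hx
    exact Subgroup.subset_closure ⟨_, ha X hX, h.conj a⟩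
  | one => simp
  | mul x y _ _ hx hy =>
    have := (expSubgroup 𝔨).mul_mem hx hy
    simpa [mul_assoc] using this
  | inv x _ hx =>
    have := (expSubgroup 𝔨).inv_mem hx
    simpa [mul_assoc] using this

/-- A subalgebra containing `𝔥` and invariant under `Ad_H` is the Lie algebra of a Lie subgroup
containing `H`. -/
theorem LieSubgroup.exists_lieAlg_eq (H : LieSubgroup n G)
    (𝔨 : LieSubalgebra ℝ (GroupLieAlgebra (𝓡 n) G)) (h𝔨 : H.lieAlg ≤ 𝔨)
    (hAd : ∀ a ∈ H.toSubgroup, ∀ Y ∈ 𝔨, Ad a Y ∈ 𝔨) :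
    ∃ K : LieSubgroup n G, K.lieAlg = 𝔨 ∧ H.toSubgroup ≤ K.toSubgroup := by
  -- The product set `H · exp(𝔨)` is a subgroup because `H` normalizes `expSubgroup 𝔨`.
  let S : Subgroup G :=
    { carrier := {a | ∃ h ∈ H.toSubgroup, ∃ x ∈ expSubgroup 𝔨, a = h * x}
      one_mem' := ⟨1, one_mem _, 1, one_mem _, by simp⟩
      mul_mem' := by
        rintro _ _ ⟨h, hh, x, hx, rfl⟩ ⟨h', hh', x', hx', rfl⟩
        refine ⟨h * h', mul_mem hh hh', h'⁻¹ * x * h' * x', mul_mem ?_ hx', by group⟩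
        have := conj_mem_expSubgroup (hAd h'⁻¹ (inv_mem hh')) hx
        simpa using this
      inv_mem' := by
        rintro _ ⟨h, hh, x, hx, rfl⟩
        exact ⟨h⁻¹, inv_mem hh, h * x⁻¹ * h⁻¹, conj_mem_expSubgroup (hAd h hh) (inv_mem hx),
          by group⟩ }
  have hHS : H.toSubgroup ≤ S := fun h hh => ⟨h, hh, 1, one_mem _, by simp⟩
  have hES : expSubgroup 𝔨 ≤ S := fun x hx => ⟨1, one_mem _, x, hx, by simp⟩
  refine ⟨⟨S, 𝔨, hES, ?_, ?_⟩, rfl, hHS⟩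
  · have := H.countable_components
    -- Each coset in `S` has a representative from `H`, so the countably many components of `H`
    -- surject onto those of `S`.
    let f : H.toSubgroup ⧸ (expSubgroup H.lieAlg).subgroupOf H.toSubgroup →
        S ⧸ (expSubgroup 𝔨).subgroupOf S :=
      Quotient.map' (fun a => ⟨a.1, hHS a.2⟩) (by
        intro a b hab
        rw [QuotientGroup.leftRel_apply, Subgroup.mem_subgroupOf] at hab ⊢
        exact expSubgroup_mono h𝔨 hab)
    refine Function.Surjective.countable (f := f) ?_
    intro q
    induction q using QuotientGroup.induction_on with
    | H a =>
      obtain ⟨_, h, hh, x, hx, rfl⟩ := a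
      refine ⟨QuotientGroup.mk ⟨h, hh⟩, ?_⟩
      refine QuotientGroup.eq.2 ?_
      rw [Subgroup.mem_subgroupOf]
      simpa using hx
  · rintro _ ⟨h, hh, x, hx, rfl⟩ Y hY
    rw [Ad_mul_apply]
    exact hAd h hh _ (Ad_mem_of_mem_expSubgroup 𝔨 hx Y hY)

/-- Every element of the Lie algebra of a Lie subgroup generates a one-parameter subgroup in it. -/
theorem LieSubgroup.exists_integralCurve (K : LieSubgroup n G) {X : GroupLieAlgebra (𝓡 n) G}
    (hX : X ∈ K.lieAlg) : ∃ γ : ℝ → G, γ 0 = 1 ∧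
      IsMIntegralCurve (I := 𝓡 n) γ (mulInvariantVectorField X) ∧ ∀ t, γ t ∈ K.toSubgroup := by
  obtain ⟨γ, h0, h⟩ := exists_isMIntegralCurve_mulInvariantVectorField X
  exact ⟨γ, h0, h, fun t => K.expSubgroup_le (Subgroup.subset_closure
    ⟨t • X, K.lieAlg.smul_mem t hX, IsExp.of_integralCurve h0 h t⟩)⟩

theorem LieSubgroup.lie_mem_of_Ad_mem (K : LieSubgroup n G)
    {V : Submodule ℝ (GroupLieAlgebra (𝓡 n) G)}
    (hV : ∀ a ∈ K.toSubgroup, ∀ Y ∈ V, Ad a Y ∈ V) {X Y : GroupLieAlgebra (𝓡 n) G}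
    (hX : X ∈ K.lieAlg) (hY : Y ∈ V) : ⁅X, Y⁆ ∈ V := by
  obtain ⟨γ, h0, h, hγ⟩ := K.exists_integralCurve hX
  exact lie_mem_of_forall_Ad_mem h0 h (fun t => hV _ (hγ t)) hY

theorem integralCurve_neg {X : GroupLieAlgebra (𝓡 n) G} {γ : ℝ → G} (h0 : γ 0 = 1)
    (h : IsMIntegralCurve (I := 𝓡 n) γ (mulInvariantVectorField X)) (t : ℝ) :
    γ (-t) = (γ t)⁻¹ := by
  rw [eq_inv_iff_mul_eq_one, ← h.map_add h0, neg_add_cancel, h0]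

/-- A bi-invariant metric is `ad`-invariant. -/
theorem BiinvariantMetric.form_lie (Q : BiinvariantMetric n G) (X Y Z : GroupLieAlgebra (𝓡 n) G) :
    Q.form ⁅X, Y⁆ Z = -Q.form Y ⁅X, Z⁆ := by
  obtain ⟨γ, h0, h⟩ := exists_isMIntegralCurve_mulInvariantVectorField X
  have := form_lie_add_form_lie h0 h Q.form (x := Y) (y := Z) (fun t => by
    rw [integralCurve_neg h0 h, ← Q.inv (γ t) Y, Ad_apply_Ad_inv])
  linarith

end AdInvariance

/-! ### Traces and simultaneous diagonalization -/

section InnerFormBases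

namespace InnerForm

variable {V : Type*} [AddCommGroup V] [Module ℝ V] [FiniteDimensional ℝ V]

theorem form_sharp (g : InnerForm V) (f : Module.Dual ℝ V) (v : V) : g.form (g.sharp f) v = f v :=
  LinearMap.BilinForm.apply_toDual_symm_apply (hB := g.nondegenerate) _ _

theorem form_proj (Q : InnerForm V) (W : Submodule ℝ V) (v : V) (w : W) :
    Q.form (Q.proj W v : V) w = Q.form v w :=
  (Q.restrict W).form_sharp _ w

theorem eq_of_form_eq (g : InnerForm V) {v w : V} (h : ∀ u, g.form v u = g.form w u) : v = w := by
  by_contra hne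
  have := g.pos _ (sub_ne_zero.2 hne)
  rw [LinearMap.map_sub₂, h, sub_self] at this
  exact lt_irrefl _ this

theorem nonneg (g : InnerForm V) (v : V) : 0 ≤ g.form v v := by
  by_cases h : v = 0
  · simp [h]
  · exact (g.pos v h).le

theorem proj_coe (Q : InnerForm V) (W : Submodule ℝ V) (w : W) : Q.proj W (w : V) = w :=
  (Q.restrict W).eq_of_form_eq fun u => Q.form_proj W w u

/-- Simultaneous diagonalization of an inner product and a symmetric bilinear form. -/
theorem exists_basis (g : InnerForm V) (s : LinearMap.BilinForm ℝ V) (hs : ∀ x y, s x y = s y x) :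
    ∃ (b : Module.Basis (Fin (Module.finrank ℝ V)) ℝ V) (l : Fin (Module.finrank ℝ V) → ℝ),
      (∀ i j, g.form (b i) (b j) = if i = j then 1 else 0) ∧
      ∀ i j, s (b i) (b j) = if i = j then l i else 0 := by
  let c : InnerProductSpace.Core ℝ V :=
    { inner := fun x y => g.form x y
      conj_inner_symm := fun x y => g.symm y x
      re_inner_nonneg := fun x => g.nonneg x
      add_left := fun x y z => by simp
      smul_left := fun x y r => by simp
      definite := fun x hx => by
        by_contra h
        exact (g.pos x h).ne' hx }
  let _ : NormedAddCommGroup V := c.toNormedAddCommGroup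
  let _ : InnerProductSpace ℝ V := InnerProductSpace.ofCore c.toCore
  have hin : ∀ x y : V, inner ℝ x y = g.form x y := fun _ _ => rfl
  -- The operator representing `s` with respect to `g` is `g`-self-adjoint; its orthonormal
  -- eigenbasis diagonalizes both forms.
  let A : V →ₗ[ℝ] V := g.sharp ∘ₗ s
  have hA : ∀ x y, g.form (A x) y = s x y := fun x y => g.form_sharp _ _
  have hsymm : A.IsSymmetric := fun x y => by
    rw [hin, hin, hA, g.symm, hA, hs]
  let b := hsymm.eigenvectorBasis rfl
  refine ⟨b.toBasis, hsymm.eigenvalues rfl, fun i j => ?_, fun i j => ?_⟩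
  · have := orthonormal_iff_ite.1 b.orthonormal i j
    simpa [hin] using this
  · have h1 := orthonormal_iff_ite.1 b.orthonormal i j
    rw [hin] at h1
    have h2 : A (b i) = (hsymm.eigenvalues rfl i) • b i := hsymm.apply_eigenvectorBasis rfl i
    rw [OrthonormalBasis.coe_toBasis, ← hA, h2, map_smul, LinearMap.smul_apply, h1]
    simp

variable {ι : Type*} [Fintype ι] [DecidableEq ι]

theorem repr_eq (g : InnerForm V) (b : Module.Basis ι ℝ V) {x : ι → ℝ}
    (hb : ∀ i j, g.form (b i) (b j) = if i = j then x i else 0) (v : V) (i : ι) :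
    b.repr v i = g.form v (b i) / x i := by
  have hx : x i ≠ 0 := by
    have := g.pos _ (b.ne_zero i)
    rw [hb, if_pos rfl] at this
    exact this.ne'
  rw [eq_div_iff hx]
  have := congrArg (fun u => g.form u (b i)) (b.sum_repr v)
  simp only [map_sum, LinearMap.sum_apply, map_smul, LinearMap.smul_apply, hb, smul_eq_mul] at this
  simpa using this

theorem trace_eq (g : InnerForm V) (b : Module.Basis ι ℝ V) {x : ι → ℝ}
    (hb : ∀ i j, g.form (b i) (b j) = if i = j then x i else 0) (f : V →ₗ[ℝ] V) :
    LinearMap.trace ℝ V f = ∑ i, g.form (f (b i)) (b i) / x i := by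
  rw [LinearMap.trace_eq_matrix_trace ℝ b, Matrix.trace]
  simp only [Matrix.diag_apply, LinearMap.toMatrix_apply, g.repr_eq b hb]

theorem traceForm_eq (g : InnerForm V) (b : Module.Basis ι ℝ V) {x : ι → ℝ}
    (hb : ∀ i j, g.form (b i) (b j) = if i = j then x i else 0) (s : LinearMap.BilinForm ℝ V) :
    g.traceForm s = ∑ i, s (b i) (b i) / x i := by
  rw [traceForm, g.trace_eq b hb]
  simp only [LinearMap.comp_apply, form_sharp]

theorem form_eq_sum (g : InnerForm V) (b : Module.Basis ι ℝ V)
    (hb : ∀ i j, g.form (b i) (b j) = if i = j then 1 else 0) (v w : V) :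
    g.form v w = ∑ i, g.form v (b i) * g.form w (b i) := by
  conv_lhs => rw [← b.sum_repr w]
  simp only [map_sum, map_smul, smul_eq_mul, g.repr_eq b hb]
  exact Finset.sum_congr rfl fun i _ => by ring

theorem trace_comp_eq (g : InnerForm V) (b : Module.Basis ι ℝ V)
    (hb : ∀ i j, g.form (b i) (b j) = if i = j then 1 else 0) (f h : V →ₗ[ℝ] V) :
    LinearMap.trace ℝ V (f ∘ₗ h) = ∑ i, ∑ j, g.form (h (b i)) (b j) * g.form (f (b j)) (b i) := by
  rw [g.trace_eq b hb]
  refine Finset.sum_congr rfl fun i _ => ?_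
  rw [LinearMap.comp_apply]
  conv_lhs => rw [← b.sum_repr (h (b i))]
  simp only [map_sum, map_smul, smul_eq_mul, g.repr_eq b hb, LinearMap.sum_apply,
    LinearMap.smul_apply, div_one]

end InnerForm

end InnerFormBases

/-! ### Explicit formulas for the Ricci and scalar curvatures -/

section RicciFormula

variable {𝔤 : Type*} [LieRing 𝔤] [LieAlgebra ℝ 𝔤] [FiniteDimensional ℝ 𝔤]
variable {ι : Type*} [Fintype ι] [DecidableEq ι]

/-- `Q` is invariant under the adjoint action of the Lie algebra. -/
def InnerForm.IsAdInvariant (Q : InnerForm 𝔤) : Prop :=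
  ∀ X Y Z : 𝔤, Q.form ⁅X, Y⁆ Z = -Q.form Y ⁅X, Z⁆

theorem InnerForm.IsAdInvariant.form_lie_self {Q : InnerForm 𝔤} (hQ : Q.IsAdInvariant) (X Y : 𝔤) :
    Q.form ⁅X, Y⁆ Y = 0 := by
  have := hQ X Y Y
  rw [Q.symm Y] at this
  linarith

theorem form_bracketProj (Q : InnerForm 𝔤) (W : Submodule ℝ 𝔤) (X Y Z : W) :
    Q.form (bracketProj Q W X Y : 𝔤) Z = Q.form ⁅(X : 𝔤), (Y : 𝔤)⁆ Z :=
  Q.form_proj W _ Z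

/-- This is the unimodularity used below: `Q(ad X v, v) = 0`, so the diagonal entries vanish in a
`Q`-orthonormal basis. -/
theorem trace_bracketProj {Q : InnerForm 𝔤} (hQ : Q.IsAdInvariant) (W : Submodule ℝ 𝔤) (X : W) :
    LinearMap.trace ℝ W (bracketProj Q W X) = 0 := by
  obtain ⟨b, -, hb, -⟩ := (Q.restrict W).exists_basis 0 (by simp)
  rw [(Q.restrict W).trace_eq b hb]
  refine Finset.sum_eq_zero fun i _ => ?_
  have : (Q.restrict W).form (bracketProj Q W X (b i)) (b i) = 0 :=
    (form_bracketProj Q W X (b i) (b i)).trans (hQ.form_lie_self _ _)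
  simp [this]

/-- The endomorphism `X ↦ [[X, Y]_𝔭, Z]_W`. -/
noncomputable def isotropyEnd (Q : InnerForm 𝔤) (W : Submodule ℝ 𝔤) (Y Z : W) : W →ₗ[ℝ] W where
  toFun X := Q.proj W ⁅⁅(X : 𝔤), (Y : 𝔤)⁆ - (bracketProj Q W X Y : 𝔤), (Z : 𝔤)⁆
  map_add' X X' := by
    simp only [map_add, LinearMap.add_apply, Submodule.coe_add, add_lie, sub_lie, map_sub]
    abel
  map_smul' c X := by
    simp only [map_smul, LinearMap.smul_apply, Submodule.coe_smul, smul_lie, sub_lie,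
      map_sub, smul_sub, RingHom.id_apply]

/-- The part of the Ricci curvature that does not depend on the metric. -/
noncomputable def ricciBase (Q : InnerForm 𝔤) (W : Submodule ℝ 𝔤) (Y Z : W) : ℝ :=
  -(LinearMap.trace ℝ W (bracketProj Q W Y ∘ₗ bracketProj Q W Z)) / 2
    - LinearMap.trace ℝ W (isotropyEnd Q W Y Z)

omit [DecidableEq ι] in
-- Two double sums agree once their symmetrizations in `i, j` agree, which reduces the identity to a
-- pointwise computation.
theorem ricci_sum_identity (Y Z y z : ι → ι → ℝ) (hy : ∀ i j, y j i = -y i j)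
    (hz : ∀ i j, z j i = -z i j) :
    ∑ i, ∑ j, ((-Z i j + z j i - Z j i) / 2 * ((Y i j - Y j i + y j i) / 2)
      + Y i j * ((-Z j i + z i j - Z i j) / 2)) =
    -(∑ i, ∑ j, Y i j * Z i j) / 2 + (∑ i, ∑ j, y i j * z i j) / 4
      - (∑ i, ∑ j, Z i j * Y j i) / 2 := by
  have key : ∀ f h : ι → ι → ℝ, (∀ i j, f i j + f j i = h i j + h j i) →
      ∑ i, ∑ j, f i j = ∑ i, ∑ j, h i j := by
    intro f h hfh
    have h1 : ∑ i, ∑ j, (f i j + f j i) = ∑ i, ∑ j, (h i j + h j i) := by simp only [hfh]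
    have h2 : ∀ f : ι → ι → ℝ, ∑ i, ∑ j, (f i j + f j i) = 2 * ∑ i, ∑ j, f i j := by
      intro f
      simp only [Finset.sum_add_distrib]
      rw [Finset.sum_comm (f := fun i j => f j i)]
      ring
    rw [h2, h2] at h1
    linarith
  rw [key _ (fun i j => -(Y i j * Z i j) / 2 + (y i j * z i j) / 4 - (Z i j * Y j i) / 2)]
  · simp only [Finset.sum_add_distrib, Finset.sum_sub_distrib, Finset.sum_div, Finset.sum_neg_distrib,
      neg_div]
  · intro i j
    rw [hy i j, hz i j]
    ring

/-- The trace of the curvature is expanded in a `g`-orthonormal frame and the connection is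
eliminated by the Koszul formula. All dependence on `g` then sits in two quadratic sums of structure
constants. -/
theorem ricci_apply {Q : InnerForm 𝔤} (hQ : Q.IsAdInvariant) (W : Submodule ℝ 𝔤) (g : InnerForm W)
    (e : Module.Basis ι ℝ W) (he : ∀ i j, g.form (e i) (e j) = if i = j then 1 else 0) (Y Z : W) :
    ricci Q W g Y Z =
      -(∑ i, ∑ j, g.form (bracketProj Q W Y (e i)) (e j) * g.form (bracketProj Q W Z (e i)) (e j)) / 2
      + (∑ i, ∑ j, g.form (bracketProj Q W (e i) (e j)) Y * g.form (bracketProj Q W (e i) (e j)) Z) / 4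
      + ricciBase Q W Y Z := by
  -- By the Koszul formula this vector pairs with `w` to the trace of `bracketProj Q W w`, which is
  -- zero.
  have hdiv : ∑ i, leviCivita Q W g (e i) (e i) = 0 := by
    refine g.eq_of_form_eq fun w => ?_
    rw [map_sum, LinearMap.sum_apply, map_zero, LinearMap.zero_apply]
    have h1 := g.trace_eq e he (bracketProj Q W w)
    rw [trace_bracketProj hQ] at h1
    rw [h1]
    refine Finset.sum_congr rfl fun i _ => ?_
    rw [form_leviCivita]
    simp only [koszulForm, LinearMap.coe_mk, AddHom.coe_mk]
    have h2 : bracketProj Q W (e i) (e i) = 0 := by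
      simp [bracketProj]
    rw [h2]
    simp
  have h1 : ricci Q W g Y Z = LinearMap.trace ℝ W (riemannEnd Q W g Y Z) := rfl
  rw [h1, g.trace_eq e he, ricciBase, g.trace_comp_eq e he,
    g.trace_eq e he (isotropyEnd Q W Y Z)]
  -- Metric compatibility moves the outer connection to the other argument: the first term then
  -- pairs with the vector killed by `hdiv`, the second becomes a sum of products of connection
  -- coefficients.
  have hterm : ∀ i, g.form (riemannEnd Q W g Y Z (e i)) (e i) / 1 =
      -g.form (leviCivita Q W g Y Z) (leviCivita Q W g (e i) (e i))
      + ∑ j, (g.form (leviCivita Q W g (e i) Z) (e j) * g.form (leviCivita Q W g Y (e i)) (e j)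
        + g.form (bracketProj Q W Y (e i)) (e j) * g.form (leviCivita Q W g (e j) Z) (e i))
      - g.form (isotropyEnd Q W Y Z (e i)) (e i) / 1 := by
    intro i
    have a1 := leviCivita_metric Q W g (e i) (leviCivita Q W g Y Z) (e i)
    have a2 := leviCivita_metric Q W g Y (leviCivita Q W g (e i) Z) (e i)
    rw [g.form_eq_sum e he (leviCivita Q W g (e i) Z)] at a2
    have a3 : g.form (leviCivita Q W g (bracketProj Q W (e i) Y) Z) (e i) =
        -∑ j, g.form (bracketProj Q W Y (e i)) (e j) * g.form (leviCivita Q W g (e j) Z) (e i) := by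
      rw [bracketProj_swap]
      conv_lhs => rw [← e.sum_repr (bracketProj Q W Y (e i))]
      simp only [map_neg, map_sum, map_smul, LinearMap.sum_apply, LinearMap.neg_apply,
        LinearMap.smul_apply, smul_eq_mul, g.repr_eq e he, div_one]
    have a4 : riemannEnd Q W g Y Z (e i) = leviCivita Q W g (e i) (leviCivita Q W g Y Z)
      - leviCivita Q W g Y (leviCivita Q W g (e i) Z)
      - leviCivita Q W g (bracketProj Q W (e i) Y) Z - isotropyEnd Q W Y Z (e i) := rfl
    rw [a4]
    simp only [map_sub, LinearMap.sub_apply, Finset.sum_add_distrib]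
    rw [a3]
    linarith
  rw [Finset.sum_congr rfl fun i _ => hterm i]
  rw [Finset.sum_sub_distrib, Finset.sum_add_distrib, Finset.sum_neg_distrib, ← map_sum, hdiv,
    map_zero]
  have hk : ∀ X Y Z, g.form (leviCivita Q W g X Y) Z = (g.form (bracketProj Q W X Y) Z
      + g.form (bracketProj Q W Z X) Y + g.form (bracketProj Q W Z Y) X) / 2 :=
    fun X Y Z => form_leviCivita Q W g X Y Z
  have hsw : ∀ X Y Z, g.form (bracketProj Q W X Y) Z = -g.form (bracketProj Q W Y X) Z := by
    intro X Y Z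
    rw [bracketProj_swap, map_neg, LinearMap.neg_apply]
  have key := ricci_sum_identity
    (fun i j => g.form (bracketProj Q W Y (e i)) (e j))
    (fun i j => g.form (bracketProj Q W Z (e i)) (e j))
    (fun i j => g.form (bracketProj Q W (e i) (e j)) Y)
    (fun i j => g.form (bracketProj Q W (e i) (e j)) Z)
    (fun i j => hsw _ _ _) (fun i j => hsw _ _ _)
  have h2 : ∀ i j, g.form (leviCivita Q W g (e i) Z) (e j) * g.form (leviCivita Q W g Y (e i)) (e j)
        + g.form (bracketProj Q W Y (e i)) (e j) * g.form (leviCivita Q W g (e j) Z) (e i) =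
      (-g.form (bracketProj Q W Z (e i)) (e j) + g.form (bracketProj Q W (e j) (e i)) Z
        - g.form (bracketProj Q W Z (e j)) (e i)) / 2
      * ((g.form (bracketProj Q W Y (e i)) (e j) - g.form (bracketProj Q W Y (e j)) (e i)
        + g.form (bracketProj Q W (e j) (e i)) Y) / 2)
      + g.form (bracketProj Q W Y (e i)) (e j) * ((-g.form (bracketProj Q W Z (e j)) (e i)
        + g.form (bracketProj Q W (e i) (e j)) Z - g.form (bracketProj Q W Z (e i)) (e j)) / 2) := by
    intro i j
    rw [hk, hk, hk, hsw (e i) Z, hsw (e j) Z, hsw (e j) Y]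
    ring
  simp only [h2]
  rw [key]
  ring

theorem scalarCurvature_eq_of_orthonormal {Q : InnerForm 𝔤} (hQ : Q.IsAdInvariant)
    (W : Submodule ℝ 𝔤) (g : InnerForm W)
    (e : Module.Basis ι ℝ W) (he : ∀ i j, g.form (e i) (e j) = if i = j then 1 else 0) :
    scalarCurvature Q W g = ∑ i, ricciBase Q W (e i) (e i)
      - (∑ i, ∑ j, ∑ k, g.form (bracketProj Q W (e i) (e j)) (e k) ^ 2) / 4 := by
  rw [scalarCurvature, g.traceForm_eq e he]
  simp only [ricci_apply hQ W g e he, div_one, Finset.sum_add_distrib, ← pow_two, ← Finset.sum_div,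
    Finset.sum_neg_distrib]
  have : ∑ k, ∑ i, ∑ j, g.form (bracketProj Q W (e i) (e j)) (e k) ^ 2 =
      ∑ i, ∑ j, ∑ k, g.form (bracketProj Q W (e i) (e j)) (e k) ^ 2 := by
    rw [Finset.sum_comm]
    exact Finset.sum_congr rfl fun i _ => Finset.sum_comm
  rw [this]
  ring

theorem ricciBase_smul (Q : InnerForm 𝔤) (W : Submodule ℝ 𝔤) (c : ℝ) (Y : W) :
    ricciBase Q W (c • Y) (c • Y) = c ^ 2 * ricciBase Q W Y Y := by
  have h : isotropyEnd Q W (c • Y) (c • Y) = (c ^ 2) • isotropyEnd Q W Y Y := by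
    ext1 X
    simp only [isotropyEnd, LinearMap.coe_mk, AddHom.coe_mk, LinearMap.smul_apply, map_smul,
      Submodule.coe_smul, lie_smul, ← smul_sub, smul_lie, smul_smul, pow_two]
  simp only [ricciBase, h, map_smul, LinearMap.smul_comp, LinearMap.comp_smul, smul_eq_mul]
  ring

/-- The scalar curvature in an orthogonal basis. -/
theorem scalarCurvature_eq {Q : InnerForm 𝔤} (hQ : Q.IsAdInvariant)
    (W : Submodule ℝ 𝔤) (g : InnerForm W) (e : Module.Basis ι ℝ W) {x : ι → ℝ}
    (he : ∀ i j, g.form (e i) (e j) = if i = j then x i else 0) :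
    scalarCurvature Q W g = ∑ i, ricciBase Q W (e i) (e i) / x i
      - (∑ i, ∑ j, ∑ k, g.form (bracketProj Q W (e i) (e j)) (e k) ^ 2 / (x i * x j * x k)) / 4 := by
  have hx : ∀ i, 0 < x i := fun i => by
    have := g.pos _ (e.ne_zero i)
    rwa [he, if_pos rfl] at this
  have hs : ∀ i, (√(x i))⁻¹ ≠ 0 := fun i => inv_ne_zero (Real.sqrt_pos.2 (hx i)).ne'
  have hs2 : ∀ i, (√(x i))⁻¹ ^ 2 = (x i)⁻¹ := fun i => by
    rw [inv_pow, Real.sq_sqrt (hx i).le]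
  let e' := e.unitsSMul (fun i => Units.mk0 _ (hs i))
  have he' : ∀ i, e' i = (√(x i))⁻¹ • e i := fun i => Module.Basis.unitsSMul_apply i
  rw [scalarCurvature_eq_of_orthonormal hQ W g e']
  · congr 1
    · refine Finset.sum_congr rfl fun i _ => ?_
      rw [he', ricciBase_smul, hs2]
      ring
    · congr 1
      refine Finset.sum_congr rfl fun i _ => Finset.sum_congr rfl fun j _ =>
        Finset.sum_congr rfl fun k _ => ?_
      simp only [he', map_smul, LinearMap.smul_apply, smul_eq_mul]
      rw [mul_pow, mul_pow, mul_pow, hs2, hs2, hs2]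
      have := (hx i).ne'
      have := (hx j).ne'
      have := (hx k).ne'
      field_simp
  · intro i j
    simp only [he', map_smul, LinearMap.smul_apply, smul_eq_mul, he]
    split_ifs with h
    · subst h
      have := hs2 i
      have h0 := (hx i).ne'
      calc _ = (√(x i))⁻¹ ^ 2 * x i := by ring
        _ = 1 := by rw [hs2]; field_simp
    · simp

/-- Ad-invariance makes the structure constants skew in all indices, so both traces become sums of
squares: half the squared components in `W` from the Killing-type term, and the squared length of
the component of the bracket orthogonal to `W` from the isotropy term. -/
theorem ricciBase_eq {Q : InnerForm 𝔤} (hQ : Q.IsAdInvariant) (W : Submodule ℝ 𝔤)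
    (b : Module.Basis ι ℝ W) (hb : ∀ i j, Q.form (b i : 𝔤) (b j) = if i = j then 1 else 0)
    (Y : W) : ricciBase Q W Y Y = ∑ i, Q.form ⁅(Y : 𝔤), (b i : 𝔤)⁆ ⁅(Y : 𝔤), (b i : 𝔤)⁆
      - (∑ i, ∑ j, Q.form ⁅(Y : 𝔤), (b i : 𝔤)⁆ (b j) ^ 2) / 2 := by
  have hb' : ∀ i j, (Q.restrict W).form (b i) (b j) = if i = j then 1 else 0 := hb
  rw [ricciBase, (Q.restrict W).trace_comp_eq b hb', (Q.restrict W).trace_eq b hb']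
  have h0 : ∀ X Z : W, (Q.restrict W).form X Z = Q.form (X : 𝔤) Z := fun _ _ => rfl
  simp only [h0, form_bracketProj]
  have h1 : ∀ i j, Q.form ⁅(Y : 𝔤), (b i : 𝔤)⁆ (b j) * Q.form ⁅(Y : 𝔤), (b j : 𝔤)⁆ (b i) =
      -Q.form ⁅(Y : 𝔤), (b i : 𝔤)⁆ (b j) ^ 2 := by
    intro i j
    rw [hQ Y (b j), Q.symm (b j : 𝔤)]
    ring
  have h2 : ∀ i, Q.form (isotropyEnd Q W Y Y (b i) : 𝔤) (b i) =
      ∑ j, Q.form ⁅(Y : 𝔤), (b i : 𝔤)⁆ (b j) ^ 2 -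
      Q.form ⁅(Y : 𝔤), (b i : 𝔤)⁆ ⁅(Y : 𝔤), (b i : 𝔤)⁆ := by
    intro i
    have a1 : Q.form (isotropyEnd Q W Y Y (b i) : 𝔤) (b i) =
        Q.form ⁅⁅(b i : 𝔤), (Y : 𝔤)⁆ - (bracketProj Q W (b i) Y : 𝔤), (Y : 𝔤)⁆ (b i) :=
      Q.form_proj W _ (b i)
    have a2 : Q.form (bracketProj Q W (b i) Y : 𝔤) (bracketProj Q W (b i) Y) =
        ∑ j, Q.form ⁅(Y : 𝔤), (b i : 𝔤)⁆ (b j) ^ 2 := by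
      have := (Q.restrict W).form_eq_sum b hb' (bracketProj Q W (b i) Y) (bracketProj Q W (b i) Y)
      simp only [h0, form_bracketProj] at this
      rw [form_bracketProj, this]
      refine Finset.sum_congr rfl fun j _ => ?_
      rw [← lie_skew, map_neg, LinearMap.neg_apply]
      ring
    have a3 := form_bracketProj Q W (b i) Y (bracketProj Q W (b i) Y)
    rw [a1, ← lie_skew, map_neg, LinearMap.neg_apply, hQ, neg_neg, ← lie_skew (b i : 𝔤) (Y : 𝔤),
      ← a2]
    rw [← lie_skew (b i : 𝔤) (Y : 𝔤)] at a3
    simp only [map_sub, map_neg, LinearMap.sub_apply, LinearMap.neg_apply] at a3 ⊢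
    have a4 := Q.symm (bracketProj Q W (b i) Y : 𝔤) ⁅(Y : 𝔤), (b i : 𝔤)⁆
    linarith
  simp only [h1, h2, div_one, Finset.sum_sub_distrib, Finset.sum_neg_distrib]
  ring

/-- The scalar curvature of the metric for which the `Q`-orthonormal family `b` is orthogonal with
`g (b i) (b i) = (y i)⁻¹`. -/
noncomputable def scal (Q : InnerForm 𝔤) (b : ι → 𝔤) (y : ι → ℝ) : ℝ :=
  ∑ i, y i * (∑ j, Q.form ⁅b i, b j⁆ ⁅b i, b j⁆ - (∑ j, ∑ k, Q.form ⁅b i, b j⁆ (b k) ^ 2) / 2)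
    - (∑ i, ∑ j, ∑ k, Q.form ⁅b i, b j⁆ (b k) ^ 2 * (y i * y j / y k)) / 4

theorem scalarCurvature_eq_scal {Q : InnerForm 𝔤} (hQ : Q.IsAdInvariant)
    (W : Submodule ℝ 𝔤) (g : InnerForm W) (b : Module.Basis ι ℝ W)
    (hb : ∀ i j, Q.form (b i : 𝔤) (b j) = if i = j then 1 else 0) {y : ι → ℝ}
    (hg : ∀ i j, g.form (b i) (b j) = if i = j then (y i)⁻¹ else 0) :
    scalarCurvature Q W g = scal Q (fun i => (b i : 𝔤)) y := by
  have hy : ∀ i, y i ≠ 0 := fun i h => by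
    have := g.pos _ (b.ne_zero i)
    rw [hg, if_pos rfl, h] at this
    simp at this
  rw [scalarCurvature_eq hQ W g b hg, scal]
  congr 1
  · refine Finset.sum_congr rfl fun i _ => ?_
    rw [ricciBase_eq hQ W b hb]
    field_simp
  · congr 1
    refine Finset.sum_congr rfl fun i _ => Finset.sum_congr rfl fun j _ =>
      Finset.sum_congr rfl fun k _ => ?_
    have hb' : ∀ i j, (Q.restrict W).form (b i) (b j) = if i = j then 1 else 0 := hb
    have : g.form (bracketProj Q W (b i) (b j)) (b k) =
        Q.form ⁅(b i : 𝔤), (b j : 𝔤)⁆ (b k) * (y k)⁻¹ := by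
      conv_lhs => rw [← b.sum_repr (bracketProj Q W (b i) (b j))]
      simp only [map_sum, map_smul, LinearMap.sum_apply, LinearMap.smul_apply, hg, smul_eq_mul,
        (Q.restrict W).repr_eq b hb', div_one]
      rw [Finset.sum_eq_single k (by intro l _ h; simp [h]) (by simp), if_pos rfl]
      congr 1
      exact form_bracketProj Q W (b i) (b j) (b k)
    rw [this]
    have := hy i
    have := hy j
    have := hy k
    field_simp

end RicciFormula

/-! ### First variation of the scalar curvature -/

section Variation

/-- A positive multiple of an inner product. -/
noncomputable def InnerForm.smul {V : Type*} [AddCommGroup V] [Module ℝ V] (g : InnerForm V) (c : ℝ)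
    (hc : 0 < c) : InnerForm V where
  form := c • g.form
  symm x y := by simp [g.symm x y]
  pos x hx := by simpa using mul_pos hc (g.pos x hx)

variable {𝔤 : Type*} [LieRing 𝔤] [LieAlgebra ℝ 𝔤] [FiniteDimensional ℝ 𝔤]

theorem InnerForm.smul_form_apply {V : Type*} [AddCommGroup V] [Module ℝ V] (g : InnerForm V)
    (c : ℝ) (hc : 0 < c) (x y : V) : (g.smul c hc).form x y = c * g.form x y := rfl

theorem InnerForm.traceForm_smul {V : Type*} [AddCommGroup V] [Module ℝ V] [FiniteDimensional ℝ V]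
    (g : InnerForm V) (c : ℝ) (hc : 0 < c) (s : LinearMap.BilinForm ℝ V) :
    (g.smul c hc).traceForm s = g.traceForm s / c := by
  obtain ⟨e, -, he, -⟩ := g.exists_basis 0 (by simp)
  rw [g.traceForm_eq e he, (g.smul c hc).traceForm_eq e (x := fun _ => c) (fun i j => by
    rw [smul_form_apply, he]; split_ifs <;> simp)]
  simp [Finset.sum_div]

theorem scalarCurvature_smul {Q : InnerForm 𝔤} (hQ : Q.IsAdInvariant) (W : Submodule ℝ 𝔤)
    (g : InnerForm W) (c : ℝ) (hc : 0 < c) :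
    scalarCurvature Q W (g.smul c hc) = scalarCurvature Q W g / c := by
  obtain ⟨e, -, he, -⟩ := g.exists_basis 0 (by simp)
  rw [scalarCurvature_eq hQ W g e he, scalarCurvature_eq hQ W _ e (x := fun _ => c) (fun i j => by
    rw [InnerForm.smul_form_apply, he]; split_ifs <;> simp)]
  rw [sub_div, Finset.sum_div]
  congr 1
  · simp [Finset.sum_div]
  · rw [div_right_comm]
    congr 1
    simp only [Finset.sum_div]
    refine Finset.sum_congr rfl fun i _ => Finset.sum_congr rfl fun j _ =>
      Finset.sum_congr rfl fun k _ => ?_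
    rw [InnerForm.smul_form_apply]
    field_simp

theorem trace_isotropyEnd_comm {Q : InnerForm 𝔤} (hQ : Q.IsAdInvariant) (W : Submodule ℝ 𝔤)
    (Y Z : W) : LinearMap.trace ℝ W (isotropyEnd Q W Y Z) =
      LinearMap.trace ℝ W (isotropyEnd Q W Z Y) := by
  obtain ⟨b, -, hb, -⟩ := (Q.restrict W).exists_basis 0 (by simp)
  rw [(Q.restrict W).trace_eq b hb, (Q.restrict W).trace_eq b hb]
  have key : ∀ (Y Z : W) i, (Q.restrict W).form (isotropyEnd Q W Y Z (b i)) (b i) =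
      Q.form (bracketProj Q W (b i) Y : 𝔤) (bracketProj Q W (b i) Z) -
        Q.form ⁅(b i : 𝔤), (Y : 𝔤)⁆ ⁅(b i : 𝔤), (Z : 𝔤)⁆ := by
    intro Y Z i
    have a1 : Q.form (isotropyEnd Q W Y Z (b i) : 𝔤) (b i) =
        Q.form ⁅⁅(b i : 𝔤), (Y : 𝔤)⁆ - (bracketProj Q W (b i) Y : 𝔤), (Z : 𝔤)⁆ (b i) :=
      Q.form_proj W _ (b i)
    have a2 := form_bracketProj Q W (b i) Z (bracketProj Q W (b i) Y)
    have a3 := Q.symm (bracketProj Q W (b i) Y : 𝔤) (bracketProj Q W (b i) Z)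
    have a4 := Q.symm (bracketProj Q W (b i) Y : 𝔤) ⁅(b i : 𝔤), (Z : 𝔤)⁆
    refine a1.trans ?_
    rw [← lie_skew, map_neg, LinearMap.neg_apply, hQ, neg_neg, ← lie_skew (b i : 𝔤) (Z : 𝔤)]
    rw [← lie_skew (b i : 𝔤) (Z : 𝔤)] at a2 a4
    simp only [map_sub, map_neg, LinearMap.sub_apply, LinearMap.neg_apply] at a2 a4 ⊢
    linarith
  refine Finset.sum_congr rfl fun i _ => ?_
  rw [key, key, Q.symm (bracketProj Q W (b i) Y : 𝔤), Q.symm ⁅(b i : 𝔤), (Y : 𝔤)⁆]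

/-- The Ricci curvature is symmetric. -/
theorem ricci_comm {Q : InnerForm 𝔤} (hQ : Q.IsAdInvariant) (W : Submodule ℝ 𝔤) (g : InnerForm W)
    (Y Z : W) : ricci Q W g Y Z = ricci Q W g Z Y := by
  obtain ⟨e, -, he, -⟩ := g.exists_basis 0 (by simp)
  rw [ricci_apply hQ W g e he, ricci_apply hQ W g e he, ricciBase, ricciBase,
    trace_isotropyEnd_comm hQ W Y Z, LinearMap.trace_comp_comm']
  congr 2
  · congr 2
    exact Finset.sum_congr rfl fun i _ => Finset.sum_congr rfl fun j _ => mul_comm _ _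
  · congr 1
    exact Finset.sum_congr rfl fun i _ => Finset.sum_congr rfl fun j _ => mul_comm _ _

/-- The right side is minus the derivative at `t = 0` of the formula for the scalar curvature with
`x i = 1 + t * l i`. Thus the differential of the scalar curvature in the direction `diag l` is the
negative of its pairing with `Ric`. -/
theorem sum_mul_ricci {Q : InnerForm 𝔤} (hQ : Q.IsAdInvariant) (W : Submodule ℝ 𝔤)
    (g : InnerForm W) {ι : Type*} [Fintype ι] [DecidableEq ι]
    (e : Module.Basis ι ℝ W) (he : ∀ i j, g.form (e i) (e j) = if i = j then 1 else 0) (l : ι → ℝ) :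
    ∑ i, l i * ricci Q W g (e i) (e i) = ∑ i, ricciBase Q W (e i) (e i) * l i +
      (∑ i, ∑ j, ∑ k, g.form (bracketProj Q W (e i) (e j)) (e k) ^ 2 * (l k - l i - l j)) / 4 := by
  set c : ι → ι → ι → ℝ := fun i j k => g.form (bracketProj Q W (e i) (e j)) (e k) ^ 2 with hc
  have hcs : ∀ i j k, c i j k = c j i k := by
    intro i j k
    simp only [hc]
    rw [bracketProj_swap, map_neg, LinearMap.neg_apply]
    ring
  have h1 : ∀ i, l i * ricci Q W g (e i) (e i) = ricciBase Q W (e i) (e i) * l i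
      - (∑ j, ∑ k, c i j k * l i) / 2 + (∑ j, ∑ k, c j k i * l i) / 4 := by
    intro i
    rw [ricci_apply hQ W g e he]
    simp only [hc, ← Finset.sum_mul, ← pow_two]
    ring
  have h2 : ∑ i, ∑ j, ∑ k, c j k i * l i = ∑ i, ∑ j, ∑ k, c i j k * l k := by
    rw [Finset.sum_comm]
    exact Finset.sum_congr rfl fun i _ => Finset.sum_comm
  have h3 : ∑ i, ∑ j, ∑ k, c i j k * l j = ∑ i, ∑ j, ∑ k, c i j k * l i := by
    rw [Finset.sum_comm]
    exact Finset.sum_congr rfl fun i _ => Finset.sum_congr rfl fun j _ =>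
      Finset.sum_congr rfl fun k _ => by rw [hcs]
  have h4 : ∑ i, ∑ j, ∑ k, c i j k * (l k - l i - l j) = ∑ i, ∑ j, ∑ k, c i j k * l k
      - ∑ i, ∑ j, ∑ k, c i j k * l i - ∑ i, ∑ j, ∑ k, c i j k * l j := by
    simp only [← Finset.sum_sub_distrib, mul_sub]
  simp only [h1, Finset.sum_add_distrib, Finset.sum_sub_distrib, ← Finset.sum_div]
  rw [h2, h4, h3]
  ring

/-- If `g` maximizes the scale-invariant quotient of the scalar curvature and the trace of `T` in
the direction of `Ric - S T`, then `Ric = S T`. -/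
theorem ricci_eq_of_scalarCurvature_le {Q : InnerForm 𝔤} (hQ : Q.IsAdInvariant)
    (W : Submodule ℝ 𝔤) (g : InnerForm W) (T : LinearMap.BilinForm ℝ W)
    (hTs : ∀ x y, T x y = T y x) (hT : g.traceForm T = 1)
    (hmax : ∀ (g' : InnerForm W) (t : ℝ),
      g'.form = g.form + t • (ricci Q W g - scalarCurvature Q W g • T) →
      scalarCurvature Q W g' ≤ scalarCurvature Q W g * g'.traceForm T) :
    ricci Q W g = scalarCurvature Q W g • T := by
  set S := scalarCurvature Q W g with hS
  set η := ricci Q W g - S • T with hη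
  -- Diagonalizing the variation against `g` keeps the whole line `g + t η` diagonal, so the
  -- explicit curvature formula applies for all small `t`.
  obtain ⟨e, l, he, hl⟩ := g.exists_basis η (fun x y => by
    simp only [hη, LinearMap.sub_apply, LinearMap.smul_apply, ricci_comm hQ W g x y, hTs x y])
  have hηe : ∀ v k, η v (e k) = l k * g.form v (e k) := by
    intro v k
    conv_lhs => rw [← e.sum_repr v]
    simp only [map_sum, map_smul, LinearMap.sum_apply, LinearMap.smul_apply, hl, smul_eq_mul,
      g.repr_eq e he]
    rw [Finset.sum_eq_single k (by intro l _ h; simp [h]) (by simp), if_pos rfl]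
    ring
  have hpos : ∀ᶠ t in 𝓝 (0 : ℝ), ∀ i, 0 < 1 + t * l i := by
    rw [eventually_all]
    intro i
    have : ContinuousAt (fun t : ℝ => 1 + t * l i) 0 := by fun_prop
    exact this.eventually_const_lt (by simp)
  set c : Fin _ → Fin _ → Fin _ → ℝ := fun i j k => g.form (bracketProj Q W (e i) (e j)) (e k) ^ 2
    with hc
  let φ : ℝ → ℝ := fun t => ∑ i, ricciBase Q W (e i) (e i) * (1 + t * l i)⁻¹
    - (∑ i, ∑ j, ∑ k, c i j k * ((1 + t * l k) * (1 + t * l i)⁻¹ * (1 + t * l j)⁻¹)) / 4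
    - S * ∑ i, T (e i) (e i) * (1 + t * l i)⁻¹
  have hφ : ∀ t, (∀ i, 0 < 1 + t * l i) → ∃ g' : InnerForm W, g'.form = g.form + t • η ∧
      φ t = scalarCurvature Q W g' - S * g'.traceForm T := by
    intro t ht
    have hform : ∀ v k, (g.form + t • η) v (e k) = (1 + t * l k) * g.form v (e k) := by
      intro v k
      simp only [LinearMap.add_apply, LinearMap.smul_apply, hηe, smul_eq_mul]
      ring
    let g' : InnerForm W :=
      { form := g.form + t • η
        symm := fun x y => by
          simp only [hη, LinearMap.add_apply, LinearMap.smul_apply, LinearMap.sub_apply, g.symm x y,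
            ricci_comm hQ W g x y, hTs x y]
        pos := fun v hv => by
          have h1 : (g.form + t • η) v v = ∑ i, (1 + t * l i) * (e.repr v i) ^ 2 := by
            conv_lhs => rw [← e.sum_repr v]
            rw [map_sum]
            refine Finset.sum_congr rfl fun i _ => ?_
            rw [e.sum_repr, map_smul, hform, smul_eq_mul, g.repr_eq e he]
            ring
          rw [h1]
          have h2 : ∃ i, e.repr v i ≠ 0 := by
            by_contra h
            push Not at h
            exact hv (e.repr.map_eq_zero_iff.1 (Finsupp.ext h))
          obtain ⟨i, hi⟩ := h2
          exact Finset.sum_pos' (fun j _ => mul_nonneg (ht j).le (sq_nonneg _))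
            ⟨i, Finset.mem_univ i, mul_pos (ht i) (by positivity)⟩ }
    have hg' : ∀ v k, g'.form v (e k) = (1 + t * l k) * g.form v (e k) := hform
    have hge : ∀ i j, g'.form (e i) (e j) = if i = j then 1 + t * l i else 0 := by
      intro i j
      rw [hg', he]
      split_ifs with h
      · rw [h, mul_one]
      · simp
    refine ⟨g', rfl, ?_⟩
    rw [scalarCurvature_eq hQ W g' e hge, g'.traceForm_eq e hge]
    simp only [φ, div_eq_mul_inv (T _ _), div_eq_mul_inv (ricciBase _ _ _ _)]
    congr 3
    refine Finset.sum_congr rfl fun i _ => Finset.sum_congr rfl fun j _ =>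
      Finset.sum_congr rfl fun k _ => ?_
    rw [hg', hc]
    have := (ht i).ne'
    have := (ht j).ne'
    have := (ht k).ne'
    field_simp
  have hφ0 : φ 0 = 0 := by
    have h1 := scalarCurvature_eq hQ W g e he
    have h2 := g.traceForm_eq e he T
    simp only [φ, zero_mul, add_zero, inv_one, mul_one]
    simp only [div_one, mul_one] at h1 h2
    rw [← h2, hT, mul_one, hS, h1]
    simp only [hc]
    ring
  have hloc : IsLocalMax φ 0 := by
    filter_upwards [hpos] with t ht
    obtain ⟨g', h1, h2⟩ := hφ t ht
    rw [hφ0, h2]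
    linarith [hmax g' t h1]
  have hx : ∀ i, HasDerivAt (fun t : ℝ => 1 + t * l i) (l i) 0 := fun i => by
    simpa using ((hasDerivAt_id (0 : ℝ)).mul_const (l i)).const_add 1
  have hxi : ∀ i, HasDerivAt (fun t : ℝ => (1 + t * l i)⁻¹) (-l i) 0 := fun i => by
    simpa using (hx i).fun_inv (by simp)
  have hd : HasDerivAt φ (∑ i, ricciBase Q W (e i) (e i) * (-l i)
      - (∑ i, ∑ j, ∑ k, c i j k * (l k - l i - l j)) / 4
      - S * ∑ i, T (e i) (e i) * (-l i)) 0 := by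
    refine HasDerivAt.sub (HasDerivAt.sub ?_ ?_) ?_
    · exact HasDerivAt.fun_sum fun i _ => (hxi i).const_mul _
    · refine HasDerivAt.div_const (HasDerivAt.fun_sum fun i _ => HasDerivAt.fun_sum fun j _ =>
        HasDerivAt.fun_sum fun k _ => ?_) _
      refine HasDerivAt.const_mul _ ?_
      refine (((hx k).mul (hxi i)).mul (hxi j)).congr_deriv ?_
      simp
      ring
    · exact (HasDerivAt.fun_sum fun i _ => (hxi i).const_mul _).const_mul _
  have h0 := hloc.hasDerivAt_eq_zero hd
  have hsum := sum_mul_ricci hQ W g e he l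
  have hli : ∀ i, l i = ricci Q W g (e i) (e i) - S * T (e i) (e i) := by
    intro i
    have := hl i i
    rw [if_pos rfl] at this
    rw [← this]
    simp [hη]
  -- The derivative of `φ` at `0` is minus this sum, the squared norm of `Ric - S T`; it vanishes at
  -- a local maximum.
  have hsq : ∑ i, l i * l i = 0 := by
    have h1 : ∑ i, l i * l i = ∑ i, l i * ricci Q W g (e i) (e i)
        - S * ∑ i, T (e i) (e i) * l i := by
      rw [Finset.mul_sum, ← Finset.sum_sub_distrib]
      refine Finset.sum_congr rfl fun i _ => ?_
      nth_rewrite 2 [hli i]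
      ring
    rw [h1, hsum]
    simp only [mul_neg, Finset.sum_neg_distrib] at h0
    linarith
  have hl0 : ∀ i, l i = 0 := fun i =>
    mul_self_eq_zero.1 ((Finset.sum_eq_zero_iff_of_nonneg (fun i _ => mul_self_nonneg (l i))).1 hsq
      i (Finset.mem_univ i))
  have hη0 : η = 0 := LinearMap.BilinForm.ext_basis e fun i j => by
    rw [hl]; simp [hl0]
  exact sub_eq_zero.1 hη0

end Variation

/-! ### Scalar curvature when some weights tend to zero -/

section NumericLimit

variable {ι : Type*} [Fintype ι]

/-- The scalar curvature as a function of the structure constants. -/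
noncomputable def structureScal (N : ι → ι → ℝ) (q : ι → ι → ι → ℝ) (y : ι → ℝ) : ℝ :=
  ∑ i, y i * (∑ j, N i j - (∑ j, ∑ k, q i j k) / 2)
    - (∑ i, ∑ j, ∑ k, q i j k * (y i * y j / y k)) / 4

theorem sum_subtype_eq_sum_indicator (p : ι → Prop) [DecidablePred p] (f : ι → ℝ) :
    ∑ i : {i // p i}, f i = ∑ i, (if p i then 1 else 0) * f i := by
  rw [← Finset.sum_subtype (Finset.univ.filter p) (by simp) f, Finset.sum_filter]
  simp only [ite_mul, one_mul, zero_mul]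

/-- Symmetrizing in `j, k` reduces this to `y j / y k + y k / y j ≥ 2`. -/
theorem le_sum_mul_div (c : ι → ι → ℝ) (y : ι → ℝ) (hy : ∀ i, 0 < y i) (hc : ∀ i j, 0 ≤ c i j)
    (hs : ∀ i j, c i j = c j i) : ∑ j, ∑ k, c j k ≤ ∑ j, ∑ k, c j k * (y j / y k) := by
  have h1 : ∑ j, ∑ k, c j k * (y j / y k) = ∑ j, ∑ k, c j k * (y k / y j) := by
    rw [Finset.sum_comm]
    exact Finset.sum_congr rfl fun j _ => Finset.sum_congr rfl fun k _ => by rw [hs]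
  have h2 : ∑ j, ∑ k, 2 * c j k ≤ ∑ j, ∑ k, (c j k * (y j / y k) + c j k * (y k / y j)) := by
    refine Finset.sum_le_sum fun j _ => Finset.sum_le_sum fun k _ => ?_
    rw [← mul_add, mul_comm]
    refine mul_le_mul_of_nonneg_left ?_ (hc j k)
    have := hy j
    have := hy k
    rw [div_add_div _ _ (hy k).ne' (hy j).ne', le_div_iff₀ (by positivity)]
    nlinarith [sq_nonneg (y j - y k)]
  simp only [Finset.sum_add_distrib, ← Finset.mul_sum] at h2
  rw [← h1] at h2
  linarith

/-- Of the non-negative terms on the right, those kept have all three indices selected, or exactly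
one selected index, in one of the first two places. The two placements contribute equally, and
`le_sum_mul_div` removes the uncontrolled ratio of unselected weights. -/
theorem sum_indicator_le (χ : ι → ℝ) (hχ : ∀ i, χ i = 0 ∨ χ i = 1) (q : ι → ι → ι → ℝ) (y : ι → ℝ)
    (hy : ∀ i, 0 < y i) (hq : ∀ i j k, 0 ≤ q i j k) (hq1 : ∀ i j k, q i j k = q j i k)
    (hq2 : ∀ i j k, q i j k = q i k j) :
    ∑ i, ∑ j, ∑ k, χ i * χ j * χ k * (q i j k * (y i * y j / y k))
      + 2 * ∑ i, ∑ j, ∑ k, χ i * (1 - χ j) * (1 - χ k) * (q i j k * y i) ≤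
    ∑ i, ∑ j, ∑ k, q i j k * (y i * y j / y k) := by
  have h1 : ∑ i, ∑ j, ∑ k, χ i * (1 - χ j) * (1 - χ k) * (q i j k * y i) ≤
      ∑ i, ∑ j, ∑ k, χ i * (1 - χ j) * (1 - χ k) * (q i j k * (y i * y j / y k)) := by
    refine Finset.sum_le_sum fun i _ => ?_
    have := le_sum_mul_div (fun j k => χ i * (1 - χ j) * (1 - χ k) * (q i j k * y i)) y hy
      (fun j k => by
        have := hq i j k
        have := hy i
        rcases hχ i with h | h <;> rcases hχ j with h' | h' <;> rcases hχ k with h'' | h'' <;>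
          simp only [h, h', h''] <;> norm_num <;> positivity)
      (fun j k => by rw [hq2]; ring)
    refine this.trans_eq ?_
    exact Finset.sum_congr rfl fun j _ => Finset.sum_congr rfl fun k _ => by ring
  have h2 : ∑ i, ∑ j, ∑ k, χ i * (1 - χ j) * (1 - χ k) * (q i j k * (y i * y j / y k)) =
      ∑ i, ∑ j, ∑ k, χ j * (1 - χ i) * (1 - χ k) * (q i j k * (y i * y j / y k)) := by
    rw [Finset.sum_comm]
    refine Finset.sum_congr rfl fun i _ => Finset.sum_congr rfl fun j _ =>
      Finset.sum_congr rfl fun k _ => by rw [hq1]; ring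
  have h3 : ∑ i, ∑ j, ∑ k, (χ i * χ j * χ k * (q i j k * (y i * y j / y k))
      + χ i * (1 - χ j) * (1 - χ k) * (q i j k * (y i * y j / y k))
      + χ j * (1 - χ i) * (1 - χ k) * (q i j k * (y i * y j / y k))) ≤
      ∑ i, ∑ j, ∑ k, q i j k * (y i * y j / y k) := by
    refine Finset.sum_le_sum fun i _ => Finset.sum_le_sum fun j _ => Finset.sum_le_sum fun k _ => ?_
    have h0 : 0 ≤ q i j k * (y i * y j / y k) := by
      have := hq i j k
      have := hy i
      have := hy j
      have := hy k
      positivity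
    rcases hχ i with h | h <;> rcases hχ j with h' | h' <;> rcases hχ k with h'' | h'' <;>
      simp only [h, h', h''] <;> norm_num <;> exact h0
  simp only [Finset.sum_add_distrib] at h3
  rw [← h2] at h3
  linarith

/-- The first part is the subalgebra condition forced by bounded curvature. The second is upper
semicontinuity: the negative terms that could blow up are replaced by a bound with a limit, and the
condition on `N'` makes that limit exactly the expression on the surviving indices. -/
theorem structureScal_limit {N : ℕ → ι → ι → ℝ} {q : ℕ → ι → ι → ι → ℝ} {y : ℕ → ι → ℝ}
    {N' : ι → ι → ℝ} {q' : ι → ι → ι → ℝ} {y' : ι → ℝ} {s : ℝ}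
    (hN : ∀ i j, Tendsto (fun m => N m i j) atTop (𝓝 (N' i j)))
    (hq : ∀ i j k, Tendsto (fun m => q m i j k) atTop (𝓝 (q' i j k)))
    (hy : ∀ i, Tendsto (fun m => y m i) atTop (𝓝 (y' i)))
    (hypos : ∀ m i, 0 < y m i) (hqpos : ∀ m i j k, 0 ≤ q m i j k)
    (hq1 : ∀ m i j k, q m i j k = q m j i k) (hq2 : ∀ m i j k, q m i j k = q m i k j)
    (hs : Tendsto (fun m => structureScal (N m) (q m) (y m)) atTop (𝓝 s)) :
    (∀ i j k, 0 < y' i → 0 < y' j → y' k = 0 → q' i j k = 0) ∧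
    ((∀ i j, 0 < y' i → y' j = 0 → N' i j = ∑ k, q' i j k) →
      s ≤ structureScal (ι := {i // 0 < y' i}) (fun i j => N' i j) (fun i j k => q' i j k)
        (fun i => y' i)) := by
  have hy0 : ∀ i, 0 ≤ y' i := fun i => ge_of_tendsto' (hy i) fun m => (hypos m i).le
  have hq0 : ∀ i j k, 0 ≤ q' i j k := fun i j k => ge_of_tendsto' (hq i j k) fun m => hqpos m i j k
  have hA : Tendsto (fun m => ∑ i, y m i * ∑ j, N m i j) atTop (𝓝 (∑ i, y' i * ∑ j, N' i j)) :=
    tendsto_finsetSum _ fun i _ => (hy i).mul (tendsto_finsetSum _ fun j _ => hN i j)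
  have hterm : ∀ m i j k, 0 ≤ q m i j k * (y m i * y m j / y m k) := fun m i j k => by
    have := hqpos m i j k
    have := hypos m i
    have := hypos m j
    have := hypos m k
    positivity
  have part1 : ∀ i j k, 0 < y' i → 0 < y' j → y' k = 0 → q' i j k = 0 := by
    intro i j k hi hj hk
    -- One term of the negative cubic sum is at most the whole sum, which the formula bounds by the
    -- positive part minus the scalar curvature. After multiplication by `y m k → 0` the right side
    -- tends to zero.
    have hbound : ∀ m, q m i j k * (y m i * y m j) ≤
        4 * (∑ i, y m i * ∑ j, N m i j - structureScal (N m) (q m) (y m)) * y m k := by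
      intro m
      rw [← div_le_iff₀ (hypos m k), mul_div_assoc]
      have h1 : q m i j k * (y m i * y m j / y m k) ≤
          ∑ i, ∑ j, ∑ k, q m i j k * (y m i * y m j / y m k) := by
        have a1 := Finset.single_le_sum (f := fun k => q m i j k * (y m i * y m j / y m k))
          (fun k _ => hterm m i j k) (Finset.mem_univ k)
        have a2 := Finset.single_le_sum (f := fun j => ∑ k, q m i j k * (y m i * y m j / y m k))
          (fun j _ => Finset.sum_nonneg fun k _ => hterm m i j k) (Finset.mem_univ j)
        have a3 := Finset.single_le_sum
          (f := fun i => ∑ j, ∑ k, q m i j k * (y m i * y m j / y m k))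
          (fun i _ => Finset.sum_nonneg fun j _ => Finset.sum_nonneg fun k _ => hterm m i j k)
          (Finset.mem_univ i)
        exact a1.trans (a2.trans a3)
      have h2 : 0 ≤ ∑ i, y m i * ((∑ j, ∑ k, q m i j k) / 2) :=
        Finset.sum_nonneg fun i _ => mul_nonneg (hypos m i).le (div_nonneg
          (Finset.sum_nonneg fun j _ => Finset.sum_nonneg fun k _ => hqpos m i j k) (by norm_num))
      simp only [structureScal, mul_sub, Finset.sum_sub_distrib]
      linarith
    have hlim := le_of_tendsto_of_tendsto' ((hq i j k).mul ((hy i).mul (hy j)))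
      (((hA.sub hs).const_mul 4).mul (hy k)) hbound
    rw [hk, mul_zero] at hlim
    have h3 := mul_pos hi hj
    have h4 := hq0 i j k
    nlinarith
  refine ⟨part1, fun hH => ?_⟩
  classical
  let χ : ι → ℝ := fun i => if 0 < y' i then 1 else 0
  have hχ : ∀ i, χ i = 0 ∨ χ i = 1 := fun i => by
    simp only [χ]; split_ifs <;> simp
  -- the upper bound and its limit
  let U : (ι → ι → ℝ) → (ι → ι → ι → ℝ) → (ι → ℝ) → ℝ := fun N q y =>
    ∑ i, y i * (∑ j, N i j - (∑ j, ∑ k, q i j k) / 2)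
      - (∑ i, ∑ j, ∑ k, χ i * χ j * χ k * (q i j k * (y i * y j / y k))
      + 2 * ∑ i, ∑ j, ∑ k, χ i * (1 - χ j) * (1 - χ k) * (q i j k * y i)) / 4
  have hU : ∀ m, structureScal (N m) (q m) (y m) ≤ U (N m) (q m) (y m) := by
    intro m
    have := sum_indicator_le χ hχ (q m) (y m) (hypos m) (hqpos m) (hq1 m) (hq2 m)
    simp only [structureScal, U]
    linarith
  have hUlim : Tendsto (fun m => U (N m) (q m) (y m)) atTop (𝓝 (U N' q' y')) := by
    refine Tendsto.sub ?_ (Tendsto.div_const (Tendsto.add ?_ (Tendsto.const_mul _ ?_)) _)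
    · exact tendsto_finsetSum _ fun i _ => (hy i).mul ((tendsto_finsetSum _ fun j _ => hN i j).sub
        ((tendsto_finsetSum _ fun j _ => tendsto_finsetSum _ fun k _ => hq i j k).div_const _))
    · refine tendsto_finsetSum _ fun i _ => tendsto_finsetSum _ fun j _ =>
        tendsto_finsetSum _ fun k _ => ?_
      by_cases hk : 0 < y' k
      · exact ((hq i j k).mul (((hy i).mul (hy j)).div (hy k) hk.ne')).const_mul _
      · have : χ k = 0 := if_neg hk
        simp [this]
    · exact tendsto_finsetSum _ fun i _ => tendsto_finsetSum _ fun j _ =>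
        tendsto_finsetSum _ fun k _ => ((hq i j k).mul (hy i)).const_mul _
  refine (le_of_tendsto_of_tendsto' hs hUlim hU).trans_eq ?_
  simp only [U, structureScal]
  have e1 : ∀ f : ι → ℝ, ∑ i : {i // 0 < y' i}, f i = ∑ i, χ i * f i := fun f =>
    sum_subtype_eq_sum_indicator _ f
  rw [e1 (fun i => y' i * (∑ j : {i // 0 < y' i}, N' i j
    - (∑ j : {i // 0 < y' i}, ∑ k : {i // 0 < y' i}, q' i j k) / 2)),
    e1 (fun i => ∑ j : {i // 0 < y' i}, ∑ k : {i // 0 < y' i}, q' i j k * (y' i * y' j / y' k))]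
  have e2 : ∀ f : ι → ι → ℝ, ∑ j : {i // 0 < y' i}, ∑ k : {i // 0 < y' i}, f j k =
      ∑ j, ∑ k, χ j * χ k * f j k := fun f => by
    rw [e1 (fun j => ∑ k : {i // 0 < y' i}, f j k)]
    refine Finset.sum_congr rfl fun j _ => ?_
    rw [e1, Finset.mul_sum]
    exact Finset.sum_congr rfl fun k _ => by ring
  have e3 : ∀ i, ∑ j : {i // 0 < y' i}, ∑ k : {i // 0 < y' i}, q' i j k * (y' i * y' j / y' k) =
      ∑ j, ∑ k, χ j * χ k * (q' i j k * (y' i * y' j / y' k)) := fun i =>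
    e2 (fun j k => q' i j k * (y' i * y' j / y' k))
  have e4 : ∀ i, ∑ j : {i // 0 < y' i}, ∑ k : {i // 0 < y' i}, q' i j k =
      ∑ j, ∑ k, χ j * χ k * q' i j k := fun i => e2 (fun j k => q' i j k)
  have e5 : ∀ i, ∑ j : {i // 0 < y' i}, N' i j = ∑ j, χ j * N' i j := fun i => e1 (fun j => N' i j)
  simp only [e3, e4, e5]
  have e6 : ∑ i, χ i * ∑ j, ∑ k, χ j * χ k * (q' i j k * (y' i * y' j / y' k)) =
      ∑ i, ∑ j, ∑ k, χ i * χ j * χ k * (q' i j k * (y' i * y' j / y' k)) := by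
    simp only [Finset.mul_sum, mul_assoc]
  rw [e6]
  -- For surviving `i`, a lost `j` contributes its full `N' i j`, which is cancelled by two halves:
  -- one from the Killing-type term and one from the mixed terms retained in `U`.
  have e7 : ∀ i, y' i * (∑ j, N' i j - (∑ j, ∑ k, q' i j k) / 2) -
      (∑ j, ∑ k, χ i * (1 - χ j) * (1 - χ k) * (q' i j k * y' i)) / 2 =
      χ i * (y' i * (∑ j, χ j * N' i j - (∑ j, ∑ k, χ j * χ k * q' i j k) / 2)) := by
    intro i
    by_cases hi : 0 < y' i
    · have hχi : χ i = 1 := if_pos hi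
      have hzero : ∀ j, χ j = 0 → y' j = 0 := fun j hj => by
        by_contra hne
        have : χ j = 1 := if_pos (lt_of_le_of_ne (hy0 j) (Ne.symm hne))
        rw [this] at hj
        exact one_ne_zero hj
      have hone : ∀ j, χ j = 1 → 0 < y' j := fun j hj => by
        by_contra hne
        have : χ j = 0 := if_neg hne
        rw [this] at hj
        exact zero_ne_one hj
      have a1 : ∀ j k, q' i j k = χ j * χ k * q' i j k + (1 - χ j) * (1 - χ k) * q' i j k := by
        intro j k
        rcases hχ j with h | h <;> rcases hχ k with h' | h'
        · simp [h, h']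
        · have : q' i j k = 0 := by
            have h2 : q' i j k = q' i k j :=
              tendsto_nhds_unique (hq i j k) ((hq i k j).congr fun m => (hq2 m i j k).symm)
            rw [h2]
            exact part1 i k j hi (hone k h') (hzero j h)
          simp [this]
        · simp [part1 i j k hi (hone j h) (hzero k h')]
        · simp [h, h']
      have a2 : ∀ j, N' i j = χ j * N' i j + ∑ k, (1 - χ j) * (1 - χ k) * q' i j k := by
        intro j
        rcases hχ j with h | h
        · rw [hH i j hi (hzero j h), h, zero_mul, zero_add]
          refine Finset.sum_congr rfl fun k _ => ?_
          refine (a1 j k).trans ?_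
          rw [h]
          ring
        · simp [h]
      have a3 : ∑ j, N' i j = ∑ j, χ j * N' i j + ∑ j, ∑ k, (1 - χ j) * (1 - χ k) * q' i j k := by
        rw [← Finset.sum_add_distrib]
        exact Finset.sum_congr rfl fun j _ => a2 j
      have a4 : ∑ j, ∑ k, q' i j k = ∑ j, ∑ k, χ j * χ k * q' i j k +
          ∑ j, ∑ k, (1 - χ j) * (1 - χ k) * q' i j k := by
        simp only [← Finset.sum_add_distrib]
        exact Finset.sum_congr rfl fun j _ => Finset.sum_congr rfl fun k _ => a1 j k
      have a5 : ∑ j, ∑ k, χ i * (1 - χ j) * (1 - χ k) * (q' i j k * y' i) =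
          y' i * ∑ j, ∑ k, (1 - χ j) * (1 - χ k) * q' i j k := by
        simp only [Finset.mul_sum]
        exact Finset.sum_congr rfl fun j _ => Finset.sum_congr rfl fun k _ => by rw [hχi]; ring
      rw [a5, a3, a4, hχi]
      ring
    · have h1 : y' i = 0 := le_antisymm (not_lt.1 hi) (hy0 i)
      simp [h1]
  have e8 := Finset.sum_congr (s₁ := Finset.univ) rfl fun i (_ : i ∈ Finset.univ) => e7 i
  rw [Finset.sum_sub_distrib, ← Finset.sum_div] at e8
  rw [← e8]
  ring

end NumericLimit

/-! ### Invariant metrics as weighted orthonormal frames -/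

section Frames

variable {𝔤 : Type*} [LieRing 𝔤] [LieAlgebra ℝ 𝔤] [FiniteDimensional ℝ 𝔤]
variable {ι : Type*} [Fintype ι] [DecidableEq ι] {Γ : Type*}

/-- The Lie bracket as a bilinear map. -/
def lieBilin : 𝔤 →ₗ[ℝ] 𝔤 →ₗ[ℝ] 𝔤 :=
  LinearMap.mk₂ ℝ (fun x y => ⁅x, y⁆) add_lie smul_lie lie_add (fun c x y => lie_smul c x y)

/-- The operator `v ↦ ∑ i, y i * Q(v, b i) b i`.  If `b` is a `Q`-orthonormal family, it is the
composition of the orthogonal projection to the span of `b` with the inverse of the metric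
`diag ((y i)⁻¹)`. -/
noncomputable def frameOp (Q : InnerForm 𝔤) (b : ι → 𝔤) (y : ι → ℝ) (v : 𝔤) : 𝔤 :=
  ∑ i, (y i * Q.form v (b i)) • b i

/-- `g` is an inner product on `W ⊆ 𝔥^⊥` invariant under the operators `ρ a`, with `tr_g T = 1`, and
`𝔥 + W` is closed under brackets of elements of `W`. -/
structure IsAdmissible (Q : InnerForm 𝔤) (𝔥 : LieSubalgebra ℝ 𝔤) (ρ : Γ → 𝔤 →ₗ[ℝ] 𝔤)
    (T : LinearMap.BilinForm ℝ 𝔤) (W : Submodule ℝ 𝔤) (g : InnerForm W) : Prop where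
  perp : ∀ w ∈ W, ∀ A ∈ 𝔥, Q.form w A = 0
  lie_mem : ∀ x ∈ W, ∀ y ∈ W, ⁅x, y⁆ ∈ 𝔥.toSubmodule ⊔ W
  map_mem : ∀ a, ∀ x ∈ W, ρ a x ∈ W
  inv : ∀ a (x y : W), g.form ⟨ρ a x, map_mem a x x.2⟩ ⟨ρ a y, map_mem a y y.2⟩ = g.form x y
  trace : g.traceForm (T.restrict W) = 1

/-- A `Q`-orthonormal frame that diagonalizes an admissible metric, with eigenvalues `(y i)⁻¹`. -/
structure IsAdmissibleFrame (Q : InnerForm 𝔤) (𝔥 : LieSubalgebra ℝ 𝔤) (ρ : Γ → 𝔤 →ₗ[ℝ] 𝔤)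
    (T : LinearMap.BilinForm ℝ 𝔤) (b : ι → 𝔤) (y : ι → ℝ) : Prop where
  orthonormal : ∀ i j, Q.form (b i) (b j) = if i = j then 1 else 0
  pos : ∀ i, 0 < y i
  perp : ∀ i, ∀ A ∈ 𝔥, Q.form (b i) A = 0
  lie_sub_mem : ∀ i j, ⁅b i, b j⁆ - ∑ k, Q.form ⁅b i, b j⁆ (b k) • b k ∈ 𝔥
  comm : ∀ a v, ρ a (frameOp Q b y v) = frameOp Q b y (ρ a v)
  trace : ∑ i, y i * T (b i) (b i) = 1

theorem InnerForm.injective_of_isometry {V : Type*} [AddCommGroup V] [Module ℝ V]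
    (Q : InnerForm V) {φ : V →ₗ[ℝ] V} (hφ : ∀ x y, Q.form (φ x) (φ y) = Q.form x y) :
    Function.Injective φ := by
  rw [← LinearMap.ker_eq_bot, LinearMap.ker_eq_bot']
  intro x hx
  by_contra hne
  have h1 := Q.pos x hne
  rw [← hφ, hx] at h1
  simp at h1

theorem linearIndependent_of_orthonormal (Q : InnerForm 𝔤) {b : ι → 𝔤}
    (hb : ∀ i j, Q.form (b i) (b j) = if i = j then 1 else 0) : LinearIndependent ℝ b := by
  rw [Fintype.linearIndependent_iff]
  intro c hc i
  have := congrArg (fun v => Q.form v (b i)) hc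
  simpa [hb] using this

theorem sum_form_smul_eq (Q : InnerForm 𝔤) {b : ι → 𝔤}
    (hb : ∀ i j, Q.form (b i) (b j) = if i = j then 1 else 0) {v : 𝔤}
    (hv : v ∈ Submodule.span ℝ (Set.range b)) : ∑ i, Q.form v (b i) • b i = v := by
  obtain ⟨c, rfl⟩ := (Submodule.mem_span_range_iff_exists_fun ℝ).1 hv
  refine Finset.sum_congr rfl fun i _ => ?_
  simp [hb]

theorem frameOp_mem (Q : InnerForm 𝔤) (b : ι → 𝔤) (y : ι → ℝ) (v : 𝔤) :
    frameOp Q b y v ∈ Submodule.span ℝ (Set.range b) :=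
  Submodule.sum_mem _ fun i _ => Submodule.smul_mem _ _ (Submodule.subset_span ⟨i, rfl⟩)

theorem form_frameOp (Q : InnerForm 𝔤) {b : ι → 𝔤}
    (hb : ∀ i j, Q.form (b i) (b j) = if i = j then 1 else 0) (y : ι → ℝ) (v : 𝔤) (j : ι) :
    Q.form (frameOp Q b y v) (b j) = y j * Q.form v (b j) := by
  simp [frameOp, hb]

/-- The same frame with inverse weights supplies the preimage, so the range of `frameOp` is the full
span. Any operator commuting with `frameOp` therefore preserves that span. -/
theorem exists_frameOp_eq (Q : InnerForm 𝔤) {b : ι → 𝔤}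
    (hb : ∀ i j, Q.form (b i) (b j) = if i = j then 1 else 0) {y : ι → ℝ} (hy : ∀ i, 0 < y i) {v : 𝔤}
    (hv : v ∈ Submodule.span ℝ (Set.range b)) : ∃ u, frameOp Q b y u = v := by
  refine ⟨frameOp Q b (fun i => (y i)⁻¹) v, ?_⟩
  rw [frameOp]
  conv_rhs => rw [← sum_form_smul_eq Q hb hv]
  refine Finset.sum_congr rfl fun i _ => ?_
  rw [form_frameOp Q hb, mul_inv_cancel_left₀ (hy i).ne']

theorem form_eq_sum_of_diag (Q : InnerForm 𝔤) {W : Submodule ℝ 𝔤} (g : InnerForm W)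
    (e : Module.Basis ι ℝ W) (he : ∀ i j, Q.form (e i : 𝔤) (e j) = if i = j then 1 else 0)
    {y : ι → ℝ} (hg : ∀ i j, g.form (e i) (e j) = if i = j then (y i)⁻¹ else 0) (v w : W) :
    g.form v w = ∑ i, (y i)⁻¹ * (Q.form (v : 𝔤) (e i) * Q.form (w : 𝔤) (e i)) := by
  have he' : ∀ i j, (Q.restrict W).form (e i) (e j) = if i = j then 1 else 0 := he
  have hr : ∀ (v : W) i, e.repr v i = Q.form (v : 𝔤) (e i) := fun v i => by
    rw [(Q.restrict W).repr_eq e he', div_one]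
    rfl
  conv_lhs => rw [← e.sum_repr v, ← e.sum_repr w]
  simp only [map_sum, map_smul, LinearMap.sum_apply, LinearMap.smul_apply, hg, smul_eq_mul, hr]
  refine Finset.sum_congr rfl fun i _ => ?_
  rw [Finset.sum_eq_single i (by intro j _ h; simp [h]) (by simp), if_pos rfl]
  ring

/-- A basis-free description: `frameOp` sends `v` to the `g`-representative of `Q(v, ·)` on `W`.
This makes invariance of `g` equivalent to commutation with `frameOp`. -/
theorem form_frameOp_eq (Q : InnerForm 𝔤) {W : Submodule ℝ 𝔤} (g : InnerForm W)
    (e : Module.Basis ι ℝ W) (he : ∀ i j, Q.form (e i : 𝔤) (e j) = if i = j then 1 else 0)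
    {y : ι → ℝ} (hy : ∀ i, 0 < y i)
    (hg : ∀ i j, g.form (e i) (e j) = if i = j then (y i)⁻¹ else 0) (v : 𝔤) (w : W)
    (hv : frameOp Q (fun i => (e i : 𝔤)) y v ∈ W) :
    g.form ⟨frameOp Q (fun i => (e i : 𝔤)) y v, hv⟩ w = Q.form v w := by
  have he' : ∀ i j, (Q.restrict W).form (e i) (e j) = if i = j then 1 else 0 := he
  rw [form_eq_sum_of_diag Q g e he hg]
  have hw : (w : 𝔤) = ∑ i, Q.form (w : 𝔤) (e i) • (e i : 𝔤) := by
    have h1 := congrArg (fun u : W => (u : 𝔤)) (e.sum_repr w)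
    simp only [(Q.restrict W).repr_eq e he', div_one, Submodule.coe_sum, Submodule.coe_smul] at h1
    exact h1.symm
  conv_rhs => rw [hw]
  rw [map_sum]
  refine Finset.sum_congr rfl fun i _ => ?_
  have := form_frameOp Q (b := fun i => (e i : 𝔤)) he y v i
  simp only [map_smul, smul_eq_mul]
  rw [this]
  have := (hy i).ne'
  field_simp

theorem span_range_coe_basis {W : Submodule ℝ 𝔤} (e : Module.Basis ι ℝ W) :
    Submodule.span ℝ (Set.range fun i => (e i : 𝔤)) = W := by
  have : (Set.range fun i => (e i : 𝔤)) = W.subtype '' Set.range e := by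
    rw [← Set.range_comp]; rfl
  rw [this, ← Submodule.map_span, e.span_eq, Submodule.map_top, Submodule.range_subtype]

variable {Q : InnerForm 𝔤} {𝔥 : LieSubalgebra ℝ 𝔤} {ρ : Γ → 𝔤 →ₗ[ℝ] 𝔤}
  {T : LinearMap.BilinForm ℝ 𝔤}

theorem IsAdmissible.exists_frame (hQ : Q.IsAdInvariant)
    (hρ : ∀ a x y, Q.form (ρ a x) (ρ a y) = Q.form x y)
    {W : Submodule ℝ 𝔤} {g : InnerForm W} (h : IsAdmissible Q 𝔥 ρ T W g) :
    ∃ (b : Fin (Module.finrank ℝ W) → 𝔤) (y : Fin (Module.finrank ℝ W) → ℝ),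
      IsAdmissibleFrame Q 𝔥 ρ T b y ∧ Submodule.span ℝ (Set.range b) = W ∧
      scalarCurvature Q W g = scal Q b y := by
  obtain ⟨e, l, he, hl⟩ := (Q.restrict W).exists_basis g.form g.symm
  have he0 : ∀ i j, Q.form (e i : 𝔤) (e j) = if i = j then 1 else 0 := he
  have hlpos : ∀ i, 0 < l i := fun i => by
    have := g.pos _ (e.ne_zero i)
    rwa [hl, if_pos rfl] at this
  have hg : ∀ i j, g.form (e i) (e j) = if i = j then ((l i)⁻¹)⁻¹ else 0 := by simpa using hl
  have hspan := span_range_coe_basis e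
  have hmem : ∀ y v, frameOp Q (fun i => (e i : 𝔤)) y v ∈ W := fun y v =>
    hspan.le (frameOp_mem Q (fun i => (e i : 𝔤)) y v)
  refine ⟨fun i => (e i : 𝔤), fun i => (l i)⁻¹, ⟨he0, fun i => inv_pos.2 (hlpos i),
    fun i A hA => h.perp _ (e i).2 A hA, fun i j => ?_, fun a v => ?_, ?_⟩, hspan,
    scalarCurvature_eq_scal hQ W g e he0 hg⟩
  · obtain ⟨A, hA, w, hw, hAw⟩ := Submodule.mem_sup.1 (h.lie_mem _ (e i).2 _ (e j).2)
    have h1 := sum_form_smul_eq Q he0 (hspan.symm ▸ hw)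
    have h2 : ∀ k, Q.form ⁅(e i : 𝔤), (e j : 𝔤)⁆ (e k) = Q.form w (e k) := fun k => by
      rw [← hAw, map_add, LinearMap.add_apply, Q.symm A, h.perp _ (e k).2 A hA, zero_add]
    simp only [h2]
    rw [h1, ← hAw, add_sub_cancel_right]
    exact hA
  · have hinj : Function.Injective (ρ a) := Q.injective_of_isometry (hρ a)
    -- An isometry mapping the finite-dimensional `W` into itself maps it onto itself, so vectors of
    -- the form `ρ a w'` suffice as test vectors.
    have hsurj : ∀ w : W, ∃ w' : W, (⟨ρ a w', h.map_mem a w' w'.2⟩ : W) = w := by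
      have : Function.Injective ((ρ a).restrict (h.map_mem a)) := fun x x' hx =>
        Subtype.ext (hinj (congrArg Subtype.val hx))
      exact LinearMap.injective_iff_surjective.1 this
    have key : (⟨ρ a (frameOp Q (fun i => (e i : 𝔤)) (fun i => (l i)⁻¹) v), h.map_mem a _ (hmem _ _)⟩
        : W) = ⟨frameOp Q (fun i => (e i : 𝔤)) (fun i => (l i)⁻¹) (ρ a v), hmem _ _⟩ := by
      refine g.eq_of_form_eq fun w => ?_
      obtain ⟨w', rfl⟩ := hsurj w
      rw [h.inv a ⟨_, hmem _ _⟩ w', form_frameOp_eq Q g e he0 (fun i => inv_pos.2 (hlpos i)) hg,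
        form_frameOp_eq Q g e he0 (fun i => inv_pos.2 (hlpos i)) hg, hρ]
    exact congrArg Subtype.val key
  · have := h.trace
    rw [g.traceForm_eq e hg] at this
    rw [← this]
    refine Finset.sum_congr rfl fun i _ => ?_
    rw [div_inv_eq_mul, mul_comm]
    rfl

/-- The converse passage to `IsAdmissible.exists_frame`. Frames can be fed into limits and direct
sums, and this lemma turns the outcome back into a metric. -/
theorem IsAdmissibleFrame.exists_metric (hQ : Q.IsAdInvariant)
    (hρ : ∀ a x y, Q.form (ρ a x) (ρ a y) = Q.form x y)
    {b : ι → 𝔤} {y : ι → ℝ} (h : IsAdmissibleFrame Q 𝔥 ρ T b y) {W : Submodule ℝ 𝔤}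
    (hW : Submodule.span ℝ (Set.range b) = W) :
    ∃ g : InnerForm W, IsAdmissible Q 𝔥 ρ T W g ∧ scalarCurvature Q W g = scal Q b y := by
  subst hW
  set W := Submodule.span ℝ (Set.range b)
  let e : Module.Basis ι ℝ W := Module.Basis.span (linearIndependent_of_orthonormal Q h.orthonormal)
  have heb : ∀ i, (e i : 𝔤) = b i := fun i =>
    congrArg Subtype.val (Module.Basis.span_apply (linearIndependent_of_orthonormal Q h.orthonormal) i)
  have hbe : (fun i => (e i : 𝔤)) = b := funext heb
  have he : ∀ i j, Q.form (e i : 𝔤) (e j) = if i = j then 1 else 0 := by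
    simpa only [heb] using h.orthonormal
  let B : LinearMap.BilinForm ℝ W :=
    LinearMap.mk₂ ℝ (fun v w => ∑ i, (y i)⁻¹ * (Q.form (v : 𝔤) (b i) * Q.form (w : 𝔤) (b i)))
      (fun v v' w => by
        rw [← Finset.sum_add_distrib]
        exact Finset.sum_congr rfl fun i _ => by
          simp only [Submodule.coe_add, map_add, LinearMap.add_apply]; ring)
      (fun c v w => by
        rw [smul_eq_mul, Finset.mul_sum]
        exact Finset.sum_congr rfl fun i _ => by
          simp only [Submodule.coe_smul, map_smul, LinearMap.smul_apply, smul_eq_mul]; ring)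
      (fun v w w' => by
        rw [← Finset.sum_add_distrib]
        exact Finset.sum_congr rfl fun i _ => by
          simp only [Submodule.coe_add, map_add, LinearMap.add_apply]; ring)
      (fun c v w => by
        rw [smul_eq_mul, Finset.mul_sum]
        exact Finset.sum_congr rfl fun i _ => by
          simp only [Submodule.coe_smul, map_smul, LinearMap.smul_apply, smul_eq_mul]; ring)
  have hB : ∀ v w : W, B v w =
      ∑ i, (y i)⁻¹ * (Q.form (v : 𝔤) (b i) * Q.form (w : 𝔤) (b i)) := fun _ _ => rfl
  let g : InnerForm W :=
    { form := B
      symm := fun v w => by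
        rw [hB, hB]
        exact Finset.sum_congr rfl fun i _ => by ring
      pos := fun v hv => by
        rw [hB]
        have h2 : ∃ i, Q.form (v : 𝔤) (b i) ≠ 0 := by
          by_contra hc
          push Not at hc
          apply hv
          apply Subtype.ext
          rw [← sum_form_smul_eq Q h.orthonormal v.2]
          simp [hc]
        obtain ⟨i, hi⟩ := h2
        exact Finset.sum_pos' (fun j _ => mul_nonneg (inv_pos.2 (h.pos j)).le (mul_self_nonneg _))
          ⟨i, Finset.mem_univ i, mul_pos (inv_pos.2 (h.pos i)) (mul_self_pos.2 hi)⟩ }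
  have hg : ∀ i j, g.form (e i) (e j) = if i = j then (y i)⁻¹ else 0 := by
    intro i j
    change B _ _ = _
    rw [hB]
    simp only [heb, h.orthonormal]
    rw [Finset.sum_eq_single i (by intro k _ hk; simp [hk.symm]) (by simp)]
    by_cases hij : i = j
    · simp [hij]
    · simp [hij, Ne.symm hij]
  have hmap : ∀ a, ∀ x ∈ W, ρ a x ∈ W := by
    intro a x hx
    obtain ⟨u, rfl⟩ := exists_frameOp_eq Q h.orthonormal h.pos hx
    rw [h.comm]
    exact frameOp_mem Q b y _
  refine ⟨g, ⟨?_, ?_, hmap, ?_, ?_⟩, ?_⟩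
  · intro w hw A hA
    rw [← sum_form_smul_eq Q h.orthonormal hw]
    simp [h.perp _ A hA]
  · intro x hx z hz
    refine LinearMap.BilinMap.apply_apply_mem_of_mem_span _ _ _ lieBilin
      ?_ x z hx hz
    rintro _ ⟨i, rfl⟩ _ ⟨j, rfl⟩
    refine Submodule.mem_sup.2 ⟨_, h.lie_sub_mem i j, _, ?_, sub_add_cancel _ _⟩
    exact Submodule.sum_mem _ fun k _ => Submodule.smul_mem _ _ (Submodule.subset_span ⟨k, rfl⟩)
  · intro a x z
    obtain ⟨u, hu⟩ := exists_frameOp_eq Q h.orthonormal h.pos x.2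
    obtain rfl : x = ⟨frameOp Q b y u, frameOp_mem Q b y u⟩ := Subtype.ext hu.symm
    have key := form_frameOp_eq Q g e he h.pos hg
    rw [hbe] at key
    rw [key]
    have h1 : (⟨ρ a (frameOp Q b y u), hmap a _ (frameOp_mem Q b y u)⟩ : W) =
        ⟨frameOp Q b y (ρ a u), frameOp_mem Q b y _⟩ := Subtype.ext (h.comm a u)
    rw [h1, key, hρ]
  · rw [g.traceForm_eq e hg, ← h.trace]
    refine Finset.sum_congr rfl fun i _ => ?_
    rw [div_inv_eq_mul, mul_comm]
    change y i * T (e i) (e i) = _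
    rw [heb]
  · rw [scalarCurvature_eq_scal hQ W g e he hg, hbe]

end Frames

/-! ### Compactness of frames and limits of metrics -/

section Compactness

variable {𝔤 : Type*} [LieRing 𝔤] [LieAlgebra ℝ 𝔤] [FiniteDimensional ℝ 𝔤]
  [TopologicalSpace 𝔤] [IsTopologicalAddGroup 𝔤] [ContinuousSMul ℝ 𝔤] [T2Space 𝔤]

theorem continuous_bilinear {E : Type*} [AddCommGroup E] [Module ℝ E] [TopologicalSpace E]
    [IsTopologicalAddGroup E] [ContinuousSMul ℝ E] (B : 𝔤 →ₗ[ℝ] 𝔤 →ₗ[ℝ] E) :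
    Continuous fun p : 𝔤 × 𝔤 => B p.1 p.2 := by
  let f := Module.finBasis ℝ 𝔤
  have h : ∀ p : 𝔤 × 𝔤, B p.1 p.2 = ∑ i, f.coord i p.2 • B.flip (f i) p.1 := by
    intro p
    conv_lhs => rw [← f.sum_repr p.2]
    simp only [map_sum, map_smul, Module.Basis.coord_apply, LinearMap.flip_apply]
  simp only [h]
  refine continuous_finsetSum _ fun i _ => Continuous.smul ?_ ?_
  · exact (f.coord i).continuous_of_finiteDimensional.comp continuous_snd
  · exact (B.flip (f i)).continuous_of_finiteDimensional.comp continuous_fst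

theorem Filter.Tendsto.bilinear {E : Type*} [AddCommGroup E] [Module ℝ E] [TopologicalSpace E]
    [IsTopologicalAddGroup E] [ContinuousSMul ℝ E] (B : 𝔤 →ₗ[ℝ] 𝔤 →ₗ[ℝ] E) {α : Type*}
    {l : Filter α} {u v : α → 𝔤} {x y : 𝔤} (hu : Tendsto u l (𝓝 x)) (hv : Tendsto v l (𝓝 y)) :
    Tendsto (fun m => B (u m) (v m)) l (𝓝 (B x y)) :=
  ((continuous_bilinear B).tendsto (x, y)).comp (hu.prodMk_nhds hv)

theorem isCompact_setOf_form_le_one (Q : InnerForm 𝔤) : IsCompact {v : 𝔤 | Q.form v v ≤ 1} := by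
  obtain ⟨f, -, hf, -⟩ := Q.exists_basis 0 (by simp)
  let φ : 𝔤 ≃L[ℝ] (Fin (Module.finrank ℝ 𝔤) → ℝ) := f.equivFun.toContinuousLinearEquiv
  have hK : IsCompact (φ.symm '' Set.Icc (fun _ => -1) (fun _ => 1)) :=
    isCompact_Icc.image φ.symm.continuous
  refine hK.of_isClosed_subset ?_ ?_
  · exact isClosed_le ((continuous_bilinear Q.form).comp (continuous_id.prodMk continuous_id))
      continuous_const
  · intro v hv
    refine ⟨φ v, ?_, φ.symm_apply_apply v⟩
    have h1 : ∀ i, φ v i = Q.form v (f i) := fun i => by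
      have : φ v i = f.repr v i := rfl
      rw [this, Q.repr_eq f hf, div_one]
    have h2 : ∀ i, |φ v i| ≤ 1 := by
      intro i
      rw [h1, ← sq_le_one_iff_abs_le_one]
      rw [Set.mem_ofPred_eq, Q.form_eq_sum f hf] at hv
      simp only [← pow_two] at hv
      exact (Finset.single_le_sum (f := fun i => Q.form v (f i) ^ 2) (fun i _ => sq_nonneg _)
        (Finset.mem_univ i)).trans hv
    exact ⟨fun i => (abs_le.1 (h2 i)).1, fun i => (abs_le.1 (h2 i)).2⟩

theorem exists_form_lie_le (Q : InnerForm 𝔤) : ∃ C : ℝ, 0 ≤ C ∧ ∀ x y : 𝔤, Q.form x x ≤ 1 →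
    Q.form y y ≤ 1 → Q.form ⁅x, y⁆ ⁅x, y⁆ ≤ C := by
  have hK := (isCompact_setOf_form_le_one Q).prod (isCompact_setOf_form_le_one Q)
  have hl : Continuous fun p : 𝔤 × 𝔤 => ⁅p.1, p.2⁆ := continuous_bilinear lieBilin
  have hc : Continuous fun p : 𝔤 × 𝔤 => Q.form ⁅p.1, p.2⁆ ⁅p.1, p.2⁆ :=
    (continuous_bilinear Q.form).comp (hl.prodMk hl)
  obtain ⟨C, hC⟩ := hK.bddAbove_image hc.continuousOn
  refine ⟨max C 0, le_max_right _ _, fun x y hx hy => le_max_of_le_left ?_⟩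
  exact hC ⟨(x, y), ⟨hx, hy⟩, rfl⟩

variable {Γ : Type*} {Q : InnerForm 𝔤} {𝔥 : LieSubalgebra ℝ 𝔤} {ρ : Γ → 𝔤 →ₗ[ℝ] 𝔤}
  {T : LinearMap.BilinForm ℝ 𝔤} {τ : ℝ}

/-- All summands of the trace are non-negative, so each `y i * T (b i) (b i)` is at most `1`, while
`T (b i) (b i) ≥ τ`. -/
theorem IsAdmissibleFrame.le_inv {ι : Type*} [Fintype ι] [DecidableEq ι] (hτ : 0 < τ)
    (hT : ∀ v, (∀ A ∈ 𝔥, Q.form v A = 0) → τ * Q.form v v ≤ T v v)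
    {b : ι → 𝔤} {y : ι → ℝ} (h : IsAdmissibleFrame Q 𝔥 ρ T b y) (i : ι) : y i ≤ τ⁻¹ := by
  have h1 : ∀ i, τ ≤ T (b i) (b i) := fun i => by
    have := hT (b i) (h.perp i)
    rwa [h.orthonormal, if_pos rfl, mul_one] at this
  have h2 : y i * T (b i) (b i) ≤ 1 := by
    rw [← h.trace]
    exact Finset.single_le_sum (f := fun i => y i * T (b i) (b i))
      (fun j _ => mul_nonneg (h.pos j).le (hτ.le.trans (h1 j))) (Finset.mem_univ i)
  rw [← one_div, le_div_iff₀ hτ]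
  exact (mul_le_mul_of_nonneg_left (h1 i) (h.pos i).le).trans h2

/-- The cubic sum enters `scal` negatively and is dropped. What remains is controlled by the
weights, bounded by `τ⁻¹`, the brackets of unit vectors, bounded by compactness, and the dimension.
-/
theorem exists_scalarCurvature_le (hQ : Q.IsAdInvariant)
    (hρ : ∀ a x y, Q.form (ρ a x) (ρ a y) = Q.form x y) (hτ : 0 < τ)
    (hT : ∀ v, (∀ A ∈ 𝔥, Q.form v A = 0) → τ * Q.form v v ≤ T v v) :
    ∃ C : ℝ, ∀ (W : Submodule ℝ 𝔤) (g : InnerForm W), IsAdmissible Q 𝔥 ρ T W g →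
      scalarCurvature Q W g ≤ C := by
  obtain ⟨C, hC0, hC⟩ := exists_form_lie_le Q
  refine ⟨Module.finrank ℝ 𝔤 * (τ⁻¹ * (Module.finrank ℝ 𝔤 * C)), fun W g h => ?_⟩
  obtain ⟨b, y, hb, -, hs⟩ := h.exists_frame hQ hρ
  have hk : (Module.finrank ℝ W : ℝ) ≤ Module.finrank ℝ 𝔤 := by
    exact_mod_cast Submodule.finrank_le W
  have h1 : ∀ i, Q.form (b i) (b i) ≤ 1 := fun i => by rw [hb.orthonormal, if_pos rfl]
  have hτ' : 0 ≤ τ⁻¹ := (inv_pos.2 hτ).le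
  have h2 : ∀ i, y i * (∑ j, Q.form ⁅b i, b j⁆ ⁅b i, b j⁆ -
      (∑ j, ∑ k, Q.form ⁅b i, b j⁆ (b k) ^ 2) / 2) ≤ τ⁻¹ * (Module.finrank ℝ 𝔤 * C) := by
    intro i
    have a1 : ∑ j, Q.form ⁅b i, b j⁆ ⁅b i, b j⁆ ≤ Module.finrank ℝ 𝔤 * C := by
      refine (Finset.sum_le_card_nsmul _ _ C fun j _ => hC _ _ (h1 i) (h1 j)).trans ?_
      rw [Finset.card_univ, Fintype.card_fin, nsmul_eq_mul]
      exact mul_le_mul_of_nonneg_right hk hC0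
    have a2 : 0 ≤ (∑ j, ∑ k, Q.form ⁅b i, b j⁆ (b k) ^ 2) / 2 := by positivity
    have a3 : 0 ≤ Module.finrank ℝ 𝔤 * C := by positivity
    calc _ ≤ y i * (Module.finrank ℝ 𝔤 * C) :=
          mul_le_mul_of_nonneg_left (by linarith) (hb.pos i).le
      _ ≤ _ := mul_le_mul_of_nonneg_right (hb.le_inv hτ hT i) a3
  have h3 : 0 ≤ (∑ i, ∑ j, ∑ k, Q.form ⁅b i, b j⁆ (b k) ^ 2 * (y i * y j / y k)) / 4 := by
    have := hb.pos
    refine div_nonneg (Finset.sum_nonneg fun i _ => Finset.sum_nonneg fun j _ =>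
      Finset.sum_nonneg fun k _ => ?_) (by norm_num)
    have := hb.pos i
    have := hb.pos j
    have := hb.pos k
    positivity
  rw [hs, scal]
  refine (sub_le_self _ h3).trans ((Finset.sum_le_card_nsmul _ _ _ fun i _ => h2 i).trans ?_)
  rw [Finset.card_univ, Fintype.card_fin, nsmul_eq_mul]
  exact mul_le_mul_of_nonneg_right hk (by positivity)

theorem frameOp_tendsto {ι : Type*} [Fintype ι] {b : ℕ → ι → 𝔤} {y : ℕ → ι → ℝ} {b' : ι → 𝔤}
    {y' : ι → ℝ} (hb : ∀ i, Tendsto (fun m => b m i) atTop (𝓝 (b' i)))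
    (hy : ∀ i, Tendsto (fun m => y m i) atTop (𝓝 (y' i))) (v : 𝔤) :
    Tendsto (fun m => frameOp Q (b m) (y m) v) atTop (𝓝 (frameOp Q b' y' v)) := by
  refine tendsto_finsetSum _ fun i _ => Tendsto.smul ((hy i).mul ?_) (hb i)
  exact Tendsto.bilinear Q.form tendsto_const_nhds (hb i)

theorem sum_subtype_pos_eq {ι M : Type*} [Fintype ι] [AddCommMonoid M] {y : ι → ℝ}
    (hy : ∀ i, 0 ≤ y i) (f : ι → M) (hf : ∀ i, y i = 0 → f i = 0) :
    ∑ i : {i // 0 < y i}, f i = ∑ i, f i := by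
  classical
  rw [← Finset.sum_subtype (Finset.univ.filter fun i => 0 < y i) (by simp) f, Finset.sum_filter]
  refine Finset.sum_congr rfl fun i _ => ?_
  split_ifs with hi
  · rfl
  · exact (hf i (le_antisymm (not_lt.1 hi) (hy i))).symm

/-- A limit of admissible frames: the vectors with non-zero limiting eigenvalue form an admissible
frame, whose scalar curvature is at least the limit of the scalar curvatures. -/
theorem IsAdmissibleFrame.limit {ι : Type*} [Fintype ι] [DecidableEq ι] (hQ : Q.IsAdInvariant)
    (hinv : ∀ V : Submodule ℝ 𝔤, (∀ a, ∀ x ∈ V, ρ a x ∈ V) → ∀ A ∈ 𝔥, ∀ x ∈ V, ⁅A, x⁆ ∈ V)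
    {b : ℕ → ι → 𝔤} {y : ℕ → ι → ℝ} (h : ∀ m, IsAdmissibleFrame Q 𝔥 ρ T (b m) (y m))
    {b' : ι → 𝔤} {y' : ι → ℝ} (hb : ∀ i, Tendsto (fun m => b m i) atTop (𝓝 (b' i)))
    (hy : ∀ i, Tendsto (fun m => y m i) atTop (𝓝 (y' i))) {s : ℝ}
    (hs : Tendsto (fun m => scal Q (b m) (y m)) atTop (𝓝 s)) :
    IsAdmissibleFrame Q 𝔥 ρ T (fun i : {i // 0 < y' i} => b' i) (fun i => y' i) ∧
    s ≤ scal Q (fun i : {i // 0 < y' i} => b' i) (fun i => y' i) := by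
  classical
  have hy0 : ∀ i, 0 ≤ y' i := fun i => ge_of_tendsto' (hy i) fun m => ((h m).pos i).le
  have hbr : ∀ i j, Tendsto (fun m => ⁅b m i, b m j⁆) atTop (𝓝 ⁅b' i, b' j⁆) := fun i j =>
    Tendsto.bilinear lieBilin (hb i) (hb j)
  have hQ' : ∀ {u v : ℕ → 𝔤} {x z : 𝔤}, Tendsto u atTop (𝓝 x) → Tendsto v atTop (𝓝 z) →
      Tendsto (fun m => Q.form (u m) (v m)) atTop (𝓝 (Q.form x z)) := fun hu hv =>
    Tendsto.bilinear Q.form hu hv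
  have hq : ∀ i j k, Tendsto (fun m => Q.form ⁅b m i, b m j⁆ (b m k)) atTop
      (𝓝 (Q.form ⁅b' i, b' j⁆ (b' k))) := fun i j k => hQ' (hbr i j) (hb k)
  have horth : ∀ i j, Q.form (b' i) (b' j) = if i = j then 1 else 0 := fun i j =>
    tendsto_nhds_unique (hQ' (hb i) (hb j))
      (tendsto_const_nhds.congr fun m => ((h m).orthonormal i j).symm)
  have hperp : ∀ i, ∀ A ∈ 𝔥, Q.form (b' i) A = 0 := fun i A hA =>
    tendsto_nhds_unique (hQ' (hb i) tendsto_const_nhds)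
      (tendsto_const_nhds.congr fun m => ((h m).perp i A hA).symm)
  have hclosed : IsClosed (𝔥 : Set 𝔤) := 𝔥.toSubmodule.closed_of_finiteDimensional
  have hlie : ∀ i j, ⁅b' i, b' j⁆ - ∑ k, Q.form ⁅b' i, b' j⁆ (b' k) • b' k ∈ 𝔥 := fun i j =>
    hclosed.mem_of_tendsto ((hbr i j).sub (tendsto_finsetSum _ fun k _ => (hq i j k).smul (hb k)))
      (Eventually.of_forall fun m => (h m).lie_sub_mem i j)
  -- Unlike the metric, `frameOp` stays finite when weights vanish, so invariance written as a
  -- commutation relation passes to the limit.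
  have hcomm : ∀ a v, ρ a (frameOp Q b' y' v) = frameOp Q b' y' (ρ a v) := fun a v =>
    tendsto_nhds_unique
      (((ρ a).continuous_of_finiteDimensional.tendsto _).comp (frameOp_tendsto hb hy v))
      ((frameOp_tendsto hb hy (ρ a v)).congr fun m => ((h m).comm a v).symm)
  have htr : ∑ i, y' i * T (b' i) (b' i) = 1 :=
    tendsto_nhds_unique
      (tendsto_finsetSum _ fun i _ => (hy i).mul (Tendsto.bilinear T (hb i) (hb i)))
      (tendsto_const_nhds.congr fun m => (h m).trace.symm)
  have hop : ∀ v, frameOp Q (fun i : {i // 0 < y' i} => b' i) (fun i => y' i) v =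
      frameOp Q b' y' v := fun v =>
    sum_subtype_pos_eq hy0 (fun i => (y' i * Q.form v (b' i)) • b' i) fun i hi => by simp [hi]
  have hanti1 : ∀ m i j k, Q.form ⁅b m i, b m j⁆ (b m k) ^ 2 = Q.form ⁅b m j, b m i⁆ (b m k) ^ 2 := by
    intro m i j k
    rw [← lie_skew, map_neg, LinearMap.neg_apply, neg_sq]
  have hanti2 : ∀ m i j k, Q.form ⁅b m i, b m j⁆ (b m k) ^ 2 = Q.form ⁅b m i, b m k⁆ (b m j) ^ 2 := by
    intro m i j k
    rw [hQ, neg_sq, Q.symm]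
  obtain ⟨h1, h2⟩ := structureScal_limit (s := s)
    (N := fun m i j => Q.form ⁅b m i, b m j⁆ ⁅b m i, b m j⁆)
    (q := fun m i j k => Q.form ⁅b m i, b m j⁆ (b m k) ^ 2) (y := y)
    (N' := fun i j => Q.form ⁅b' i, b' j⁆ ⁅b' i, b' j⁆)
    (q' := fun i j k => Q.form ⁅b' i, b' j⁆ (b' k) ^ 2) (y' := y')
    (fun i j => hQ' (hbr i j) (hbr i j)) (fun i j k => (hq i j k).pow 2) hy
    (fun m => (h m).pos) (fun m i j k => sq_nonneg _) hanti1 hanti2 hs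
  have hframe : IsAdmissibleFrame Q 𝔥 ρ T (fun i : {i // 0 < y' i} => b' i) (fun i => y' i) := by
    refine ⟨fun i j => ?_, fun i => i.2, fun i => hperp i, fun i j => ?_, fun a v => ?_, ?_⟩
    · rw [horth]
      exact if_congr Subtype.coe_inj rfl rfl
    -- By the first half of `structureScal_limit`, a bracket of two surviving vectors has no
    -- component along lost ones, so the sum over all `k` reduces to the surviving ones.
    · have := sum_subtype_pos_eq hy0 (fun k => Q.form ⁅b' i, b' j⁆ (b' k) • b' k) fun k hk => by
        have := h1 i j k i.2 j.2 hk
        rw [pow_eq_zero_iff (by norm_num)] at this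
        rw [this, zero_smul]
      rw [this]
      exact hlie i j
    · rw [hop, hop, hcomm]
    · rw [← htr]
      exact sum_subtype_pos_eq hy0 (fun i => y' i * T (b' i) (b' i)) fun i hi => by simp [hi]
  refine ⟨hframe, h2 fun i j hi hj => ?_⟩
  set W := Submodule.span ℝ (Set.range fun i : {i // 0 < y' i} => b' i)
  have hWinv : ∀ a, ∀ x ∈ W, ρ a x ∈ W := by
    intro a x hx
    obtain ⟨u, rfl⟩ := exists_frameOp_eq Q hframe.orthonormal hframe.pos hx
    rw [hframe.comm]
    exact frameOp_mem Q _ _ _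
  have hWj : ∀ x ∈ W, Q.form (b' j) x = 0 := by
    intro x hx
    rw [← sum_form_smul_eq Q hframe.orthonormal hx, map_sum]
    refine Finset.sum_eq_zero fun k _ => ?_
    have : j ≠ k := fun hjk => by
      have := k.2
      rw [← hjk, hj] at this
      exact lt_irrefl _ this
    simp [horth, this]
  -- For `i` surviving and `j` lost, the `𝔥`-component `A` of the bracket vanishes: `ad A` preserves
  -- the surviving span `W`, while `b' j` is orthogonal to `W`. The squared length of the bracket is
  -- then the sum of its squared frame components, as the semicontinuity statement requires.
  set A := ⁅b' i, b' j⁆ - ∑ k, Q.form ⁅b' i, b' j⁆ (b' k) • b' k with hA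
  have hAh : A ∈ 𝔥 := hlie i j
  have hAi : Q.form (b' j) ⁅A, b' i⁆ = 0 :=
    hWj _ (hinv W hWinv A hAh _ (Submodule.subset_span ⟨⟨i, hi⟩, rfl⟩))
  have h3 : Q.form ⁅b' i, b' j⁆ A = 0 := by
    rw [hQ, ← lie_skew, map_neg, hAi, neg_zero, neg_zero]
  have h4 : Q.form A A = 0 := by
    have e1 : Q.form A A = Q.form ⁅b' i, b' j⁆ A -
        Q.form (∑ k, Q.form ⁅b' i, b' j⁆ (b' k) • b' k) A := by rw [← LinearMap.map_sub₂]
    rw [e1, h3, map_sum, LinearMap.sum_apply, zero_sub, neg_eq_zero]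
    exact Finset.sum_eq_zero fun k _ => by
      rw [map_smul, LinearMap.smul_apply, hperp k A hAh, smul_zero]
  have h5 : A = 0 := by
    by_contra hne
    exact (Q.pos A hne).ne' h4
  have h6 : Q.form ⁅b' i, b' j⁆ A = Q.form ⁅b' i, b' j⁆ ⁅b' i, b' j⁆ -
      ∑ k, Q.form ⁅b' i, b' j⁆ (b' k) ^ 2 := by
    rw [hA, map_sub, map_sum]
    simp only [map_smul, smul_eq_mul, pow_two]
  rw [h3] at h6
  exact (sub_eq_zero.1 h6.symm)

/-- A limit of admissible metrics whose scalar curvatures converge to `s` dominates an admissible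
metric with scalar curvature at least `s`, possibly on a smaller subspace. -/
theorem exists_admissible_limit (hQ : Q.IsAdInvariant)
    (hρ : ∀ a x y, Q.form (ρ a x) (ρ a y) = Q.form x y)
    (hinv : ∀ V : Submodule ℝ 𝔤, (∀ a, ∀ x ∈ V, ρ a x ∈ V) → ∀ A ∈ 𝔥, ∀ x ∈ V, ⁅A, x⁆ ∈ V)
    (hτ : 0 < τ) (hT : ∀ v, (∀ A ∈ 𝔥, Q.form v A = 0) → τ * Q.form v v ≤ T v v)
    {W : ℕ → Submodule ℝ 𝔤} {g : ∀ m, InnerForm (W m)}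
    (h : ∀ m, IsAdmissible Q 𝔥 ρ T (W m) (g m)) {U : Submodule ℝ 𝔤} (hU : ∀ m, W m ≤ U)
    {d : ℕ} (hd : ∀ m, Module.finrank ℝ (W m) ≤ d) {s : ℝ}
    (hs : Tendsto (fun m => scalarCurvature Q (W m) (g m)) atTop (𝓝 s)) :
    ∃ (W' : Submodule ℝ 𝔤) (g' : InnerForm W'), IsAdmissible Q 𝔥 ρ T W' g' ∧ W' ≤ U ∧
      Module.finrank ℝ W' ≤ d ∧ s ≤ scalarCurvature Q W' g' := by
  -- The dimensions are bounded, so one of them occurs infinitely often; a subsequence of frames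
  -- with a common index type results.
  obtain ⟨k, hkd, hk⟩ : ∃ k ≤ d, ∃ᶠ m in atTop, Module.finrank ℝ (W m) = k := by
    by_contra hc
    push Not at hc
    have h1 : ∀ᶠ m in atTop, ∀ k ∈ Finset.range (d + 1), Module.finrank ℝ (W m) ≠ k := by
      rw [Filter.eventually_all_finset]
      intro k hk
      exact hc k (Nat.lt_succ_iff.1 (Finset.mem_range.1 hk))
    obtain ⟨m, hm⟩ := h1.exists
    exact hm _ (Finset.mem_range.2 (Nat.lt_succ_of_le (hd m))) rfl
  obtain ⟨φ, hφ, hφk⟩ := extraction_of_frequently_atTop hk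
  have hframe : ∀ m, ∃ (b : Fin k → 𝔤) (y : Fin k → ℝ), IsAdmissibleFrame Q 𝔥 ρ T b y ∧
      Submodule.span ℝ (Set.range b) = W (φ m) ∧
      scalarCurvature Q (W (φ m)) (g (φ m)) = scal Q b y := by
    intro m
    have := (h (φ m)).exists_frame hQ hρ
    rwa [hφk m] at this
  choose b y hby hspan hscal using hframe
  let S : Set ((Fin k → 𝔤) × (Fin k → ℝ)) :=
    (Set.univ.pi fun _ => {v : 𝔤 | Q.form v v ≤ 1}) ×ˢ (Set.univ.pi fun _ => Set.Icc 0 τ⁻¹)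
  have hS : IsCompact S := (isCompact_univ_pi fun _ => isCompact_setOf_form_le_one Q).prod
    (isCompact_univ_pi fun _ => isCompact_Icc)
  have hmem : ∀ m, (b m, y m) ∈ S := fun m =>
    ⟨fun i _ => by
      rw [Set.mem_ofPred_eq]
      change Q.form (b m i) (b m i) ≤ 1
      rw [(hby m).orthonormal, if_pos rfl],
     fun i _ => ⟨((hby m).pos i).le, (hby m).le_inv hτ hT i⟩⟩
  obtain ⟨⟨b', y'⟩, ψ, hψ, hlim⟩ : ∃ p : (Fin k → 𝔤) × (Fin k → ℝ), ∃ ψ : ℕ → ℕ, StrictMono ψ ∧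
      Tendsto ((fun m => (b m, y m)) ∘ ψ) atTop (𝓝 p) := by
    let e : 𝔤 ≃L[ℝ] (Fin (Module.finrank ℝ 𝔤) → ℝ) :=
      (Module.finBasis ℝ 𝔤).equivFun.toContinuousLinearEquiv
    have : FirstCountableTopology 𝔤 := e.toHomeomorph.isInducing.firstCountableTopology
    obtain ⟨p, -, ψ, hψ, hlim⟩ := hS.tendsto_subseq hmem
    exact ⟨p, ψ, hψ, hlim⟩
  have hb : ∀ i, Tendsto (fun m => b (ψ m) i) atTop (𝓝 (b' i)) := fun i =>
    (tendsto_pi_nhds.1 ((continuous_fst.tendsto _).comp hlim)) i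
  have hy : ∀ i, Tendsto (fun m => y (ψ m) i) atTop (𝓝 (y' i)) := fun i =>
    (tendsto_pi_nhds.1 ((continuous_snd.tendsto _).comp hlim)) i
  have hs' : Tendsto (fun m => scal Q (b (ψ m)) (y (ψ m))) atTop (𝓝 s) :=
    (hs.comp (hφ.tendsto_atTop.comp hψ.tendsto_atTop)).congr fun m => hscal (ψ m)
  obtain ⟨hF, hle⟩ := IsAdmissibleFrame.limit hQ hinv (fun m => hby (ψ m)) hb hy hs'
  obtain ⟨g', hg', hgs⟩ := hF.exists_metric hQ hρ rfl
  refine ⟨_, g', hg', ?_, ?_, hgs ▸ hle⟩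
  · rw [Submodule.span_le]
    rintro _ ⟨i, rfl⟩
    refine U.closed_of_finiteDimensional.mem_of_tendsto (hb i) (Eventually.of_forall fun m => ?_)
    exact hU _ ((hspan (ψ m)).le (Submodule.subset_span ⟨(i : Fin k), rfl⟩))
  · refine (finrank_range_le_card _).trans (le_trans ?_ hkd)
    exact (Fintype.card_subtype_le _).trans_eq (Fintype.card_fin k)

end Compactness

/-! ### Comparison of two inner products -/

section Comparison

theorem InnerForm.exists_pos_mul_le {V : Type*} [AddCommGroup V] [Module ℝ V]
    [FiniteDimensional ℝ V] (g T : InnerForm V) :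
    ∃ τ : ℝ, 0 < τ ∧ ∀ v, τ * g.form v v ≤ T.form v v := by
  obtain ⟨e, l, he, hl⟩ := g.exists_basis T.form T.symm
  have hlpos : ∀ i, 0 < l i := fun i => by
    have := T.pos _ (e.ne_zero i)
    rwa [hl, if_pos rfl] at this
  have hsum : ∀ i, (l i)⁻¹ ≤ 1 + ∑ j, (l j)⁻¹ := fun i => by
    have := Finset.single_le_sum (f := fun i => (l i)⁻¹) (fun j _ => (inv_pos.2 (hlpos j)).le)
      (Finset.mem_univ i)
    linarith
  have hpos : 0 < 1 + ∑ j, (l j)⁻¹ := by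
    have : 0 ≤ ∑ j, (l j)⁻¹ := Finset.sum_nonneg fun j _ => (inv_pos.2 (hlpos j)).le
    linarith
  -- This constant is below every eigenvalue of `T`; the summand `1` keeps it positive when the
  -- space is zero.
  refine ⟨(1 + ∑ j, (l j)⁻¹)⁻¹, inv_pos.2 hpos, fun v => ?_⟩
  have hT : ∀ v i, T.form v (e i) = l i * g.form v (e i) := fun v i => by
    conv_lhs => rw [← e.sum_repr v]
    simp only [map_sum, map_smul, LinearMap.sum_apply, LinearMap.smul_apply, hl, smul_eq_mul,
      g.repr_eq e he, div_one]
    rw [Finset.sum_eq_single i (by intro k _ h; simp [h]) (by simp), if_pos rfl, mul_comm]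
  have h1 : T.form v v = ∑ i, l i * g.form v (e i) ^ 2 := by
    conv_lhs => rw [← e.sum_repr v]
    rw [map_sum]
    refine Finset.sum_congr rfl fun i _ => ?_
    rw [e.sum_repr, map_smul, hT, smul_eq_mul, g.repr_eq e he, div_one]
    ring
  rw [h1, g.form_eq_sum e he, Finset.mul_sum]
  refine Finset.sum_le_sum fun i _ => ?_
  rw [← pow_two]
  refine mul_le_mul_of_nonneg_right ?_ (sq_nonneg _)
  exact (inv_le_comm₀ (hlpos i) hpos).1 (hsum i)

end Comparison

/-! ### Isometry invariance of the Ricci tensor -/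

section Naturality

variable {𝔤 : Type*} [LieRing 𝔤] [LieAlgebra ℝ 𝔤] [FiniteDimensional ℝ 𝔤]

/-- The Ricci curvature is natural under isometric automorphisms. -/
theorem ricci_map (Q : InnerForm 𝔤) {W : Submodule ℝ 𝔤} (g : InnerForm W) (φ : 𝔤 →ₗ[ℝ] 𝔤)
    (hlie : ∀ x y, φ ⁅x, y⁆ = ⁅φ x, φ y⁆) (hφ : ∀ x y, Q.form (φ x) (φ y) = Q.form x y)
    (hW : ∀ x ∈ W, φ x ∈ W)
    (hg : ∀ x y : W, g.form ⟨φ x, hW x x.2⟩ ⟨φ y, hW y y.2⟩ = g.form x y) (Y Z : W) :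
    ricci Q W g ⟨φ Y, hW Y Y.2⟩ ⟨φ Z, hW Z Z.2⟩ = ricci Q W g Y Z := by
  have hinj : Function.Injective (φ.restrict hW) := fun x x' hx =>
    Subtype.ext (Q.injective_of_isometry hφ (congrArg Subtype.val hx))
  let ψ : W ≃ₗ[ℝ] W := LinearEquiv.ofInjectiveEndo (φ.restrict hW) hinj
  have hψ : ∀ x : W, ψ x = ⟨φ x, hW x x.2⟩ := fun _ => rfl
  have hψc : ∀ x : W, (ψ x : 𝔤) = φ x := fun _ => rfl
  have hg' : ∀ x y, g.form (ψ x) (ψ y) = g.form x y := hg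
  have hproj : ∀ v, Q.proj W (φ v) = ψ (Q.proj W v) := by
    intro v
    refine (Q.restrict W).eq_of_form_eq fun w => ?_
    obtain ⟨w, rfl⟩ := ψ.surjective w
    refine (Q.form_proj W _ _).trans ?_
    change _ = Q.form (ψ (Q.proj W v) : 𝔤) (ψ w)
    rw [hψc, hψc, hφ, hφ, Q.form_proj]
  have hbr : ∀ X Y, bracketProj Q W (ψ X) (ψ Y) = ψ (bracketProj Q W X Y) := fun X Y => by
    simp only [bracketProj, LinearMap.mk₂_apply, hψc, ← hlie, hproj]
  have hlc : ∀ X Y, leviCivita Q W g (ψ X) (ψ Y) = ψ (leviCivita Q W g X Y) := by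
    intro X Y
    refine g.eq_of_form_eq fun w => ?_
    obtain ⟨w, rfl⟩ := ψ.surjective w
    rw [hg', form_leviCivita, form_leviCivita]
    simp only [koszulForm, LinearMap.coe_mk, AddHom.coe_mk, hbr, hg']
  have hR : ∀ X Y Z, riemann Q W g (ψ X) (ψ Y) (ψ Z) = ψ (riemann Q W g X Y Z) := by
    intro X Y Z
    simp only [riemann, hbr, hlc, hψc, ← hlie, ← map_sub, hproj]
  have hE : riemannEnd Q W g (ψ Y) (ψ Z) = ψ.conj (riemannEnd Q W g Y Z) := by
    ext1 X
    obtain ⟨X, rfl⟩ := ψ.surjective X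
    rw [LinearEquiv.conj_apply_apply, ψ.symm_apply_apply]
    exact hR X Y Z
  change LinearMap.trace ℝ W (riemannEnd Q W g (ψ Y) (ψ Z)) = _
  rw [hE, LinearMap.trace_conj']
  rfl

end Naturality

/-! ### Metrics of non-negative scalar curvature -/

section Existence

variable {𝔤 : Type*} [LieRing 𝔤] [LieAlgebra ℝ 𝔤] [FiniteDimensional ℝ 𝔤]
  {Γ : Type*} {Q : InnerForm 𝔤} {𝔥 : LieSubalgebra ℝ 𝔤} {ρ : Γ → 𝔤 →ₗ[ℝ] 𝔤}
  {T : LinearMap.BilinForm ℝ 𝔤}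

theorem sum_sq_form_le {ι : Type*} [Fintype ι] [DecidableEq ι] (Q : InnerForm 𝔤) {b : ι → 𝔤}
    (hb : ∀ i j, Q.form (b i) (b j) = if i = j then 1 else 0) (v : 𝔤) :
    ∑ k, Q.form v (b k) ^ 2 ≤ Q.form v v := by
  set u := ∑ k, Q.form v (b k) • b k with hu
  have h1 : Q.form v u = ∑ k, Q.form v (b k) ^ 2 := by
    simp only [hu, map_sum, map_smul, smul_eq_mul, pow_two]
  have h2 : Q.form u u = ∑ k, Q.form v (b k) ^ 2 := by
    rw [hu, map_sum]
    refine Finset.sum_congr rfl fun k _ => ?_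
    simp [hb, pow_two]
  have h3 := Q.nonneg (v - u)
  have h4 := Q.symm u v
  simp only [map_sub, LinearMap.sub_apply] at h3
  linarith

/-- The multiple of `Q` with `tr T = 1` has non-negative scalar curvature. -/
theorem exists_admissible_nonneg (hQ : Q.IsAdInvariant)
    (hρ : ∀ a x y, Q.form (ρ a x) (ρ a y) = Q.form x y) {W : Submodule ℝ 𝔤}
    (hperp : ∀ w ∈ W, ∀ A ∈ 𝔥, Q.form w A = 0)
    (hlie : ∀ x ∈ W, ∀ y ∈ W, ⁅x, y⁆ ∈ 𝔥.toSubmodule ⊔ W) (hmap : ∀ a, ∀ x ∈ W, ρ a x ∈ W)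
    (hT : ∀ w ∈ W, w ≠ 0 → 0 < T w w) (hW : W ≠ ⊥) :
    ∃ g : InnerForm W, IsAdmissible Q 𝔥 ρ T W g ∧ 0 ≤ scalarCurvature Q W g := by
  obtain ⟨e, -, he, -⟩ := (Q.restrict W).exists_basis 0 (by simp)
  have he0 : ∀ i j, Q.form (e i : 𝔤) (e j) = if i = j then 1 else 0 := he
  have htr := (Q.restrict W).traceForm_eq e he (T.restrict W)
  have hc : 0 < (Q.restrict W).traceForm (T.restrict W) := by
    rw [htr]
    have : Nontrivial W := Submodule.nontrivial_iff_ne_bot.2 hW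
    have : Nonempty (Fin (Module.finrank ℝ W)) := ⟨⟨0, Module.finrank_pos⟩⟩
    refine Finset.sum_pos (fun i _ => ?_) Finset.univ_nonempty
    rw [div_one]
    exact hT _ (e i).2 fun h => e.ne_zero i (Subtype.ext h)
  refine ⟨(Q.restrict W).smul _ hc, ⟨hperp, hlie, hmap, fun a x y => ?_, ?_⟩, ?_⟩
  · rw [InnerForm.smul_form_apply, InnerForm.smul_form_apply]
    congr 1
    exact hρ a x y
  · rw [InnerForm.traceForm_smul, div_self hc.ne']
  · rw [scalarCurvature_smul hQ, scalarCurvature_eq_scal hQ W (Q.restrict W) e he0 (y := fun _ => 1)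
      (by simpa using he), scal]
    refine div_nonneg ?_ hc.le
    -- For `Q` itself the scalar curvature is the sum of squared lengths of brackets minus three
    -- quarters of the sum of their squared components, which is non-negative by Bessel's
    -- inequality.
    have h1 : ∑ i, ∑ j, ∑ k, Q.form ⁅(e i : 𝔤), (e j : 𝔤)⁆ (e k) ^ 2 ≤
        ∑ i, ∑ j, Q.form ⁅(e i : 𝔤), (e j : 𝔤)⁆ ⁅(e i : 𝔤), (e j : 𝔤)⁆ :=
      Finset.sum_le_sum fun i _ => Finset.sum_le_sum fun j _ => sum_sq_form_le Q he0 _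
    have h2 : 0 ≤ ∑ i, ∑ j, ∑ k, Q.form ⁅(e i : 𝔤), (e j : 𝔤)⁆ (e k) ^ 2 := by positivity
    simp only [one_mul, mul_one, div_one, Finset.sum_sub_distrib, ← Finset.sum_div]
    linarith

end Existence

/-! ### Scalar curvature of a homogeneous fibration -/

section Submersion

theorem structureScal_smul {ι : Type*} [Fintype ι] (N : ι → ι → ℝ) (q : ι → ι → ι → ℝ) (y : ι → ℝ)
    {c : ℝ} (hc : c ≠ 0) : structureScal N q (fun i => c * y i) = c * structureScal N q y := by
  simp only [structureScal, mul_sub, ← mul_div_assoc, Finset.mul_sum]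
  congr 1
  · refine Finset.sum_congr rfl fun i _ => ?_
    simp only [mul_assoc]
  · congr 1
    refine Finset.sum_congr rfl fun i _ => Finset.sum_congr rfl fun j _ =>
      Finset.sum_congr rfl fun k _ => ?_
    by_cases hk : y k = 0
    · simp [hk]
    · field_simp

variable {ι κ : Type*} [Fintype ι] [Fintype κ]

/-- Here `u` weights the fiber and `v` the base. The conditions say that the fiber directions are
closed under brackets modulo isotropy, act on the base directions, and respect the base metric, so
mixed constants occur only between equal base weights. The mixed contributions then cancel, except
for the O'Neill term. -/
theorem structureScal_sumElim (N : ι ⊕ κ → ι ⊕ κ → ℝ) (q : ι ⊕ κ → ι ⊕ κ → ι ⊕ κ → ℝ)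
    (u : ι → ℝ) (v : κ → ℝ) (hv : ∀ k, v k ≠ 0) (hN : ∀ i j, N i j = N j i)
    (hq1 : ∀ i j k, q i j k = q j i k) (hq2 : ∀ i j k, q i j k = q i k j)
    (h0 : ∀ i j k, q (.inl i) (.inl j) (.inr k) = 0)
    (hN' : ∀ i j, N (.inl i) (.inr j) = ∑ k, q (.inl i) (.inr j) (.inr k))
    (hr : ∀ i j k, q (.inl i) (.inr j) (.inr k) * (v j - v k) = 0) :
    structureScal N q (Sum.elim u v) =
      structureScal (fun i j => N (.inl i) (.inl j)) (fun i j k => q (.inl i) (.inl j) (.inl k)) u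
      + structureScal (fun i j => N (.inr i) (.inr j)) (fun i j k => q (.inr i) (.inr j) (.inr k)) v
      - (∑ i, ∑ j, ∑ k, q (.inl i) (.inr j) (.inr k) * (v j ^ 2 / u i)) / 4 := by
  set r : ι → κ → κ → ℝ := fun i j k => q (.inl i) (.inr j) (.inr k) with hrdef
  have a1 : ∀ i j k, q (.inl i) (.inr j) (.inl k) = 0 := fun i j k => by rw [hq2, h0]
  have a2 : ∀ i j k, q (.inr i) (.inl j) (.inl k) = 0 := fun i j k => by rw [hq1, a1]
  have a3 : ∀ i j k, q (.inr j) (.inl i) (.inr k) = r i j k := fun i j k => by rw [hq1]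
  have a4 : ∀ i j k, q (.inr j) (.inr k) (.inl i) = r i j k := fun i j k => by rw [hq2, a3]
  have a5 : ∀ i j k, q (.inl i) (.inr j) (.inr k) = r i j k := fun i j k => rfl
  have a6 : ∀ i j, N (.inr j) (.inl i) = ∑ k, r i j k := fun i j => by rw [hN, hN']
  have hvr : ∀ i j k, r i j k = 0 ∨ v j = v k := fun i j k => by
    rcases mul_eq_zero.1 (hr i j k) with h | h
    · exact .inl h
    · exact .inr (sub_eq_zero.1 h)
  have b1 : ∀ i j k, r i j k * (u i * v j / v k) = r i j k * u i := fun i j k => by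
    rcases hvr i j k with h | h
    · simp [h]
    · rw [h, mul_div_assoc, div_self (hv k), mul_one]
  have b2 : ∀ i j k, r i j k * (v j * u i / v k) = r i j k * u i := fun i j k => by
    rw [mul_comm (v j), b1]
  have b3 : ∀ i j k, r i j k * (v j * v k / u i) = r i j k * (v j ^ 2 / u i) := fun i j k => by
    rcases hvr i j k with h | h
    · simp [h]
    · rw [h, pow_two]
  simp only [structureScal, Fintype.sum_sum_type, Sum.elim_inl, Sum.elim_inr, h0, a1, a2, a3, a4, a5,
    a6, hN', b1, b2, b3, zero_mul, Finset.sum_const_zero, add_zero, zero_add]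
  have c1 : ∑ j, ∑ i, ∑ k, r i j k * u i = ∑ i, ∑ j, ∑ k, r i j k * u i := Finset.sum_comm
  have c2 : ∑ j, ∑ k, ∑ i, r i j k * (v j ^ 2 / u i) = ∑ i, ∑ j, ∑ k, r i j k * (v j ^ 2 / u i) := by
    rw [Finset.sum_comm (f := fun i j => ∑ k, r i j k * (v j ^ 2 / u i))]
    exact Finset.sum_congr rfl fun j _ => Finset.sum_comm
  have c3 : ∀ j, ∑ k, ∑ i, r i j k = ∑ i, ∑ k, r i j k := fun j => Finset.sum_comm
  simp only [Finset.sum_add_distrib, c1, c2, c3, mul_add, mul_sub, add_div, Finset.sum_sub_distrib]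
  have d1 : ∑ i, ∑ j, ∑ k, r i j k * u i = ∑ i, u i * ∑ j, ∑ k, r i j k := by
    refine Finset.sum_congr rfl fun i _ => ?_
    simp only [Finset.mul_sum, mul_comm]
  rw [d1]
  have d2 : ∀ (x w : ι → ℝ), ∑ i, x i * (w i / 2) = (∑ i, x i * w i) / 2 := fun x w => by
    simp only [← mul_div_assoc, Finset.sum_div]
  have d3 : ∀ (x w : κ → ℝ), ∑ i, x i * (w i / 2) = (∑ i, x i * w i) / 2 := fun x w => by
    simp only [← mul_div_assoc, Finset.sum_div]
  simp only [d2, d3]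
  ring

end Submersion

/-! ### Combining a fiber metric and a base metric -/

section CombinedFrame

variable {𝔤 : Type*} [LieRing 𝔤] [LieAlgebra ℝ 𝔤] [FiniteDimensional ℝ 𝔤]
  {ι κ : Type*} [Fintype ι] [DecidableEq ι] [Fintype κ] [DecidableEq κ] {Γ Γ' : Type*}
  {Q : InnerForm 𝔤} {𝔥 𝔨 : LieSubalgebra ℝ 𝔤} {ρ : Γ → 𝔤 →ₗ[ℝ] 𝔤} {ρ' : Γ' → 𝔤 →ₗ[ℝ] 𝔤}
  {T : LinearMap.BilinForm ℝ 𝔤}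

theorem frameOp_smul (Q : InnerForm 𝔤) (b : ι → 𝔤) (y : ι → ℝ) (c : ℝ) (v : 𝔤) :
    frameOp Q b (fun i => c * y i) v = c • frameOp Q b y v := by
  simp only [frameOp, Finset.smul_sum, smul_smul, mul_assoc]

theorem frameOp_sumElim (Q : InnerForm 𝔤) (b : ι → 𝔤) (b' : κ → 𝔤) (y : ι → ℝ) (y' : κ → ℝ) (v : 𝔤) :
    frameOp Q (Sum.elim b b') (Sum.elim y y') v = frameOp Q b y v + frameOp Q b' y' v := by
  simp only [frameOp, Fintype.sum_sum_type, Sum.elim_inl, Sum.elim_inr]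

theorem frameOp_apply_self (Q : InnerForm 𝔤) {b : ι → 𝔤}
    (hb : ∀ i j, Q.form (b i) (b j) = if i = j then 1 else 0) (y : ι → ℝ) (i : ι) :
    frameOp Q b y (b i) = y i • b i := by
  rw [frameOp, Finset.sum_eq_single i (by intro j _ h; simp [hb, h.symm]) (by simp)]
  simp [hb]

/-- An admissible frame for the fiber and one for the base combine to an admissible frame. -/
theorem IsAdmissibleFrame.sumElim {b : ι → 𝔤} {y : ι → ℝ} {b' : κ → 𝔤} {y' : κ → ℝ}
    (hb : IsAdmissibleFrame Q 𝔥 ρ T b y) (hb' : IsAdmissibleFrame Q 𝔨 ρ' T b' y')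
    (h𝔨 : 𝔥 ≤ 𝔨) (hmem : ∀ i, b i ∈ 𝔨) (hρ : ∀ a, ∃ a', ρ a = ρ' a')
    (hcompl : ∀ v, (∀ i, Q.form v (b i) = 0) → (∀ j, Q.form v (b' j) = 0) → v ∈ 𝔥)
    {t : ℝ} (ht0 : 0 < t) (ht1 : t < 1) :
    IsAdmissibleFrame Q 𝔥 ρ T (Sum.elim b b')
      (Sum.elim (fun i => (1 - t) * y i) (fun j => t * y' j)) := by
  have hort : ∀ i j, Q.form (Sum.elim b b' i) (Sum.elim b b' j) = if i = j then 1 else 0 := by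
    rintro (i | i) (j | j)
    · simp [hb.orthonormal]
    · simp [Q.symm (b i), hb'.perp j _ (hmem i)]
    · simp [hb'.perp i _ (hmem j)]
    · simp [hb'.orthonormal]
  refine ⟨hort, ?_, ?_, ?_, ?_, ?_⟩
  · rintro (i | i)
    · exact mul_pos (sub_pos.2 ht1) (hb.pos i)
    · exact mul_pos ht0 (hb'.pos i)
  · rintro (i | i) A hA
    · exact hb.perp i A hA
    · exact hb'.perp i A (h𝔨 hA)
  · intro i j
    set w := ⁅Sum.elim b b' i, Sum.elim b b' j⁆
    have h : ∀ l, Q.form (w - ∑ k, Q.form w (Sum.elim b b' k) • Sum.elim b b' k)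
        (Sum.elim b b' l) = 0 := fun l => by
      simp only [map_sub, LinearMap.sub_apply, map_sum, LinearMap.sum_apply, map_smul,
        LinearMap.smul_apply, hort, smul_eq_mul]
      simp
    exact hcompl _ (fun l => h (.inl l)) (fun l => h (.inr l))
  · intro a v
    obtain ⟨a', ha'⟩ := hρ a
    simp only [frameOp_sumElim, frameOp_smul, map_add, map_smul]
    rw [hb.comm, ha', hb'.comm]
  -- The weights `1 - t` and `t` are chosen so that the total trace is a convex combination of two
  -- ones.
  · simp only [Fintype.sum_sum_type, Sum.elim_inl, Sum.elim_inr, mul_assoc, ← Finset.mul_sum]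
    rw [hb.trace, hb'.trace]
    ring

/-- The two diagonal contributions are homogeneous of degree one in their weights, and the O'Neill
term scales as the squared base factor over the fiber factor. Its loss is of second order in `t`. -/
theorem exists_scal_sumElim_eq (hQ : Q.IsAdInvariant) {b : ι → 𝔤} {y : ι → ℝ} {b' : κ → 𝔤}
    {y' : κ → ℝ} (hb : IsAdmissibleFrame Q 𝔥 ρ T b y) (hb' : IsAdmissibleFrame Q 𝔨 ρ' T b' y')
    (hmem : ∀ i, b i ∈ 𝔨)
    (hcomm : ∀ A ∈ 𝔨, ∀ v, ⁅A, frameOp Q b' y' v⁆ = frameOp Q b' y' ⁅A, v⁆) :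
    ∃ C : ℝ, 0 ≤ C ∧ ∀ t : ℝ, 0 < t → t < 1 →
      scal Q (Sum.elim b b') (Sum.elim (fun i => (1 - t) * y i) (fun j => t * y' j)) =
        (1 - t) * scal Q b y + t * scal Q b' y' - C * (t ^ 2 / (1 - t)) := by
  refine ⟨(∑ i, ∑ j, ∑ k, Q.form ⁅b i, b' j⁆ (b' k) ^ 2 * (y' j ^ 2 / y i)) / 4, ?_,
    fun t ht0 ht1 => ?_⟩
  · refine div_nonneg (Finset.sum_nonneg fun i _ => Finset.sum_nonneg fun j _ =>
      Finset.sum_nonneg fun k _ => ?_) (by norm_num)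
    have := hb.pos i
    positivity
  -- Since `ad 𝔨` commutes with the operator of the base frame, it preserves the range of that
  -- operator, which is the span of `b'`.
  have hinv : ∀ i k, ⁅b i, b' k⁆ ∈ Submodule.span ℝ (Set.range b') := fun i k => by
    obtain ⟨u, hu⟩ := exists_frameOp_eq Q hb'.orthonormal hb'.pos
      (Submodule.subset_span (Set.mem_range_self k))
    rw [← hu, hcomm _ (hmem i)]
    exact frameOp_mem Q _ _ _
  have key := structureScal_sumElim
    (fun i j => Q.form ⁅Sum.elim b b' i, Sum.elim b b' j⁆ ⁅Sum.elim b b' i, Sum.elim b b' j⁆)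
    (fun i j k => Q.form ⁅Sum.elim b b' i, Sum.elim b b' j⁆ (Sum.elim b b' k) ^ 2)
    (fun i => (1 - t) * y i) (fun j => t * y' j)
    (fun k => (mul_pos ht0 (hb'.pos k)).ne')
    (fun i j => by rw [← lie_skew]; simp only [map_neg, LinearMap.neg_apply, neg_neg])
    (fun i j k => by rw [← lie_skew, map_neg, LinearMap.neg_apply, neg_sq])
    (fun i j k => by rw [hQ, neg_sq, Q.symm])
    (fun i j k => by
      simp only [Sum.elim_inl, Sum.elim_inr]
      rw [Q.symm, hb'.perp k _ (𝔨.lie_mem (hmem i) (hmem j))]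
      norm_num)
    (fun i j => by
      simp only [Sum.elim_inl, Sum.elim_inr]
      have h1 := congrArg (Q.form ⁅b i, b' j⁆) (sum_form_smul_eq Q hb'.orthonormal (hinv i j))
      rw [← h1, map_sum]
      simp only [map_smul, smul_eq_mul, pow_two])
    (fun i j k => by
      simp only [Sum.elim_inl, Sum.elim_inr]
      have h1 := congrArg (fun w => Q.form w (b' k)) (hcomm _ (hmem i) (b' j))
      simp only [frameOp_apply_self Q hb'.orthonormal, form_frameOp Q hb'.orthonormal, lie_smul,
        map_smul, LinearMap.smul_apply, smul_eq_mul] at h1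
      have h2 : Q.form ⁅b i, b' j⁆ (b' k) * (y' j - y' k) = 0 := by linarith
      calc _ = Q.form ⁅b i, b' j⁆ (b' k) * t * (Q.form ⁅b i, b' j⁆ (b' k) * (y' j - y' k)) := by ring
        _ = 0 := by rw [h2, mul_zero])
  rw [structureScal_smul _ _ _ (sub_pos.2 ht1).ne', structureScal_smul _ _ _ ht0.ne'] at key
  refine key.trans ?_
  congr 1
  rw [div_mul_eq_mul_div]
  congr 1
  simp only [Finset.sum_mul, Sum.elim_inl, Sum.elim_inr]
  refine Finset.sum_congr rfl fun i _ => Finset.sum_congr rfl fun j _ =>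
    Finset.sum_congr rfl fun k _ => ?_
  have h1 := (hb.pos i).ne'
  have h2 := (sub_pos.2 ht1).ne'
  field_simp

/-- If the fiber has scalar curvature at least `a` and the base more than `a`, some combination
has scalar curvature more than `a`. -/
theorem exists_frame_lt_scal (hQ : Q.IsAdInvariant) {b : ι → 𝔤} {y : ι → ℝ} {b' : κ → 𝔤}
    {y' : κ → ℝ} (hb : IsAdmissibleFrame Q 𝔥 ρ T b y) (hb' : IsAdmissibleFrame Q 𝔨 ρ' T b' y')
    (h𝔨 : 𝔥 ≤ 𝔨) (hmem : ∀ i, b i ∈ 𝔨) (hρ : ∀ a, ∃ a', ρ a = ρ' a')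
    (hcompl : ∀ v, (∀ i, Q.form v (b i) = 0) → (∀ j, Q.form v (b' j) = 0) → v ∈ 𝔥)
    (hcomm : ∀ A ∈ 𝔨, ∀ v, ⁅A, frameOp Q b' y' v⁆ = frameOp Q b' y' ⁅A, v⁆)
    {a : ℝ} (ha : a ≤ scal Q b y) (ha' : a < scal Q b' y') :
    ∃ z : ι ⊕ κ → ℝ, IsAdmissibleFrame Q 𝔥 ρ T (Sum.elim b b') z ∧
      a < scal Q (Sum.elim b b') z := by
  obtain ⟨C, hC, hS⟩ := exists_scal_sumElim_eq hQ hb hb' hmem hcomm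
  set δ := scal Q b' y' - a with hδ
  have hδ0 : 0 < δ := sub_pos.2 ha'
  -- The bound `t ≤ 1/2` gives `t² / (1 - t) ≤ 2 t²`, and `t (4C + 4) ≤ δ` makes the loss `2 C t²`
  -- smaller than the gain `t δ`; the extra `4` covers `C = 0`.
  set t := min (1 / 2) (δ / (4 * C + 4)) with ht
  have ht0 : 0 < t := lt_min (by norm_num) (by positivity)
  have ht2 : t ≤ 1 / 2 := min_le_left _ _
  have ht3 : t * (4 * C + 4) ≤ δ := by
    rw [← le_div_iff₀ (by positivity)]
    exact min_le_right _ _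
  have ht1 : t < 1 := by linarith
  refine ⟨_, hb.sumElim hb' h𝔨 hmem hρ hcompl ht0 ht1, ?_⟩
  rw [hS t ht0 ht1]
  have h1 : t ^ 2 / (1 - t) ≤ 2 * t ^ 2 := by
    rw [div_le_iff₀ (by linarith)]
    nlinarith [sq_nonneg t]
  have h2 := mul_le_mul_of_nonneg_left h1 hC
  have h3 : (1 - t) * a ≤ (1 - t) * scal Q b y :=
    mul_le_mul_of_nonneg_left ha (by linarith)
  have h4 : t * scal Q b' y' = t * a + t * δ := by rw [hδ]; ring
  have h5 : t * (t * (4 * C + 4)) ≤ t * δ := mul_le_mul_of_nonneg_left ht3 ht0.le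
  nlinarith [mul_nonneg hC (sq_nonneg t), sq_pos_of_pos ht0]

end CombinedFrame

/-! ### Domination of scalar curvatures on families of subspaces -/

section Dominating

variable {𝔤 : Type*} [LieRing 𝔤] [LieAlgebra ℝ 𝔤] [FiniteDimensional ℝ 𝔤]
  [TopologicalSpace 𝔤] [IsTopologicalAddGroup 𝔤] [ContinuousSMul ℝ 𝔤] [T2Space 𝔤]
  {Γ : Type*} {Q : InnerForm 𝔤} {𝔥 : LieSubalgebra ℝ 𝔤} {ρ : Γ → 𝔤 →ₗ[ℝ] 𝔤}
  {T : LinearMap.BilinForm ℝ 𝔤} {τ : ℝ}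

/-- For a family of subspaces, some admissible metric (possibly on a smaller subspace) dominates the
scalar curvatures of all admissible metrics on members of the family. -/
theorem exists_admissible_forall_le (hQ : Q.IsAdInvariant)
    (hρ : ∀ a x y, Q.form (ρ a x) (ρ a y) = Q.form x y)
    (hinv : ∀ V : Submodule ℝ 𝔤, (∀ a, ∀ x ∈ V, ρ a x ∈ V) → ∀ A ∈ 𝔥, ∀ x ∈ V, ⁅A, x⁆ ∈ V)
    (hτ : 0 < τ) (hT : ∀ v, (∀ A ∈ 𝔥, Q.form v A = 0) → τ * Q.form v v ≤ T v v)
    {P : Set (Submodule ℝ 𝔤)} {U : Submodule ℝ 𝔤} (hU : ∀ W ∈ P, W ≤ U) {d : ℕ}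
    (hd : ∀ W ∈ P, Module.finrank ℝ W ≤ d)
    (hne : ∃ W ∈ P, ∃ g : InnerForm W, IsAdmissible Q 𝔥 ρ T W g) :
    ∃ (W' : Submodule ℝ 𝔤) (g' : InnerForm W'), IsAdmissible Q 𝔥 ρ T W' g' ∧ W' ≤ U ∧
      Module.finrank ℝ W' ≤ d ∧ ∀ W ∈ P, ∀ g : InnerForm W, IsAdmissible Q 𝔥 ρ T W g →
        scalarCurvature Q W g ≤ scalarCurvature Q W' g' := by
  let S : Set ℝ := {r | ∃ W ∈ P, ∃ g : InnerForm W, IsAdmissible Q 𝔥 ρ T W g ∧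
    scalarCurvature Q W g = r}
  have hS : S.Nonempty := by
    obtain ⟨W, hW, g, hg⟩ := hne
    exact ⟨_, W, hW, g, hg, rfl⟩
  have hSb : BddAbove S := by
    obtain ⟨C, hC⟩ := exists_scalarCurvature_le hQ hρ hτ hT
    refine ⟨C, ?_⟩
    rintro _ ⟨W, -, g, hg, rfl⟩
    exact hC W g hg
  obtain ⟨u, -, hu, huS⟩ := exists_seq_tendsto_sSup hS hSb
  choose W hW g hg hgu using huS
  obtain ⟨W', g', h1, h2, h3, h4⟩ := exists_admissible_limit hQ hρ hinv hτ hT hg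
    (fun m => hU _ (hW m)) (fun m => hd _ (hW m)) (hu.congr fun m => (hgu m).symm)
  exact ⟨W', g', h1, h2, h3, fun V hV k hk => (le_csSup hSb ⟨V, hV, k, hk, rfl⟩).trans h4⟩

end Dominating

/-! ### Translation to Lie subgroups and homogeneous metrics -/

section HomogeneousSpaces

variable {n : ℕ} {G : Type*} [TopologicalSpace G] [ChartedSpace (EuclideanSpace ℝ (Fin n)) G]
  [Group G] [LieGroup (𝓡 n) ∞ G] [T2Space G]

instance instT2SpaceGroupLieAlgebra : T2Space (GroupLieAlgebra (𝓡 n) G) :=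
  inferInstanceAs (T2Space (EuclideanSpace ℝ (Fin n)))

theorem BiinvariantMetric.isAdInvariant (Q : BiinvariantMetric n G) :
    Q.toInnerForm.IsAdInvariant := Q.form_lie

namespace LieSubgroup

variable (Q : BiinvariantMetric n G) (H K : LieSubgroup n G)

theorem mem_perp {x : GroupLieAlgebra (𝓡 n) G} :
    x ∈ H.perp Q ↔ ∀ A ∈ H.lieAlg, Q.form x A = 0 := by
  rw [perp, LinearMap.BilinForm.mem_orthogonal_iff]
  exact forall₂_congr fun A _ => by rw [Q.symm]

theorem Ad_mem_perp {a : G} (ha : a ∈ H.toSubgroup) {x : GroupLieAlgebra (𝓡 n) G}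
    (hx : x ∈ H.perp Q) : Ad a x ∈ H.perp Q := by
  rw [mem_perp] at hx ⊢
  intro A hA
  rw [← Ad_apply_Ad_inv a A, Q.inv]
  exact hx _ (H.Ad_mem _ (H.toSubgroup.inv_mem ha) _ hA)

theorem sub_proj_mem_perp (x : GroupLieAlgebra (𝓡 n) G) :
    x - Q.proj H.lieAlg.toSubmodule x ∈ H.perp Q := by
  rw [mem_perp]
  intro A hA
  rw [LinearMap.map_sub₂, Q.form_proj H.lieAlg.toSubmodule x ⟨A, hA⟩, sub_self]

theorem mem_of_mem_perp {x : GroupLieAlgebra (𝓡 n) G} (hx : x ∈ H.perp Q) (hx' : x ∈ H.lieAlg) :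
    x = 0 := by
  by_contra hne
  exact (Q.pos x hne).ne' ((H.mem_perp Q).1 hx x hx')

theorem sup_perp_eq_top : H.lieAlg.toSubmodule ⊔ H.perp Q = ⊤ := by
  rw [eq_top_iff]
  intro x _
  exact Submodule.mem_sup.2 ⟨_, (Q.proj H.lieAlg.toSubmodule x).2, _, H.sub_proj_mem_perp Q x,
    add_sub_cancel _ _⟩

variable {H K} in
theorem sup_fiber_eq (h : H.lieAlg ≤ K.lieAlg) :
    H.lieAlg.toSubmodule ⊔ H.fiber Q K = K.lieAlg.toSubmodule := by
  refine le_antisymm (sup_le h inf_le_left) fun x hx => ?_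
  refine Submodule.mem_sup.2 ⟨_, (Q.proj H.lieAlg.toSubmodule x).2, _, ⟨?_, H.sub_proj_mem_perp Q x⟩,
    add_sub_cancel _ _⟩
  exact Submodule.sub_mem _ hx (h (Q.proj H.lieAlg.toSubmodule x).2)

variable {H K} in
-- Since `𝔨` is the direct sum of `𝔥` and the fiber, lowest dimension of `K` can be tested on the
-- fibers.
theorem finrank_lieAlg_eq (h : H.lieAlg ≤ K.lieAlg) :
    Module.finrank ℝ K.lieAlg = Module.finrank ℝ H.lieAlg + Module.finrank ℝ (H.fiber Q K) := by
  have h1 := Submodule.finrank_sup_add_finrank_inf_eq H.lieAlg.toSubmodule (H.fiber Q K)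
  have h2 : H.lieAlg.toSubmodule ⊓ H.fiber Q K = ⊥ := by
    rw [eq_bot_iff]
    exact fun x hx => H.mem_of_mem_perp Q hx.2.2 hx.1
  rw [sup_fiber_eq Q h, h2, finrank_bot, add_zero] at h1
  exact h1

variable {H K} in
theorem Ad_mem_fiber (h : H.toSubgroup ≤ K.toSubgroup) {a : G} (ha : a ∈ H.toSubgroup)
    {x : GroupLieAlgebra (𝓡 n) G} (hx : x ∈ H.fiber Q K) : Ad a x ∈ H.fiber Q K :=
  ⟨K.Ad_mem a (h ha) x hx.1, H.Ad_mem_perp Q ha hx.2⟩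

variable {H K} in
theorem IsIntermediate.fiber_lt_perp (hK : H.IsIntermediate K) : H.fiber Q K < H.perp Q := by
  refine lt_of_le_of_ne (H.fiber_le_perp Q K) fun h => hK.2.2.ne ?_
  have h1 := sup_fiber_eq Q hK.2.1.le
  rw [h, sup_perp_eq_top] at h1
  rw [eq_top_iff]
  intro x _
  have : x ∈ K.lieAlg.toSubmodule := h1 ▸ Submodule.mem_top
  exact this

variable {H K} in
theorem IsIntermediate.fiber_ne_bot (hK : H.IsIntermediate K) : H.fiber Q K ≠ ⊥ := by
  intro h
  have h1 := sup_fiber_eq Q hK.2.1.le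
  rw [h, sup_bot_eq] at h1
  exact hK.2.1.ne (LieSubalgebra.toSubmodule_injective h1)

variable {Q H} (T : InvariantMetric H.toSubgroup (H.perp Q))

/-- The extension of `T` by zero to the Lie algebra of `G`. -/
noncomputable def extendForm : LinearMap.BilinForm ℝ (GroupLieAlgebra (𝓡 n) G) :=
  T.form.compl₁₂ (Q.proj (H.perp Q)) (Q.proj (H.perp Q))

theorem extendForm_apply (x y : H.perp Q) :
    extendForm T (x : GroupLieAlgebra (𝓡 n) G) y = T.form x y := by
  rw [extendForm, LinearMap.compl₁₂_apply, InnerForm.proj_coe, InnerForm.proj_coe]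

theorem restrict_extendForm {W : Submodule ℝ (GroupLieAlgebra (𝓡 n) G)} (hW : W ≤ H.perp Q) :
    (extendForm T).restrict W = restrictForm T.form hW := by
  ext x y
  exact extendForm_apply T ⟨x, hW x.2⟩ ⟨y, hW y.2⟩

theorem extendForm_pos {w : GroupLieAlgebra (𝓡 n) G} (hw : w ∈ H.perp Q) (hne : w ≠ 0) :
    0 < extendForm T w w := by
  rw [extendForm_apply T ⟨w, hw⟩ ⟨w, hw⟩]
  exact T.pos _ fun h => hne (congrArg Subtype.val h)

theorem exists_mul_le_extendForm : ∃ τ : ℝ, 0 < τ ∧ ∀ v : GroupLieAlgebra (𝓡 n) G,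
    (∀ A ∈ H.lieAlg, Q.form v A = 0) → τ * Q.form v v ≤ extendForm T v v := by
  obtain ⟨τ, hτ, h⟩ := (Q.restrict (H.perp Q)).exists_pos_mul_le T.toInnerForm
  refine ⟨τ, hτ, fun v hv => ?_⟩
  have hv' : v ∈ H.perp Q := (H.mem_perp Q).2 hv
  rw [extendForm_apply T ⟨v, hv'⟩ ⟨v, hv'⟩]
  exact h ⟨v, hv'⟩

/-- The adjoint action of the elements of a Lie subgroup. -/
noncomputable def adAction (L : LieSubgroup n G) (a : L.toSubgroup) :
    GroupLieAlgebra (𝓡 n) G →ₗ[ℝ] GroupLieAlgebra (𝓡 n) G :=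
  Ad (a : G)

theorem form_adAction (Q : BiinvariantMetric n G) (L : LieSubgroup n G) (a : L.toSubgroup)
    (x y : GroupLieAlgebra (𝓡 n) G) :
    Q.form (L.adAction a x) (L.adAction a y) = Q.form x y := Q.inv a x y

theorem lie_mem_of_adAction_mem (L : LieSubgroup n G)
    (V : Submodule ℝ (GroupLieAlgebra (𝓡 n) G)) (hV : ∀ a, ∀ x ∈ V, L.adAction a x ∈ V) :
    ∀ A ∈ L.lieAlg, ∀ x ∈ V, ⁅A, x⁆ ∈ V := fun _ hA _ hx =>
  L.lie_mem_of_Ad_mem (fun a ha x hx => hV ⟨a, ha⟩ x hx) hA hx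

/-- `g` is an invariant metric of trace one on a complement of `𝔥` in some subalgebra. -/
abbrev Admissible (W : Submodule ℝ (GroupLieAlgebra (𝓡 n) G)) (g : InnerForm W) : Prop :=
  IsAdmissible Q.toInnerForm H.lieAlg H.adAction (extendForm T) W g

theorem exists_admissible_forall_le {P : Set (Submodule ℝ (GroupLieAlgebra (𝓡 n) G))}
    {U : Submodule ℝ (GroupLieAlgebra (𝓡 n) G)} (hU : ∀ W ∈ P, W ≤ U) {d : ℕ}
    (hd : ∀ W ∈ P, Module.finrank ℝ W ≤ d)
    (hne : ∃ W ∈ P, ∃ g : InnerForm W, Admissible T W g) :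
    ∃ (W' : Submodule ℝ (GroupLieAlgebra (𝓡 n) G)) (g' : InnerForm W'), Admissible T W' g' ∧
      W' ≤ U ∧ Module.finrank ℝ W' ≤ d ∧ ∀ W ∈ P, ∀ g : InnerForm W, Admissible T W g →
        scalarCurvature Q.toInnerForm W g ≤ scalarCurvature Q.toInnerForm W' g' := by
  obtain ⟨τ, hτ, hT⟩ := exists_mul_le_extendForm T
  exact _root_.exists_admissible_forall_le Q.isAdInvariant (form_adAction Q H)
    H.lie_mem_of_adAction_mem hτ hT hU hd hne

variable {T}

/-- An admissible metric as an invariant metric. -/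
def invariantMetric {W : Submodule ℝ (GroupLieAlgebra (𝓡 n) G)} {g : InnerForm W}
    (hg : Admissible T W g) : InvariantMetric H.toSubgroup W where
  toInnerForm := g
  inv a ha x y _ _ := hg.inv ⟨a, ha⟩ x y

theorem admissible_of_invariantMetric {L : LieSubgroup n G}
    {S : LinearMap.BilinForm ℝ (GroupLieAlgebra (𝓡 n) G)}
    {W : Submodule ℝ (GroupLieAlgebra (𝓡 n) G)} (hW : W ≤ L.perp Q)
    (hlie : ∀ x ∈ W, ∀ y ∈ W, ⁅x, y⁆ ∈ L.lieAlg.toSubmodule ⊔ W)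
    (hmap : ∀ a ∈ L.toSubgroup, ∀ x ∈ W, Ad a x ∈ W) (g : InvariantMetric L.toSubgroup W)
    (hg : g.traceForm (S.restrict W) = 1) :
    IsAdmissible Q.toInnerForm L.lieAlg L.adAction S W g.toInnerForm where
  perp _ hw := (L.mem_perp Q).1 (hW hw)
  lie_mem := hlie
  map_mem a x hx := hmap a a.2 x hx
  inv a x y := g.inv a a.2 x y _ _
  trace := hg

theorem Admissible.le_perp {W : Submodule ℝ (GroupLieAlgebra (𝓡 n) G)} {g : InnerForm W}
    (hg : Admissible T W g) : W ≤ H.perp Q := fun w hw => (H.mem_perp Q).2 (hg.perp w hw)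

theorem lie_mem_perp (x y : GroupLieAlgebra (𝓡 n) G) :
    ⁅x, y⁆ ∈ H.lieAlg.toSubmodule ⊔ H.perp Q := by
  rw [sup_perp_eq_top]
  exact Submodule.mem_top

theorem lie_mem_fiber (h : H.lieAlg ≤ K.lieAlg) {x y : GroupLieAlgebra (𝓡 n) G}
    (hx : x ∈ H.fiber Q K) (hy : y ∈ H.fiber Q K) :
    ⁅x, y⁆ ∈ H.lieAlg.toSubmodule ⊔ H.fiber Q K := by
  rw [sup_fiber_eq Q h]
  exact K.lieAlg.lie_mem hx.1 hy.1

variable {K}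

theorem IsIntermediate.admissible (hK : H.IsIntermediate K)
    (g : InvariantMetric H.toSubgroup (H.fiber Q K))
    (hg : g.traceForm (restrictForm T.form (H.fiber_le_perp Q K)) = 1) :
    Admissible T (H.fiber Q K) g.toInnerForm :=
  admissible_of_invariantMetric (H.fiber_le_perp Q K)
    (fun _ hx _ hy => lie_mem_fiber K hK.2.1.le hx hy) (fun _ ha _ hx => Ad_mem_fiber Q hK.1 ha hx) g
    (by rw [restrict_extendForm T (H.fiber_le_perp Q K)]; exact hg)

theorem Admissible.le_alpha {g : InnerForm (H.fiber Q K)} (hg : Admissible T (H.fiber Q K) g) :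
    ((scalarCurvature Q.toInnerForm (H.fiber Q K) g : ℝ) : EReal) ≤ H.alpha Q K T := by
  refine le_iSup₂ (f := fun (h : InvariantMetric H.toSubgroup (H.fiber Q K))
    (_ : h ∈ {h : InvariantMetric H.toSubgroup (H.fiber Q K) |
      h.traceForm (restrictForm T.form (H.fiber_le_perp Q K)) = 1}) =>
    ((scalarCurvature Q.toInnerForm (H.fiber Q K) h.toInnerForm : ℝ) : EReal))
    (invariantMetric hg) ?_
  have := hg.trace
  rw [restrict_extendForm T (H.fiber_le_perp Q K)] at this
  exact this

theorem IsIntermediate.alpha_le (hK : H.IsIntermediate K) {s : ℝ}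
    (h : ∀ g, Admissible T (H.fiber Q K) g → scalarCurvature Q.toInnerForm (H.fiber Q K) g ≤ s) :
    H.alpha Q K T ≤ s :=
  iSup₂_le fun g hg => EReal.coe_le_coe_iff.2 (h _ (hK.admissible g hg))

theorem IsIntermediate.alpha_le_alphaTotal (hK : H.IsIntermediate K) :
    H.alpha Q K T ≤ H.alphaTotal Q T :=
  le_iSup₂ (f := fun (K : LieSubgroup n G) (_ : K ∈ {K : LieSubgroup n G | H.IsIntermediate K}) =>
    H.alpha Q K T) K hK

theorem IsIntermediate.exists_admissible (hK : H.IsIntermediate K) :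
    ∃ g, Admissible T (H.fiber Q K) g ∧ 0 ≤ scalarCurvature Q.toInnerForm (H.fiber Q K) g :=
  exists_admissible_nonneg Q.isAdInvariant (form_adAction Q H)
    (fun _ hw => (H.mem_perp Q).1 (H.fiber_le_perp Q K hw))
    (fun _ hx _ hy => lie_mem_fiber K hK.2.1.le hx hy)
    (fun a _ hx => Ad_mem_fiber Q hK.1 a.2 hx)
    (fun _ hw hne => extendForm_pos T (H.fiber_le_perp Q K hw) hne) (hK.fiber_ne_bot Q)

/-- An admissible metric on a proper subspace of `𝔥^⊥` is a metric on `K/H` for an intermediate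
subgroup `K`. -/
theorem Admissible.exists_isIntermediate {W : Submodule ℝ (GroupLieAlgebra (𝓡 n) G)}
    {g : InnerForm W} (hg : Admissible T W g) (hW : W ≠ H.perp Q) :
    ∃ K : LieSubgroup n G, H.IsIntermediate K ∧ H.fiber Q K = W := by
  have hlieW : ∀ A ∈ H.lieAlg, ∀ x ∈ W, ⁅A, x⁆ ∈ W := H.lie_mem_of_adAction_mem W hg.map_mem
  let 𝔨 : LieSubalgebra ℝ (GroupLieAlgebra (𝓡 n) G) :=
    { H.lieAlg.toSubmodule ⊔ W with
      lie_mem' := by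
        intro x y hx hy
        obtain ⟨A, hA, v, hv, rfl⟩ := Submodule.mem_sup.1 hx
        obtain ⟨B, hB, w, hw, rfl⟩ := Submodule.mem_sup.1 hy
        change ⁅A + v, B + w⁆ ∈ H.lieAlg.toSubmodule ⊔ W
        rw [add_lie, lie_add, lie_add, ← lie_skew v B]
        refine Submodule.add_mem _ (Submodule.add_mem _ ?_ ?_) (Submodule.add_mem _ ?_ ?_)
        · exact Submodule.mem_sup_left (H.lieAlg.lie_mem hA hB)
        · exact Submodule.mem_sup_right (hlieW A hA w hw)
        · exact Submodule.mem_sup_right (Submodule.neg_mem _ (hlieW B hB v hv))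
        · exact hg.lie_mem v hv w hw }
  have h𝔨 : 𝔨.toSubmodule = H.lieAlg.toSubmodule ⊔ W := rfl
  have hle : H.lieAlg ≤ 𝔨 := fun x hx => by
    have : x ∈ H.lieAlg.toSubmodule ⊔ W := Submodule.mem_sup_left hx
    exact this
  obtain ⟨K, hK, hHK⟩ := H.exists_lieAlg_eq 𝔨 hle (by
    intro a ha Y hY
    obtain ⟨A, hA, v, hv, rfl⟩ := Submodule.mem_sup.1 (h𝔨 ▸ hY : Y ∈ H.lieAlg.toSubmodule ⊔ W)
    rw [map_add]
    have : Ad a A + Ad a v ∈ H.lieAlg.toSubmodule ⊔ W :=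
      Submodule.add_mem _ (Submodule.mem_sup_left (H.Ad_mem a ha A hA))
        (Submodule.mem_sup_right (hg.map_mem ⟨a, ha⟩ v hv))
    exact this)
  have hfib : H.fiber Q K = W := by
    rw [fiber, hK, h𝔨]
    refine le_antisymm ?_ (le_inf le_sup_right hg.le_perp)
    rintro x ⟨hx1, hx2⟩
    obtain ⟨A, hA, v, hv, rfl⟩ := Submodule.mem_sup.1 hx1
    have h1 : A ∈ H.perp Q := by
      have := Submodule.sub_mem _ hx2 (hg.le_perp hv)
      rwa [add_sub_cancel_right] at this
    rw [H.mem_of_mem_perp Q h1 hA, zero_add]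
    exact hv
  refine ⟨K, ⟨hHK, lt_of_le_of_ne (hK ▸ hle) fun h => ?_, lt_of_le_of_ne le_top fun h => ?_⟩, hfib⟩
  -- On the zero space every trace vanishes, contradicting trace one; this is what makes the
  -- inclusion `𝔥 ⊂ 𝔨` strict.
  · have hbot : W = ⊥ := by
      rw [eq_bot_iff, ← hfib, fiber, ← h]
      exact fun x hx => H.mem_of_mem_perp Q hx.2 hx.1
    have htr := hg.trace
    subst hbot
    obtain ⟨e, -, he, -⟩ := g.exists_basis 0 (by simp)
    rw [g.traceForm_eq e he, Finset.sum_eq_zero] at htr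
    · exact zero_ne_one htr
    · intro i _
      exact absurd (Subsingleton.elim (e i) 0) (e.ne_zero i)
  · apply hW
    rw [← hfib, fiber, h]
    exact top_inf_eq _

end LieSubgroup

end HomogeneousSpaces

/-! ### Attaining the suprema and the maximal metric -/

section MainTheorem

variable {n : ℕ} {G : Type*} [TopologicalSpace G] [ChartedSpace (EuclideanSpace ℝ (Fin n)) G]
  [Group G] [LieGroup (𝓡 n) ∞ G] [T2Space G]

namespace LieSubgroup

variable {Q : BiinvariantMetric n G} {H K : LieSubgroup n G}

/-- An operator that commutes with `Ad K` commutes with `ad 𝔨`. -/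
theorem lie_frameOp {ι : Type*} [Fintype ι] {b : ι → GroupLieAlgebra (𝓡 n) G} {y : ι → ℝ}
    (h : ∀ a v, K.adAction a (frameOp Q.toInnerForm b y v) =
      frameOp Q.toInnerForm b y (K.adAction a v))
    {A : GroupLieAlgebra (𝓡 n) G} (hA : A ∈ K.lieAlg) (v : GroupLieAlgebra (𝓡 n) G) :
    ⁅A, frameOp Q.toInnerForm b y v⁆ = frameOp Q.toInnerForm b y ⁅A, v⁆ := by
  let B : LinearMap.BilinForm ℝ (GroupLieAlgebra (𝓡 n) G) :=
    LinearMap.mk₂ ℝ (fun v w => Q.form (frameOp Q.toInnerForm b y v) w)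
      (fun v v' w => by
        simp only [frameOp, map_add, LinearMap.add_apply, mul_add, add_smul,
          Finset.sum_add_distrib])
      (fun c v w => by
        simp only [frameOp, map_smul, LinearMap.smul_apply, smul_eq_mul, map_sum,
          LinearMap.sum_apply, Finset.mul_sum]
        exact Finset.sum_congr rfl fun i _ => by ring)
      (fun v w w' => map_add _ w w')
      (fun c v w => map_smul _ c w)
  have hB : ∀ v w, B v w = Q.form (frameOp Q.toInnerForm b y v) w := fun _ _ => rfl
  obtain ⟨γ, h0, hγ, hγK⟩ := K.exists_integralCurve hA
  refine Q.eq_of_form_eq fun w => ?_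
  have key := form_lie_add_form_lie h0 hγ B (x := v) (y := w) (fun t => by
    have h1 : frameOp Q.toInnerForm b y (Ad (γ t) v) = Ad (γ t) (frameOp Q.toInnerForm b y v) :=
      (h ⟨γ t, hγK t⟩ v).symm
    rw [hB, hB, h1, integralCurve_neg h0 hγ, ← Q.inv (γ t) (frameOp Q.toInnerForm b y v),
      Ad_apply_Ad_inv])
  rw [hB, hB] at key
  rw [Q.form_lie]
  linarith

/-- The Lie algebra splits orthogonally into `𝔥`, the fiber and `𝔨^⊥`; a vector orthogonal to the
last two has zero component in `𝔥^⊥`. -/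
theorem mem_lieAlg_of_orthogonal (h : H.lieAlg ≤ K.lieAlg) {v : GroupLieAlgebra (𝓡 n) G}
    (h1 : ∀ w ∈ H.fiber Q K, Q.form v w = 0) (h2 : ∀ w ∈ K.perp Q, Q.form v w = 0) :
    v ∈ H.lieAlg := by
  set A := (Q.proj H.lieAlg.toSubmodule v : GroupLieAlgebra (𝓡 n) G)
  have hA : A ∈ H.lieAlg := (Q.proj H.lieAlg.toSubmodule v).2
  have hu : v - A ∈ H.perp Q := H.sub_proj_mem_perp Q v
  set k := (Q.proj K.lieAlg.toSubmodule (v - A) : GroupLieAlgebra (𝓡 n) G)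
  have hk : k ∈ K.lieAlg := (Q.proj K.lieAlg.toSubmodule (v - A)).2
  have hp : v - A - k ∈ K.perp Q := K.sub_proj_mem_perp Q (v - A)
  have hk' : k ∈ H.fiber Q K := by
    refine ⟨hk, ?_⟩
    have := Submodule.sub_mem _ hu (perp_le_perp Q h hp)
    rwa [sub_sub_cancel] at this
  have h3 : Q.form v (v - A) = 0 := by
    have : v - A = k + (v - A - k) := by abel
    rw [this, map_add, h1 k hk', h2 _ hp, add_zero]
  have h4 : Q.form (v - A) (v - A) = 0 := by
    rw [LinearMap.map_sub₂, h3, Q.symm A, (H.mem_perp Q).1 hu A hA, sub_zero]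
  have h5 : v - A = 0 := by
    by_contra hne
    exact (Q.pos _ hne).ne' h4
  rw [sub_eq_zero.1 h5]
  exact hA

/-- The supremum of the scalar curvature over all intermediate subgroups is attained. -/
theorem exists_alpha_eq_alphaTotal (T : InvariantMetric H.toSubgroup (H.perp Q))
    (h : ∃ K : LieSubgroup n G, H.IsIntermediate K) :
    ∃ K : LieSubgroup n G, H.IsIntermediate K ∧ H.alpha Q K T = H.alphaTotal Q T := by
  obtain ⟨K₀, hK₀⟩ := h
  have hpos : 0 < Module.finrank ℝ (H.perp Q) :=
    (Nat.zero_le _).trans_lt (Submodule.finrank_lt_finrank_of_lt (hK₀.fiber_lt_perp Q))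
  obtain ⟨W, g, hg, -, hd, hmax⟩ := exists_admissible_forall_le T
    (P := {W | ∃ K, H.IsIntermediate K ∧ H.fiber Q K = W}) (U := ⊤) (fun _ _ => le_top)
    -- Fibers are proper subspaces of `𝔥^⊥`; this bound survives the limit and prevents it from
    -- being all of `𝔥^⊥`.
    (d := Module.finrank ℝ (H.perp Q) - 1)
    (by
      rintro _ ⟨K, hK, rfl⟩
      exact Nat.le_sub_one_of_lt (Submodule.finrank_lt_finrank_of_lt (hK.fiber_lt_perp Q)))
    (by
      obtain ⟨g, hg, -⟩ := hK₀.exists_admissible (T := T)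
      exact ⟨_, ⟨K₀, hK₀, rfl⟩, g, hg⟩)
  obtain ⟨K, hK, rfl⟩ := hg.exists_isIntermediate (fun h => by
    rw [h] at hd
    omega)
  refine ⟨K, hK, le_antisymm hK.alpha_le_alphaTotal ((iSup₂_le fun K' hK' => ?_).trans hg.le_alpha)⟩
  exact IsIntermediate.alpha_le hK' fun g' hg' => hmax _ ⟨K', hK', rfl⟩ g' hg'

/-- If `K` has the lowest dimension among the intermediate subgroups with maximal `α`, then `α` is
attained by a metric on `K/H`. -/
theorem IsIntermediate.exists_admissible_eq_alpha {T : InvariantMetric H.toSubgroup (H.perp Q)}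
    (hK : H.IsIntermediate K) (hα : H.alpha Q K T = H.alphaTotal Q T)
    (hmin : ∀ K' : LieSubgroup n G, H.IsIntermediate K' → H.alpha Q K' T = H.alphaTotal Q T →
      Module.finrank ℝ K.lieAlg ≤ Module.finrank ℝ K'.lieAlg) :
    ∃ g, Admissible T (H.fiber Q K) g ∧
      H.alpha Q K T = (scalarCurvature Q.toInnerForm (H.fiber Q K) g : ℝ) ∧
      0 ≤ scalarCurvature Q.toInnerForm (H.fiber Q K) g := by
  obtain ⟨g₀, hg₀, hpos⟩ := hK.exists_admissible (T := T)
  obtain ⟨W, g, hg, hW, -, hmax⟩ := exists_admissible_forall_le T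
    (P := {H.fiber Q K}) (U := H.fiber Q K) (by simp)
    (d := Module.finrank ℝ (H.fiber Q K)) (by simp) ⟨_, rfl, g₀, hg₀⟩
  obtain ⟨K', hK', hKW⟩ := hg.exists_isIntermediate
    (fun h => (hK.fiber_lt_perp Q).not_ge (h ▸ hW))
  subst hKW
  have h1 : H.alpha Q K T ≤ (scalarCurvature Q.toInnerForm (H.fiber Q K') g : ℝ) :=
    hK.alpha_le fun g' hg' => hmax _ rfl g' hg'
  -- The limiting fiber lies in that of `K` and its metric dominates `α_𝔨`, so `K'` is again
  -- optimal; minimality of the dimension then forces equal fibers.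
  have h2 : H.alpha Q K' T = H.alphaTotal Q T :=
    le_antisymm hK'.alpha_le_alphaTotal (hα ▸ h1.trans hg.le_alpha)
  have h3 := hmin K' hK' h2
  rw [finrank_lieAlg_eq Q hK.2.1.le, finrank_lieAlg_eq Q hK'.2.1.le] at h3
  have h4 : H.fiber Q K' = H.fiber Q K :=
    Submodule.eq_of_le_of_finrank_le hW (Nat.le_of_add_le_add_left h3)
  -- Generalizing over the subspace allows the metric, whose type depends on it, to be transported
  -- along `h4`.
  have h5 : ∀ W, W = H.fiber Q K → ∀ g : InnerForm W, Admissible T W g →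
      H.alpha Q K T ≤ (scalarCurvature Q.toInnerForm W g : ℝ) →
      scalarCurvature Q.toInnerForm (H.fiber Q K) g₀ ≤ scalarCurvature Q.toInnerForm W g →
      ∃ g, Admissible T (H.fiber Q K) g ∧
      H.alpha Q K T = (scalarCurvature Q.toInnerForm (H.fiber Q K) g : ℝ) ∧
      0 ≤ scalarCurvature Q.toInnerForm (H.fiber Q K) g := by
    rintro _ rfl g hg hle h0
    exact ⟨g, hg, le_antisymm hle hg.le_alpha, hpos.trans h0⟩
  exact h5 _ h4 g hg h1 (hmax _ rfl g₀ hg₀)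

theorem admissible_perp {T : InvariantMetric H.toSubgroup (H.perp Q)}
    (g : InvariantMetric H.toSubgroup (H.perp Q)) (hg : g.traceForm T.form = 1) :
    Admissible T (H.perp Q) g.toInnerForm :=
  admissible_of_invariantMetric le_rfl (fun x _ y _ => lie_mem_perp x y)
    (fun _ ha _ hx => H.Ad_mem_perp Q ha hx) g
    (by rw [restrict_extendForm T le_rfl]; exact hg)

theorem Admissible.traceForm_perp {T : InvariantMetric H.toSubgroup (H.perp Q)}
    {g : InnerForm (H.perp Q)} (hg : Admissible T (H.perp Q) g) : g.traceForm T.form = 1 := by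
  have := hg.trace
  rw [restrict_extendForm T le_rfl] at this
  exact this

/-- If the base `G/K` has a metric with larger scalar curvature than a metric on the fiber `K/H`,
then so has `G/H`. -/
theorem IsIntermediate.exists_admissible_perp_gt {T : InvariantMetric H.toSubgroup (H.perp Q)}
    (hK : H.IsIntermediate K) {g : InnerForm (H.fiber Q K)} (hg : Admissible T (H.fiber Q K) g)
    (f : InvariantMetric K.toSubgroup (K.perp Q))
    (hf : f.traceForm (restrictForm T.form (perp_le_perp Q hK.2.1.le)) = 1)
    (hlt : scalarCurvature Q.toInnerForm (H.fiber Q K) g <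
      scalarCurvature Q.toInnerForm (K.perp Q) f.toInnerForm) :
    ∃ g', Admissible T (H.perp Q) g' ∧ scalarCurvature Q.toInnerForm (H.fiber Q K) g <
      scalarCurvature Q.toInnerForm (H.perp Q) g' := by
  have hf' : IsAdmissible Q.toInnerForm K.lieAlg K.adAction (extendForm T) (K.perp Q)
      f.toInnerForm :=
    admissible_of_invariantMetric le_rfl (fun x _ y _ => lie_mem_perp x y)
      (fun _ ha _ hx => K.Ad_mem_perp Q ha hx) f
      (by rw [restrict_extendForm T (perp_le_perp Q hK.2.1.le)]; exact hf)
  obtain ⟨b, y, hb, hbs, hbg⟩ := hg.exists_frame Q.isAdInvariant (form_adAction Q H)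
  obtain ⟨b', y', hb', hbs', hbg'⟩ := hf'.exists_frame Q.isAdInvariant (form_adAction Q K)
  have hbm : ∀ i, b i ∈ H.fiber Q K := fun i => hbs.le (Submodule.subset_span ⟨i, rfl⟩)
  have hbm' : ∀ i, b' i ∈ K.perp Q := fun i => hbs'.le (Submodule.subset_span ⟨i, rfl⟩)
  have hspan : ∀ {κ : Type} (c : κ → GroupLieAlgebra (𝓡 n) G) (v : GroupLieAlgebra (𝓡 n) G),
      (∀ i, Q.form v (c i) = 0) → ∀ w ∈ Submodule.span ℝ (Set.range c), Q.form v w = 0 := by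
    intro κ c v hv w hw
    induction hw using Submodule.span_induction with
    | mem x hx => obtain ⟨i, rfl⟩ := hx; exact hv i
    | zero => simp
    | add x y _ _ hx hy => rw [map_add, hx, hy, add_zero]
    | smul c x _ hx => rw [map_smul, hx, smul_zero]
  have hcompl : ∀ v, (∀ i, Q.form v (b i) = 0) → (∀ j, Q.form v (b' j) = 0) → v ∈ H.lieAlg :=
    fun v h1 h2 => mem_lieAlg_of_orthogonal hK.2.1.le (hbs ▸ hspan b v h1) (hbs' ▸ hspan b' v h2)
  rw [hbg, hbg'] at hlt
  obtain ⟨z, hz, hzlt⟩ := exists_frame_lt_scal Q.isAdInvariant hb hb' hK.2.1.le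
    (fun i => (hbm i).1) (fun a => ⟨⟨a, hK.1 a.2⟩, rfl⟩) hcompl
    (fun A hA v => lie_frameOp hb'.comm hA v) le_rfl hlt
  have hzspan : Submodule.span ℝ (Set.range (Sum.elim b b')) = H.perp Q := by
    refine le_antisymm (Submodule.span_le.2 ?_) fun v hv => ?_
    · rintro _ ⟨i | i, rfl⟩
      · exact (hbm i).2
      · exact perp_le_perp Q hK.2.1.le (hbm' i)
    · set w := ∑ i, Q.form v (Sum.elim b b' i) • Sum.elim b b' i
      have hw : w ∈ Submodule.span ℝ (Set.range (Sum.elim b b')) :=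
        Submodule.sum_mem _ fun i _ => Submodule.smul_mem _ _ (Submodule.subset_span ⟨i, rfl⟩)
      have hwp : w ∈ H.perp Q := (H.mem_perp Q).2 fun A hA => by
        simp only [w, map_sum, LinearMap.sum_apply, map_smul, LinearMap.smul_apply, hz.perp _ A hA,
          smul_zero, Finset.sum_const_zero]
      have horth : ∀ l, Q.form (v - w) (Sum.elim b b' l) = 0 := fun l => by
        simp only [w, map_sub, LinearMap.sub_apply, map_sum, LinearMap.sum_apply, map_smul,
          LinearMap.smul_apply, hz.orthonormal, smul_eq_mul]
        simp
      have h0 := H.mem_of_mem_perp Q (Submodule.sub_mem _ hv hwp)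
        (hcompl _ (fun l => horth (.inl l)) (fun l => horth (.inr l)))
      rwa [sub_eq_zero.1 h0]
  obtain ⟨g', hg', hgs⟩ := hz.exists_metric Q.isAdInvariant (form_adAction Q H) hzspan
  exact ⟨g', hg', by rw [hbg, hgs]; exact hzlt⟩

/-- A metric with maximal scalar curvature among the metrics with `tr_g T = 1` satisfies
`Ric = S T`. -/
theorem ricci_eq_of_forall_le {T : InvariantMetric H.toSubgroup (H.perp Q)}
    {g : InnerForm (H.perp Q)} (hg : Admissible T (H.perp Q) g)
    (hmax : ∀ g', Admissible T (H.perp Q) g' →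
      scalarCurvature Q.toInnerForm (H.perp Q) g' ≤ scalarCurvature Q.toInnerForm (H.perp Q) g) :
    ricci Q.toInnerForm (H.perp Q) g =
      scalarCurvature Q.toInnerForm (H.perp Q) g • T.form := by
  refine ricci_eq_of_scalarCurvature_le Q.isAdInvariant _ g T.form T.symm hg.traceForm_perp
    fun g' t hg' => ?_
  -- The variation `Ric - S T` is itself `Ad_H`-invariant by naturality of `Ric`, so maximality
  -- among invariant metrics is enough.
  have hinv : ∀ a ∈ H.toSubgroup, ∀ (x y : H.perp Q)
      (hx : Ad a (x : GroupLieAlgebra (𝓡 n) G) ∈ H.perp Q)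
      (hy : Ad a (y : GroupLieAlgebra (𝓡 n) G) ∈ H.perp Q),
      g'.form ⟨Ad a (x : GroupLieAlgebra (𝓡 n) G), hx⟩ ⟨Ad a (y : GroupLieAlgebra (𝓡 n) G), hy⟩
        = g'.form x y := by
    intro a ha x y hx hy
    have h1 := ricci_map Q.toInnerForm g (Ad a) (Ad_lie a) (Q.inv a)
      (fun x hx => H.Ad_mem_perp Q ha hx) (fun x y => hg.inv ⟨a, ha⟩ x y) x y
    have h2 : g.form ⟨Ad a (x : GroupLieAlgebra (𝓡 n) G), hx⟩
      ⟨Ad a (y : GroupLieAlgebra (𝓡 n) G), hy⟩ = g.form x y := hg.inv ⟨a, ha⟩ x y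
    simp only [hg', LinearMap.add_apply, LinearMap.smul_apply, LinearMap.sub_apply, h1, h2,
      T.inv a ha x y hx hy]
  have htr : 0 < g'.traceForm T.form := by
    obtain ⟨e, -, he, -⟩ := g'.exists_basis 0 (by simp)
    rw [g'.traceForm_eq e he]
    have : Nonempty (Fin (Module.finrank ℝ (H.perp Q))) := by
      by_contra hc
      rw [not_nonempty_iff] at hc
      have h1 := hg.traceForm_perp
      obtain ⟨e, -, he, -⟩ := g.exists_basis 0 (by simp)
      rw [g.traceForm_eq e he] at h1
      simp at h1
    refine Finset.sum_pos (fun i _ => ?_) Finset.univ_nonempty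
    rw [div_one]
    exact T.pos _ (e.ne_zero i)
  -- The competitor is rescaled to trace one; since `S` and the trace are both homogeneous of degree
  -- `-1`, this gives the scale-free inequality.
  have h1 := hmax _ (admissible_perp (T := T)
    { toInnerForm := g'.smul _ htr
      inv := fun a ha x y hx hy => by
        rw [InnerForm.smul_form_apply, InnerForm.smul_form_apply, hinv a ha x y hx hy] }
    (by rw [InnerForm.traceForm_smul, div_self htr.ne']))
  rw [scalarCurvature_smul Q.isAdInvariant, div_le_iff₀ htr] at h1
  exact h1

end LieSubgroup

end MainTheorem

/-! ### Assembly of the theorem -/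

theorem mainTheorem1 {n : ℕ} {G : Type*} [TopologicalSpace G]
    [ChartedSpace (EuclideanSpace ℝ (Fin n)) G] [Group G] [LieGroup (𝓡 n) ∞ G]
    [T2Space G] [CompactSpace G]
    (Q : BiinvariantMetric n G)
    (H : LieSubgroup n G) (hH : IsCompact (H.toSubgroup : Set G))
    (T : InvariantMetric H.toSubgroup (H.perp Q))
    (hmax : ∃ K : LieSubgroup n G, H.IsIntermediate K) :
    (∃ K : LieSubgroup n G, H.IsIntermediate K ∧ H.alpha Q K T = H.alphaTotal Q T) ∧
    ∀ (K : LieSubgroup n G) (hK : H.IsIntermediate K),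
      H.alpha Q K T = H.alphaTotal Q T →
      (∀ K' : LieSubgroup n G, H.IsIntermediate K' → H.alpha Q K' T = H.alphaTotal Q T →
        Module.finrank ℝ K.lieAlg ≤ Module.finrank ℝ K'.lieAlg) →
      0 < LieSubgroup.beta Q T hK - H.alpha Q K T →
      ∃ g ∈ H.metricsT Q T,
        (∀ g' ∈ H.metricsT Q T,
          scalarCurvature Q.toInnerForm (H.perp Q) g'.toInnerForm ≤
            scalarCurvature Q.toInnerForm (H.perp Q) g.toInnerForm) ∧
        ∃ c : ℝ, 0 < c ∧ ricci Q.toInnerForm (H.perp Q) g.toInnerForm = c • T.form := by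
  refine ⟨LieSubgroup.exists_alpha_eq_alphaTotal T hmax, fun K hK hα hmin hβ => ?_⟩
  obtain ⟨h, hh, hhα, hh0⟩ := hK.exists_admissible_eq_alpha hα hmin
  rw [EReal.sub_pos, hhα, LieSubgroup.beta] at hβ
  obtain ⟨f, hf⟩ := lt_iSup_iff.1 hβ
  obtain ⟨hftr, hf⟩ := lt_iSup_iff.1 hf
  obtain ⟨g₁, hg₁, hlt⟩ := hK.exists_admissible_perp_gt hh f hftr (EReal.coe_lt_coe_iff.1 hf)
  obtain ⟨W, g, hg, -, -, hgmax⟩ := LieSubgroup.exists_admissible_forall_le T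
    (P := {H.perp Q}) (U := ⊤) (by simp) (d := Module.finrank ℝ (H.perp Q)) (by simp)
    ⟨_, rfl, g₁, hg₁⟩
  have hgt := hlt.trans_le (hgmax _ rfl g₁ hg₁)
  -- A degenerate maximizer would live on some `K'/H`, giving scalar curvature at most `α_{G/H}`,
  -- although it exceeds that value by `hgt`.
  have hW : W = H.perp Q := by
    by_contra hne
    obtain ⟨K', hK', rfl⟩ := hg.exists_isIntermediate hne
    have h1 := hg.le_alpha.trans (hK'.alpha_le_alphaTotal.trans_eq (hα.symm.trans hhα))
    exact (EReal.coe_le_coe_iff.1 h1).not_gt hgt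
  subst hW
  have hmaxg : ∀ g', LieSubgroup.Admissible T (H.perp Q) g' → _ := fun g' hg' => hgmax _ rfl g' hg'
  -- The constant is `c = S(g)`, positive because it exceeds the non-negative scalar curvature of
  -- the optimal fiber metric.
  refine ⟨LieSubgroup.invariantMetric hg, hg.traceForm_perp,
    fun g' hg' => hmaxg _ (LieSubgroup.admissible_perp g' hg'), _, hh0.trans_lt hgt,
    LieSubgroup.ricci_eq_of_forall_le hg hmaxg⟩
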